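/- All manifolds are real, finite-dimensional, $C^\infty$, Hausdorff and second countable; all maps and forms are $C^\infty$. A presymplectic form is a closed degenerate 2-form whose kernel has constant rank; a symplectic form is a closed non-degenerate 2-form. Let $(M,\Omega)$ be a connected presymplectic manifold and $G$ a connected Lie group with Lie algebra $\mathfrak g$, acting smoothly, freely and properly on $M$ with $\Phi_g^*\Omega=\Omega$ for all $g\in G$. For $\xi\in\mathfrak g$ let $\tilde\xi$ be its fundamental vector field, $\tilde\xi_x=\frac{d}{dt}\big|_{t=0}\exp(t\xi)\cdot x$. Assume that the action is Poissonian with momentum map $J\colon M\to\mathfrak g^*$: the functions $f_\xi=\langle J(\cdot),\xi\rangle$ are smooth and satisfy $i(\tilde\xi)\Omega=df_\xi$ and $f_{[\xi,\eta]}=\{f_\xi,f_\eta\}:=\Omega(\tilde\xi,\tilde\eta)$ for all $\xi,\eta\in\mathfrak g$. Let $\mu\in\mathfrak g^*$ be a weakly regular value of $J$, i.e. $J^{-1}(\mu)$ is an (embedded) submanifold of $M$ and $T_xJ^{-1}(\mu)=\ker T_xJ$ for all $x\in J^{-1}(\mu)$. Let $j_\mu\colon J^{-1}(\mu)\hookrightarrow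 M$ be the inclusion, $\Omega_\mu=j_\mu^*\Omega$, let $G_\mu$ be the isotropy group of $\mu$ for the coadjoint action, $\mathfrak g_\mu$ its Lie algebra, and put $\tilde{\mathfrak g}_x=\{\tilde\xi_x:\xi\in\mathfrak g\}$ and $\tilde{\mathfrak g}_{\mu,x}=\{\tilde\xi_x:\xi\in\mathfrak g_\mu\}$. Then $G_\mu$ leaves $J^{-1}(\mu)$ invariant, and the orbit space $J^{-1}(\mu)/G_\mu$, with the quotient topology, has the structure of a manifold for which the canonical projection $\sigma\colon J^{-1}(\mu)\to J^{-1}(\mu)/G_\mu$ is a smooth submersion. There is a closed 2-form $\hat\Omega$ on $J^{-1}(\mu)/G_\mu$ such that $\sigma^*\hat\Omega=\Omega_\mu$, and: 1. $\hat\Omega$ is symplectic if and only if $\tilde{\mathfrak g}_{\mu,x}=\ker(\Omega_\mu)_x$ for every $x\in J^{-1}(\mu)$; and for each $x\in J^{-1}(\mu)$ this equality is equivalent to $\ker\Omega_x\cap T_xJ^{-1}(\mu)\subseteq\tilde{\mathfrak g}_{\mu,x}$. 2. Otherwise $\hat\Omega$ is presymplectic. In particular, for every $x\in J^{-1}(\mu)$,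 if $\ker\Omega_x\subseteq T_xJ^{-1}(\mu)$ and $\tilde{\mathfrak g}_x\cap\ker\Omega_x=\{0\}$, then $\dim\ker\hat\Omega_{\sigma(x)}=\dim\ker\Omega_x$. -/

import Mathlib

open scoped Manifold ContDiff
open Manifold

noncomputable section

namespace PresymplecticReduction

/-! ### Differential 2-forms on manifolds without boundary -/

section Forms

variable {E : Type*} [NormedAddCommGroup E] [NormedSpace ℝ E]
  {M : Type*} [TopologicalSpace M] [ChartedSpace E M]
  {E' : Type*} [NormedAddCommGroup E'] [NormedSpace ℝ E']
  {M' : Type*} [TopologicalSpace M'] [ChartedSpace E' M']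

variable (E M) in
/-- A (not necessarily continuous) field of alternating bilinear forms on the tangent spaces
of `M`. -/
abbrev TwoForm : Type _ := ∀ x : M, TangentSpace 𝓘(ℝ, E) x [⋀^Fin 2]→L[ℝ] ℝ

/-- The pull-back `f^* α` of a 2-form by a map `f`. -/
def pullback (f : M → M') (α : TwoForm E' M') : TwoForm E M :=
  fun x => (α (f x)).compContinuousLinearMap (mfderiv 𝓘(ℝ, E) 𝓘(ℝ, E') f x)

/-- The coordinate expression of a 2-form in the chart around `p`: the pull-back of the form by
the inverse of the chart, a 2-form on the target of the chart in the model vector space. -/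
def chartForm (α : TwoForm E M) (p : M) : E → E [⋀^Fin 2]→L[ℝ] ℝ :=
  fun y => (α ((extChartAt 𝓘(ℝ, E) p).symm y)).compContinuousLinearMap
    (mfderiv 𝓘(ℝ, E) 𝓘(ℝ, E) (extChartAt 𝓘(ℝ, E) p).symm y)

/-- The form is `C^∞`: so are its coordinate expressions. -/
def IsSmoothForm (α : TwoForm E M) : Prop :=
  ∀ p : M, ContDiffOn ℝ ∞ (chartForm α p) (extChartAt 𝓘(ℝ, E) p).target

/-- The form is closed: the exterior derivatives of its coordinate expressions vanish. -/
def IsClosedForm (α : TwoForm E M) : Prop :=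
  ∀ p : M, ∀ y ∈ (extChartAt 𝓘(ℝ, E) p).target, extDeriv (chartForm α p) y = 0

/-- The kernel `ker α_x = {v ∈ T_x M | α_x(v, w) = 0 for all w ∈ T_x M}`. -/
def formKer (α : TwoForm E M) (x : M) : Submodule ℝ (TangentSpace 𝓘(ℝ, E) x) where
  carrier := {v | ∀ w : TangentSpace 𝓘(ℝ, E) x, α x ![v, w] = 0}
  zero_mem' := fun w => (α x).map_coord_zero (m := ![0, w]) 0 rfl
  add_mem' := by
    intro a b ha hb w
    have h := (α x).toAlternatingMap.map_vecCons_add ![w] a b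
    change α x ![a + b, w] = α x ![a, w] + α x ![b, w] at h
    rw [h, ha w, hb w, add_zero]
  smul_mem' := by
    intro c a ha w
    have h := (α x).toAlternatingMap.map_vecCons_smul ![w] c a
    change α x ![c • a, w] = c • α x ![a, w] at h
    rw [h, ha w, smul_zero]

/-- A symplectic form: a smooth, closed, non-degenerate 2-form. -/
structure IsSymplecticForm (α : TwoForm E M) : Prop where
  smooth : IsSmoothForm α
  closed : IsClosedForm α
  nondegenerate : ∀ x : M, formKer α x = ⊥

/-- A presymplectic form: a smooth, closed, degenerate 2-form whose kernel has constant rank. -/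
structure IsPresymplecticForm (α : TwoForm E M) : Prop where
  smooth : IsSmoothForm α
  closed : IsClosedForm α
  degenerate : ∃ r : ℕ, 0 < r ∧ ∀ x : M, Module.finrank ℝ (formKer α x) = r

end Forms

/-! ### Lie groups and actions -/

section LieGroups

variable {E_G : Type*} [NormedAddCommGroup E_G] [NormedSpace ℝ E_G]
  {G : Type*} [TopologicalSpace G] [ChartedSpace E_G G] [Group G]

/-- The adjoint representation: `Ad g` is the differential at `1` of `h ↦ g h g⁻¹`. -/
def Ad (g : G) : GroupLieAlgebra 𝓘(ℝ, E_G) G →L[ℝ] GroupLieAlgebra 𝓘(ℝ, E_G) G :=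
  (mfderiv 𝓘(ℝ, E_G) 𝓘(ℝ, E_G) (fun h : G => g * h * g⁻¹) 1 : E_G →L[ℝ] E_G)

lemma Ad_one (ξ : GroupLieAlgebra 𝓘(ℝ, E_G) G) : Ad (1 : G) ξ = ξ := by
  have h : (fun h : G => 1 * h * 1⁻¹) = id := by
    funext h
    simp
  unfold Ad
  rw [h]
  exact congrArg (fun A : TangentSpace 𝓘(ℝ, E_G) (1 : G) →L[ℝ] TangentSpace 𝓘(ℝ, E_G) (1 : G) =>
    A ξ) (mfderiv_id (I := 𝓘(ℝ, E_G)) (x := (1 : G)))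

lemma Ad_mul [LieGroup 𝓘(ℝ, E_G) ∞ G] (g h : G) (ξ : GroupLieAlgebra 𝓘(ℝ, E_G) G) :
    Ad (g * h) ξ = Ad g (Ad h ξ) := by
  have hd : ∀ (a b : G),
      MDifferentiableAt 𝓘(ℝ, E_G) 𝓘(ℝ, E_G) (fun k : G => a * k * a⁻¹) b := by
    intro a b
    have h2 : ContMDiff 𝓘(ℝ, E_G) 𝓘(ℝ, E_G) ∞ (fun k : G => a * k * a⁻¹) :=
      (contMDiff_mul_right (I := 𝓘(ℝ, E_G)) (n := ∞) (a := a⁻¹)).comp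
        (contMDiff_mul_left (I := 𝓘(ℝ, E_G)) (n := ∞) (a := a))
    exact h2.mdifferentiableAt (by simp)
  have hcomp : (fun k : G => g * h * k * (g * h)⁻¹)
      = (fun k : G => g * k * g⁻¹) ∘ (fun k : G => h * k * h⁻¹) := by
    funext k
    simp [mul_assoc]
  have hpt : ∀ (p : G), p = 1 → ∀ v : E_G,
      (mfderiv 𝓘(ℝ, E_G) 𝓘(ℝ, E_G) (fun k : G => g * k * g⁻¹) p : E_G →L[ℝ] E_G) v
        = (mfderiv 𝓘(ℝ, E_G) 𝓘(ℝ, E_G) (fun k : G => g * k * g⁻¹) 1 : E_G →L[ℝ] E_G) v := by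
    rintro p rfl v
    rfl
  have hm := mfderiv_comp (I := 𝓘(ℝ, E_G)) (I' := 𝓘(ℝ, E_G)) (I'' := 𝓘(ℝ, E_G)) (1 : G)
    (hd g (h * 1 * h⁻¹)) (hd h 1)
  unfold Ad
  rw [hcomp]
  refine (congrArg (fun A : E_G →L[ℝ] E_G => A ξ) hm).trans ?_
  exact hpt (h * 1 * h⁻¹) (by simp) _

/-- The isotropy group `G_μ` of `μ ∈ 𝔤^*` for the coadjoint action
`Ad^*_g μ = μ ∘ Ad g⁻¹`. -/
def isotropy [LieGroup 𝓘(ℝ, E_G) ∞ G]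
    (μ : Module.Dual ℝ (GroupLieAlgebra 𝓘(ℝ, E_G) G)) : Subgroup G where
  carrier := {g | ∀ ξ : GroupLieAlgebra 𝓘(ℝ, E_G) G, μ (Ad g⁻¹ ξ) = μ ξ}
  one_mem' := by
    intro ξ
    rw [inv_one, Ad_one]
  mul_mem' := by
    intro a b ha hb ξ
    rw [mul_inv_rev, Ad_mul, hb, ha]
  inv_mem' := by
    intro a ha ξ
    have h := ha (Ad a⁻¹⁻¹ ξ)
    rw [← Ad_mul, mul_inv_cancel, Ad_one] at h
    exact h.symm

/-- The Lie algebra of a (closed) subgroup `H` of `G`: the initial velocities of the smooth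
one-parameter subgroups of `G` that are contained in `H`. -/
def subgroupLieAlgebra (H : Subgroup G) : Set (GroupLieAlgebra 𝓘(ℝ, E_G) G) :=
  {ξ | ∃ γ : ℝ → G, ContMDiff 𝓘(ℝ, ℝ) 𝓘(ℝ, E_G) ∞ γ ∧
    (∀ s t : ℝ, γ (s + t) = γ s * γ t) ∧ (∀ t : ℝ, γ t ∈ H) ∧
    (mfderiv 𝓘(ℝ, ℝ) 𝓘(ℝ, E_G) γ 0 : ℝ →L[ℝ] E_G) 1 = ξ}

variable {E : Type*} [NormedAddCommGroup E] [NormedSpace ℝ E]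
  {M : Type*} [TopologicalSpace M] [ChartedSpace E M] [MulAction G M]

/-- The fundamental vector field `ξ̃` of `ξ ∈ 𝔤`: the value of `ξ̃` at `x` is the image of `ξ` by
the differential at `1` of the orbit map `g ↦ g • x`. -/
def fundamental (ξ : GroupLieAlgebra 𝓘(ℝ, E_G) G) (x : M) : TangentSpace 𝓘(ℝ, E) x :=
  (mfderiv 𝓘(ℝ, E_G) 𝓘(ℝ, E) (fun g : G => g • x) 1 : E_G →L[ℝ] E) ξ

variable (E_G G E) in
/-- The set `𝔤̃_x` of values at `x` of all fundamental vector fields. -/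
def fundamentalSpace (x : M) : Set (TangentSpace 𝓘(ℝ, E) x) :=
  Set.range fun ξ : GroupLieAlgebra 𝓘(ℝ, E_G) G => fundamental ξ x

variable (E) in
/-- The set `𝔤̃_{μ,x}` of values at `x` of the fundamental vector fields given by the elements of
the Lie algebra `𝔤_μ` of the isotropy group `G_μ`. -/
def isotropyFundamentalSpace [LieGroup 𝓘(ℝ, E_G) ∞ G]
    (μ : Module.Dual ℝ (GroupLieAlgebra 𝓘(ℝ, E_G) G)) (x : M) :
    Set (TangentSpace 𝓘(ℝ, E) x) :=
  (fun ξ : GroupLieAlgebra 𝓘(ℝ, E_G) G => fundamental ξ x) '' subgroupLieAlgebra (isotropy μ)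

/-- `G` acts by presymplectic transformations: `Φ_g^* Ω = Ω` for all `g`. -/
def IsPresymplecticAction (G : Type*) [Group G] [MulAction G M] (Ω : TwoForm E M) : Prop :=
  ∀ g : G, pullback (fun x : M => g • x) Ω = Ω

/-- The differential at `x` of the component `x ↦ J(x)(ξ)` of `J : M → 𝔤^*`. -/
def dComponent (J : M → Module.Dual ℝ (GroupLieAlgebra 𝓘(ℝ, E_G) G))
    (ξ : GroupLieAlgebra 𝓘(ℝ, E_G) G) (x : M) : TangentSpace 𝓘(ℝ, E) x →L[ℝ] ℝ :=
  mfderiv 𝓘(ℝ, E) 𝓘(ℝ, ℝ) (fun y : M => J y ξ) x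

/-- `J : M → 𝔤^*` is a momentum mapping of a Poissonian action: its transpose `ξ ↦ f_ξ`,
`f_ξ(x) = J(x)(ξ)`, is a linear map of `𝔤` into the smooth functions with `i(ξ̃)Ω = df_ξ`
(a comomentum mapping), and it is a homomorphism of Lie algebras, `f_{[ξ,η]} = {f_ξ, f_η}`.
The Poisson bracket of two Hamiltonian functions is the value of `Ω` on Hamiltonian
vector fields of theirs, so `{f_ξ, f_η} = Ω(ξ̃, η̃)`. -/
structure IsPoissonianMomentumMap (Ω : TwoForm E M)
    (J : M → Module.Dual ℝ (GroupLieAlgebra 𝓘(ℝ, E_G) G)) : Prop where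
  smooth : ∀ ξ : GroupLieAlgebra 𝓘(ℝ, E_G) G,
    ContMDiff 𝓘(ℝ, E) 𝓘(ℝ, ℝ) ∞ (fun x : M => J x ξ)
  hamiltonian : ∀ (ξ : GroupLieAlgebra 𝓘(ℝ, E_G) G) (x : M) (v : TangentSpace 𝓘(ℝ, E) x),
    Ω x ![fundamental ξ x, v] = dComponent J ξ x v
  lie_hom : ∀ (ξ η : GroupLieAlgebra 𝓘(ℝ, E_G) G) (x : M),
    J x ⁅ξ, η⁆ = Ω x ![fundamental ξ x, fundamental η x]

/-- `ker T_x J`. Since `𝔤^*` is a vector space, `T_x J (v)` is the functional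
`ξ ↦ d(J(·)(ξ))_x (v)`. -/
def momentumKer (J : M → Module.Dual ℝ (GroupLieAlgebra 𝓘(ℝ, E_G) G)) (x : M) :
    Submodule ℝ (TangentSpace 𝓘(ℝ, E) x) :=
  ⨅ ξ : GroupLieAlgebra 𝓘(ℝ, E_G) G, (dComponent J ξ x).ker

/-! ### Level sets of the momentum map and the reduced space -/

/-- The level set `J⁻¹(μ)`, with the subspace topology. -/
abbrev LevelSet (J : M → Module.Dual ℝ (GroupLieAlgebra 𝓘(ℝ, E_G) G))
    (μ : Module.Dual ℝ (GroupLieAlgebra 𝓘(ℝ, E_G) G)) : Type _ :=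
  {x : M // J x = μ}

section LevelSets

variable (J : M → Module.Dual ℝ (GroupLieAlgebra 𝓘(ℝ, E_G) G))
  (μ : Module.Dual ℝ (GroupLieAlgebra 𝓘(ℝ, E_G) G))

/-- The inclusion `j_μ : J⁻¹(μ) → M`. -/
abbrev inclusion : LevelSet J μ → M := Subtype.val

variable (E) (F : Type*) [NormedAddCommGroup F] [NormedSpace ℝ F] [ChartedSpace F (LevelSet J μ)]

/-- The tangent space `T_x J⁻¹(μ)`, as a subspace of `T_x M`, for a manifold structure on
`J⁻¹(μ)`. -/
def levelTangent (x : LevelSet J μ) : Submodule ℝ (TangentSpace 𝓘(ℝ, E) (inclusion J μ x)) :=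
  (mfderiv 𝓘(ℝ, F) 𝓘(ℝ, E) (inclusion J μ) x).range

/-- `μ` is a weakly regular value of `J`: the level set `J⁻¹(μ)`, with its given manifold
structure, is a submanifold of `M`, and `T_x J⁻¹(μ) = ker T_x J` for all `x ∈ J⁻¹(μ)`. -/
structure IsWeaklyRegularValue : Prop where
  isManifold : IsManifold 𝓘(ℝ, F) ∞ (LevelSet J μ)
  embedding : IsSmoothEmbedding 𝓘(ℝ, F) 𝓘(ℝ, E) ∞ (inclusion J μ)
  tangent : ∀ x : LevelSet J μ, levelTangent E J μ F x = momentumKer J (inclusion J μ x)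

end LevelSets

section Reduced

variable [LieGroup 𝓘(ℝ, E_G) ∞ G]
  (J : M → Module.Dual ℝ (GroupLieAlgebra 𝓘(ℝ, E_G) G))
  (μ : Module.Dual ℝ (GroupLieAlgebra 𝓘(ℝ, E_G) G))

/-- Two points of `J⁻¹(μ)` are equivalent if they are in the same `G_μ`-orbit. -/
abbrev orbitSetoid : Setoid (LevelSet J μ) :=
  (MulAction.orbitRel (isotropy μ) M).comap Subtype.val

/-- The reduced space `J⁻¹(μ)/G_μ`, with the quotient topology. -/
abbrev ReducedSpace : Type _ := Quotient (orbitSetoid J μ)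

/-- The canonical projection `σ : J⁻¹(μ) → J⁻¹(μ)/G_μ`. -/
abbrev proj : LevelSet J μ → ReducedSpace J μ := Quotient.mk (orbitSetoid J μ)

end Reduced

end LieGroups

end PresymplecticReduction

end

/-! The bracket condition makes `J` equivariant. Along `ξ`, the derivative at `1` of `h ↦ ⟨J(h • y),
Ad_h ζ⟩` is `Ω(ζ̃, ξ̃) + J([ξ, ζ]) = Ω(ζ̃, ξ̃) + Ω(ξ̃, ζ̃) = 0`, and `G` is connected
(`IsPoissonianMomentumMap.equivariant`). Hence `g ∈ G_μ` as soon as `g` maps one point of `J⁻¹(μ)`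
into `J⁻¹(μ)`. The `G_μ`-classes are therefore the traces of the `G`-orbits, and `𝔤̃_μ` consists of
the vectors tangent both to the level set and to the orbit.

The quotient is built without using a Lie group structure on `G_μ`. A free proper action of `G` has,
near each point of `M`, a submersion whose fibres are the local orbits
(`exists_submersion_of_free_proper`). Its restriction to `J⁻¹(μ)` has differential with kernel
`𝔤̃_μ`, whose dimension is constant because the action is free. The constant rank theorem
(`exists_local_section_of_finrank_ker_eq`) then gives local submersions with sections
(`exists_slice`), and these are glued to charts by `exists_quotient_manifold`.

By the momentum equation and weak regularity, `T J⁻¹(μ)` is the `Ω`-orthogonal of `𝔤̃`. So `𝔤̃_μ`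
lies in `ker Ω_μ`, and by invariance `Ω_μ` descends pointwise. Near each point the reduced form is
the pull-back of `Ω` by `j_μ` composed with a section of `σ`, hence it is smooth and closed
(`exists_reduced_form`).

The rest is linear algebra. The double orthogonal of `𝔤̃` is `𝔤̃ + ker Ω`, so `ker Ω_μ = 𝔤̃_μ + ker
Ω`. This gives the symplectic criterion (`ker_restrict_iff`) and `dim ker Ω̂ = dim ker Ω - dim (𝔤̃ ∩
ker Ω)` (`finrank_ker_reduced_add`). Finally `dim (𝔤̃ ∩ ker Ω) = dim G + dim J⁻¹(μ) - dim M` does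
not depend on the point, so `Ω̂` has constant rank. -/

noncomputable section

namespace PresymplecticReduction

open Set Filter Topology

set_option linter.unusedSectionVars false

/-! ### Differentials as linear maps of model spaces, and their chart expressions. -/

section Differential

variable (E : Type*) [NormedAddCommGroup E] [NormedSpace ℝ E]
  {M : Type*} [TopologicalSpace M] [ChartedSpace E M]
  (E' : Type*) [NormedAddCommGroup E'] [NormedSpace ℝ E']
  {M' : Type*} [TopologicalSpace M'] [ChartedSpace E' M']
  (E'' : Type*) [NormedAddCommGroup E''] [NormedSpace ℝ E'']
  {M'' : Type*} [TopologicalSpace M''] [ChartedSpace E'' M'']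

/-- The differential of a map between manifolds, as a map between the model spaces. -/
def md (f : M → M') (x : M) : E →L[ℝ] E' := mfderiv 𝓘(ℝ, E) 𝓘(ℝ, E') f x

/-- Smoothness at a point for manifolds modelled on normed spaces. -/
abbrev SmoothAt (f : M → M') (x : M) : Prop := ContMDiffAt 𝓘(ℝ, E) 𝓘(ℝ, E') ∞ f x

variable {E E' E''}

lemma SmoothAt.mda {f : M → M'} {x : M} (hf : SmoothAt E E' f x) :
    MDifferentiableAt 𝓘(ℝ, E) 𝓘(ℝ, E') f x :=
  hf.mdifferentiableAt (by simp)

lemma md_comp_of_mda {g : M' → M''} {f : M → M'} {x : M}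
    (hg : MDifferentiableAt 𝓘(ℝ, E') 𝓘(ℝ, E'') g (f x))
    (hf : MDifferentiableAt 𝓘(ℝ, E) 𝓘(ℝ, E') f x) :
    md E E'' (g ∘ f) x = (md E' E'' g (f x)).comp (md E E' f x) :=
  mfderiv_comp x hg hf

lemma md_comp {g : M' → M''} {f : M → M'} {x : M} (hg : SmoothAt E' E'' g (f x))
    (hf : SmoothAt E E' f x) :
    md E E'' (g ∘ f) x = (md E' E'' g (f x)).comp (md E E' f x) :=
  md_comp_of_mda hg.mda hf.mda

lemma md_comp_apply {g : M' → M''} {f : M → M'} {x : M} (hg : SmoothAt E' E'' g (f x))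
    (hf : SmoothAt E E' f x) (v : E) :
    md E E'' (fun y => g (f y)) x v = md E' E'' g (f x) (md E E' f x v) :=
  congrArg (fun A : E →L[ℝ] E'' => A v) (md_comp hg hf)

lemma md_congr {f g : M → M'} {x : M} (h : f =ᶠ[𝓝 x] g) : md E E' f x = md E E' g x :=
  h.mfderiv_eq

lemma md_id (x : M) : md E E (fun y : M => y) x = ContinuousLinearMap.id ℝ E :=
  mfderiv_id (I := 𝓘(ℝ, E)) (x := x)

lemma md_const (c : M') (x : M) : md E E' (fun _ : M => c) x = 0 :=
  mfderiv_const (I := 𝓘(ℝ, E)) (I' := 𝓘(ℝ, E')) (x := x) (c := c)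

lemma md_eq_fderiv (f : E → E') (x : E) : md E E' f x = fderiv ℝ f x :=
  mfderiv_eq_fderiv

lemma smoothAt_extChartAt [IsManifold 𝓘(ℝ, E) ∞ M] {x y : M}
    (hy : y ∈ (extChartAt 𝓘(ℝ, E) x).source) : SmoothAt E E (extChartAt 𝓘(ℝ, E) x) y :=
  contMDiffAt_extChartAt' (by rwa [extChartAt_source] at hy)

lemma smoothAt_extChartAt_symm [IsManifold 𝓘(ℝ, E) ∞ M] {x : M} {y : E}
    (hy : y ∈ (extChartAt 𝓘(ℝ, E) x).target) : SmoothAt E E (extChartAt 𝓘(ℝ, E) x).symm y :=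
  (contMDiffOn_extChartAt_symm x).contMDiffAt ((isOpen_extChartAt_target x).mem_nhds hy)

lemma eventually_extChartAt_symm_left {x y : M} (hy : y ∈ (extChartAt 𝓘(ℝ, E) x).source) :
    ∀ᶠ z in 𝓝 y, (extChartAt 𝓘(ℝ, E) x).symm (extChartAt 𝓘(ℝ, E) x z) = z := by
  filter_upwards [(isOpen_extChartAt_source x).mem_nhds hy] with z hz
  exact (extChartAt 𝓘(ℝ, E) x).left_inv hz

lemma eventually_extChartAt_symm_right {x : M} {y : E}
    (hy : y ∈ (extChartAt 𝓘(ℝ, E) x).target) :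
    ∀ᶠ z in 𝓝 y, extChartAt 𝓘(ℝ, E) x ((extChartAt 𝓘(ℝ, E) x).symm z) = z := by
  filter_upwards [(isOpen_extChartAt_target x).mem_nhds hy] with z hz
  exact (extChartAt 𝓘(ℝ, E) x).right_inv hz

/-- A map with a local left inverse `g` has a differential with a left inverse. -/
lemma md_left_inverse {f : M → M'} {g : M' → M} {x : M} (hf : SmoothAt E E' f x)
    (hg : SmoothAt E' E g (f x)) (h : ∀ᶠ z in 𝓝 x, g (f z) = z) (v : E) :
    md E' E g (f x) (md E E' f x v) = v := by
  rw [← md_comp_apply hg hf]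
  have : (fun y => g (f y)) =ᶠ[𝓝 x] fun y => y := h
  rw [md_congr this, md_id]
  rfl

lemma md_extChartAt_symm_left [IsManifold 𝓘(ℝ, E) ∞ M] {x y : M}
    (hy : y ∈ (extChartAt 𝓘(ℝ, E) x).source) (v : E) :
    md E E (extChartAt 𝓘(ℝ, E) x).symm (extChartAt 𝓘(ℝ, E) x y)
      (md E E (extChartAt 𝓘(ℝ, E) x) y v) = v :=
  md_left_inverse (smoothAt_extChartAt hy)
    (smoothAt_extChartAt_symm ((extChartAt 𝓘(ℝ, E) x).map_source hy))
    (eventually_extChartAt_symm_left hy) v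

lemma md_extChartAt_symm_right [IsManifold 𝓘(ℝ, E) ∞ M] {x : M} {y : E}
    (hy : y ∈ (extChartAt 𝓘(ℝ, E) x).target) (v : E) :
    md E E (extChartAt 𝓘(ℝ, E) x) ((extChartAt 𝓘(ℝ, E) x).symm y)
      (md E E (extChartAt 𝓘(ℝ, E) x).symm y v) = v :=
  md_left_inverse (smoothAt_extChartAt_symm hy)
    (smoothAt_extChartAt ((extChartAt 𝓘(ℝ, E) x).map_target hy))
    (eventually_extChartAt_symm_right hy) v

/-- The preferred chart at `x` is itself what identifies `T_x M` with the model space. -/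
lemma md_extChartAt_self [IsManifold 𝓘(ℝ, E) ∞ M] (x : M) (v : E) :
    md E E (extChartAt 𝓘(ℝ, E) x) x v = v := by
  have : IsManifold 𝓘(ℝ, E) 1 M := IsManifold.of_le (n := ∞) (by norm_cast)
  have h := mfderiv_chartAt_eq_tangentCoordChange (I := 𝓘(ℝ, E)) (x := x) (y := x)
    (mem_chart_source E x)
  have h2 : md E E (extChartAt 𝓘(ℝ, E) x) x = tangentCoordChange 𝓘(ℝ, E) x x x := by
    rw [← h]; rfl
  rw [h2]
  exact tangentCoordChange_self (mem_extChartAt_source (I := 𝓘(ℝ, E)) x)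

lemma md_extChartAt_symm_self [IsManifold 𝓘(ℝ, E) ∞ M] (x : M) (v : E) :
    md E E (extChartAt 𝓘(ℝ, E) x).symm (extChartAt 𝓘(ℝ, E) x x) v = v := by
  have h := md_extChartAt_symm_left (mem_extChartAt_source (I := 𝓘(ℝ, E)) x) v
  rwa [md_extChartAt_self] at h

/-- The differential in charts around arbitrary points. -/
lemma fderiv_extChartAt_comp [IsManifold 𝓘(ℝ, E) ∞ M] [IsManifold 𝓘(ℝ, E') ∞ M']
    {f : M → M'} {p : M} {q : M'} {y : E} (hy : y ∈ (extChartAt 𝓘(ℝ, E) p).target)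
    (hq : f ((extChartAt 𝓘(ℝ, E) p).symm y) ∈ (extChartAt 𝓘(ℝ, E') q).source)
    (hf : SmoothAt E E' f ((extChartAt 𝓘(ℝ, E) p).symm y)) (v : E) :
    fderiv ℝ (fun z => extChartAt 𝓘(ℝ, E') q (f ((extChartAt 𝓘(ℝ, E) p).symm z))) y v =
      md E' E' (extChartAt 𝓘(ℝ, E') q) (f ((extChartAt 𝓘(ℝ, E) p).symm y))
        (md E E' f ((extChartAt 𝓘(ℝ, E) p).symm y)
          (md E E (extChartAt 𝓘(ℝ, E) p).symm y v)) := by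
  have h1 := smoothAt_extChartAt_symm (E := E) hy
  rw [← md_eq_fderiv, md_comp_apply (f := fun z => f ((extChartAt 𝓘(ℝ, E) p).symm z))
    (smoothAt_extChartAt hq) (hf.comp y h1), md_comp_apply hf h1]

lemma contDiffAt_extChartAt_comp [IsManifold 𝓘(ℝ, E) ∞ M] [IsManifold 𝓘(ℝ, E') ∞ M']
    {f : M → M'} {p : M} {q : M'} {y : E} (hy : y ∈ (extChartAt 𝓘(ℝ, E) p).target)
    (hq : f ((extChartAt 𝓘(ℝ, E) p).symm y) ∈ (extChartAt 𝓘(ℝ, E') q).source)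
    (hf : SmoothAt E E' f ((extChartAt 𝓘(ℝ, E) p).symm y)) :
    ContDiffAt ℝ ∞ (fun z => extChartAt 𝓘(ℝ, E') q (f ((extChartAt 𝓘(ℝ, E) p).symm z))) y := by
  rw [← contMDiffAt_iff_contDiffAt]
  exact (smoothAt_extChartAt hq).comp y (hf.comp y (smoothAt_extChartAt_symm hy))

/-- A map with vanishing differential is locally constant. -/
lemma isLocallyConstant_of_md_eq_zero [IsManifold 𝓘(ℝ, E) ∞ M] [IsManifold 𝓘(ℝ, E') ∞ M']
    {f : M → M'} (hf : ContMDiff 𝓘(ℝ, E) 𝓘(ℝ, E') ∞ f) (h : ∀ x, md E E' f x = 0) :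
    IsLocallyConstant f := by
  rw [IsLocallyConstant.iff_eventually_eq]
  intro p
  set φ := extChartAt 𝓘(ℝ, E) p
  set ψ := extChartAt 𝓘(ℝ, E') (f p)
  -- Both charts are valid on a ball, which is connected, so the vanishing derivative of the
  -- coordinate expression forces constancy there.
  have hU : φ.symm ⁻¹' (f ⁻¹' ψ.source) ∩ φ.target ∈ 𝓝 (φ p) := by
    refine inter_mem ?_ ((isOpen_extChartAt_target p).mem_nhds (mem_extChartAt_target p))
    have hc : ContinuousAt (fun z => f (φ.symm z)) (φ p) := by
      apply hf.continuous.continuousAt.comp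
      exact (smoothAt_extChartAt_symm (mem_extChartAt_target p)).continuousAt
    refine hc.preimage_mem_nhds ((isOpen_extChartAt_source (f p)).mem_nhds ?_)
    show f (φ.symm (φ p)) ∈ _
    rw [φ.left_inv (mem_extChartAt_source p)]
    exact mem_extChartAt_source (f p)
  obtain ⟨ε, hε, hball⟩ := Metric.mem_nhds_iff.1 hU
  have hconst : ∀ z ∈ Metric.ball (φ p) ε, ψ (f (φ.symm z)) = ψ (f p) := by
    intro z hz
    have := (Metric.isOpen_ball (x := φ p) (ε := ε)).is_const_of_fderiv_eq_zero (𝕜 := ℝ)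
      (f := fun z => ψ (f (φ.symm z))) (convex_ball (φ p) ε).isPreconnected
      (fun w hw => ((contDiffAt_extChartAt_comp (hball hw).2 (hball hw).1
        hf.contMDiffAt).differentiableAt (by simp)).differentiableWithinAt)
      (fun w hw => by
        ext v
        rw [fderiv_extChartAt_comp (hball hw).2 (hball hw).1 hf.contMDiffAt, h]
        simp) hz (Metric.mem_ball_self hε)
    rwa [φ.left_inv (mem_extChartAt_source p)] at this
  have hnear : ∀ᶠ y in 𝓝 p, φ y ∈ Metric.ball (φ p) ε :=
    (continuousAt_extChartAt p).preimage_mem_nhds (Metric.ball_mem_nhds _ hε)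
  filter_upwards [hnear, (isOpen_extChartAt_source p).mem_nhds (mem_extChartAt_source (I := 𝓘(ℝ, E)) p)]
    with y hy hys
  have h1 := hconst _ hy
  have h2 := (hball hy).1
  simp only [mem_preimage] at h2
  rw [φ.left_inv hys] at h1 h2
  exact ψ.injOn h2 (mem_extChartAt_source _) h1

end Differential


/-! ### Inverse function theorem and constant rank theorem in vector spaces. -/

section InverseFunction

variable {E₁ : Type*} [NormedAddCommGroup E₁] [NormedSpace ℝ E₁] [FiniteDimensional ℝ E₁]
  {E₂ : Type*} [NormedAddCommGroup E₂] [NormedSpace ℝ E₂] [FiniteDimensional ℝ E₂]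

/-- The inverse function theorem, with smoothness of the map and of its inverse on open sets. -/
theorem exists_openPartialHomeomorph_of_bijective_fderiv {f : E₁ → E₂} {U : Set E₁}
    (hU : IsOpen U) (hf : ContDiffOn ℝ ∞ f U) {a : E₁} (ha : a ∈ U)
    (hbij : Function.Bijective (fderiv ℝ f a)) :
    ∃ Φ : OpenPartialHomeomorph E₁ E₂, a ∈ Φ.source ∧ Φ.source ⊆ U ∧ (∀ z, Φ z = f z) ∧
      ContDiffOn ℝ ∞ Φ.symm Φ.target ∧
      ∀ z ∈ Φ.source, Function.Bijective (fderiv ℝ f z) := by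
  have : CompleteSpace E₁ := FiniteDimensional.complete ℝ E₁
  let e : E₁ ≃L[ℝ] E₂ := (LinearEquiv.ofBijective (fderiv ℝ f a).toLinearMap
    hbij).toContinuousLinearEquiv
  have he : (e : E₁ →L[ℝ] E₂) = fderiv ℝ f a := by ext v; rfl
  have hfa : ContDiffAt ℝ ∞ f a := hf.contDiffAt (hU.mem_nhds ha)
  have hda : HasFDerivAt f (e : E₁ →L[ℝ] E₂) a := by
    rw [he]; exact (hfa.differentiableAt (by simp)).hasFDerivAt
  let Φ₀ := hfa.toOpenPartialHomeomorph f hda (by simp)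
  have hcont : ContinuousOn (fderiv ℝ f) U := hf.continuousOn_fderiv_of_isOpen hU (by simp)
  -- Invertible maps form a neighbourhood of `e`. Shrinking to `U'` keeps the derivative invertible
  -- on the whole source, which makes the inverse smooth on the whole target.
  let U' : Set E₁ := U ∩ fderiv ℝ f ⁻¹'
    interior (Set.range ((↑) : (E₁ ≃L[ℝ] E₂) → E₁ →L[ℝ] E₂))
  have hU' : IsOpen U' := hcont.isOpen_inter_preimage hU isOpen_interior
  have haU' : a ∈ U' := by
    refine ⟨ha, mem_interior_iff_mem_nhds.2 ?_⟩
    rw [← he]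
    exact e.nhds
  have hbij' : ∀ z ∈ U', ∃ e' : E₁ ≃L[ℝ] E₂, (e' : E₁ →L[ℝ] E₂) = fderiv ℝ f z :=
    fun z hz => mem_range.1 (interior_subset hz.2)
  refine ⟨Φ₀.restr U', ?_, ?_, fun z => rfl, ?_, ?_⟩
  · rw [Φ₀.restr_source' U' hU']
    exact ⟨hfa.mem_toOpenPartialHomeomorph_source hda (by simp), haU'⟩
  · rw [Φ₀.restr_source' U' hU']
    exact fun z hz => hz.2.1
  · intro y hy
    have hy' := (Φ₀.restr U').map_target hy
    rw [Φ₀.restr_source' U' hU'] at hy'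
    obtain ⟨e', he'⟩ := hbij' _ hy'.2
    have hd : ContDiffAt ℝ ∞ f ((Φ₀.restr U').symm y) := hf.contDiffAt (hU.mem_nhds hy'.2.1)
    refine ((Φ₀.restr U').contDiffAt_symm hy (f₀' := e') ?_ hd).contDiffWithinAt
    rw [he']
    exact (hd.differentiableAt (by simp)).hasFDerivAt
  · intro z hz
    rw [Φ₀.restr_source' U' hU'] at hz
    obtain ⟨e', he'⟩ := hbij' _ hz.2
    rw [← he']
    exact e'.bijective

/-- The local form of a smooth map of constant rank: its fibres are the fibres of a local
submersion `q` with a section `s`. -/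
theorem exists_local_section_of_finrank_ker_eq {f : E₁ → E₂} {U : Set E₁}
    (hU : IsOpen U) (hf : ContDiffOn ℝ ∞ f U) {a : E₁} (ha : a ∈ U) {d k : ℕ}
    (hk : k + d = Module.finrank ℝ E₁)
    (hd : ∀ z ∈ U, Module.finrank ℝ (fderiv ℝ f z).ker = d) :
    ∃ (V : Set E₁) (W : Set (EuclideanSpace ℝ (Fin k))) (q : E₁ → EuclideanSpace ℝ (Fin k))
      (s : EuclideanSpace ℝ (Fin k) → E₁),
      IsOpen V ∧ a ∈ V ∧ V ⊆ U ∧ IsOpen W ∧ ContDiffOn ℝ ∞ q V ∧ ContDiffOn ℝ ∞ s W ∧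
      MapsTo q V W ∧ MapsTo s W V ∧ (∀ w ∈ W, q (s w) = w) ∧
      ∀ y ∈ V, ∀ y' ∈ V, q y = q y' ↔ f y = f y' := by
  set A := fderiv ℝ f a with hA
  have hrank : Module.finrank ℝ A.range = k := by
    have := A.toLinearMap.finrank_range_add_finrank_ker
    have h2 := hd a ha
    change Module.finrank ℝ (LinearMap.ker A.toLinearMap) = d at h2
    change Module.finrank ℝ (LinearMap.range A.toLinearMap) = k
    omega
  obtain ⟨R', hR'⟩ := Submodule.exists_isCompl A.range
  let i₀ : A.range ≃ₗ[ℝ] EuclideanSpace ℝ (Fin k) :=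
    LinearEquiv.ofFinrankEq _ _ (by rw [hrank]; simp)
  let π₀ : E₂ →ₗ[ℝ] EuclideanSpace ℝ (Fin k) :=
    i₀.toLinearMap ∘ₗ Submodule.projectionOnto _ _ hR'
  let π : E₂ →L[ℝ] EuclideanSpace ℝ (Fin k) := LinearMap.toContinuousLinearMap π₀
  have hπA : ∀ v, π (A v) = i₀ ⟨A v, v, rfl⟩ := by
    intro v
    show i₀ (Submodule.projectionOnto _ _ hR' (A v)) = _
    congr 1
    exact Submodule.projectionOnto_apply_left hR' ⟨A v, v, rfl⟩
  obtain ⟨C, hC⟩ := Submodule.exists_isCompl A.ker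
  let L : E₁ →L[ℝ] A.ker := LinearMap.toContinuousLinearMap (Submodule.projectionOnto _ _ hC)
  have hL : ∀ v : A.ker, L v = v := fun v => Submodule.projectionOnto_apply_left hC v
  -- The first component carries the full rank of `f` at `a`; the projection to `ker A` completes it
  -- to a local diffeomorphism.
  let Ψ : E₁ → EuclideanSpace ℝ (Fin k) × A.ker := fun y => (π (f y), L y)
  have hΨ : ContDiffOn ℝ ∞ Ψ U := (π.contDiff.comp_contDiffOn hf).prodMk L.contDiff.contDiffOn
  have hΨd : ∀ z ∈ U, ∀ v, fderiv ℝ Ψ z v = (π (fderiv ℝ f z v), L v) := by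
    intro z hz v
    have hfz : HasFDerivAt f (fderiv ℝ f z) z :=
      ((hf.contDiffAt (hU.mem_nhds hz)).differentiableAt (by simp)).hasFDerivAt
    have : HasFDerivAt Ψ ((π.comp (fderiv ℝ f z)).prod L) z :=
      (π.hasFDerivAt.comp z hfz).prodMk L.hasFDerivAt
    rw [this.fderiv]
    rfl
  have hinj : Function.Injective (fderiv ℝ Ψ a) := by
    rw [injective_iff_map_eq_zero]
    intro v hv
    rw [hΨd a ha, Prod.mk_eq_zero] at hv
    obtain ⟨h1, h2⟩ := hv
    rw [← hA, hπA, map_eq_zero_iff _ i₀.injective] at h1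
    have hvk : v ∈ A.ker := congrArg Subtype.val h1
    have := hL ⟨v, hvk⟩
    change L v = _ at this
    rw [h2] at this
    exact (congrArg Subtype.val this).symm
  have hdim : Module.finrank ℝ E₁ = Module.finrank ℝ (EuclideanSpace ℝ (Fin k) × A.ker) := by
    rw [Module.finrank_prod, hd a ha]
    simpa using hk.symm
  have hbij : Function.Bijective (fderiv ℝ Ψ a) :=
    ⟨hinj, (LinearMap.injective_iff_surjective_of_finrank_eq_finrank hdim
      (f := (fderiv ℝ Ψ a).toLinearMap)).1 hinj⟩
  obtain ⟨Φ, haΦ, hΦU, hΦ, hsymm, hΦbij⟩ :=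
    exists_openPartialHomeomorph_of_bijective_fderiv hU hΨ ha hbij
  have hΦa : Φ a ∈ Φ.target := Φ.map_source haΦ
  have hnhds : Φ.target ∈ 𝓝 ((Φ a).1, (Φ a).2) := Φ.open_target.mem_nhds hΦa
  obtain ⟨ε, hε, hball⟩ := Metric.mem_nhds_iff.1 hnhds
  set W := Metric.ball (Φ a).1 ε with hW
  set B := Metric.ball (Φ a).2 ε with hB
  have hWB : W ×ˢ B ⊆ Φ.target := by rwa [hW, hB, ball_prod_same]
  -- In the coordinates `(w, b)` the map `f` depends on `w` alone. The derivative in `b` vanishes on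
  -- the ball `B`, which is connected.
  have hkey : ∀ w ∈ W, ∀ b ∈ B, ∀ b' ∈ B, f (Φ.symm (w, b)) = f (Φ.symm (w, b')) := by
    intro w hw b hb b' hb'
    refine (Metric.isOpen_ball (x := (Φ a).2) (ε := ε)).is_const_of_fderiv_eq_zero (𝕜 := ℝ)
      (f := fun b => f (Φ.symm (w, b))) (convex_ball _ ε).isPreconnected ?_ ?_ hb hb'
    · intro b hb
      have h1 : ContDiffAt ℝ ∞ Φ.symm (w, b) :=
        hsymm.contDiffAt (Φ.open_target.mem_nhds (hWB ⟨hw, hb⟩))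
      have h2 : ContDiffAt ℝ ∞ f (Φ.symm (w, b)) :=
        hf.contDiffAt (hU.mem_nhds (hΦU (Φ.map_target (hWB ⟨hw, hb⟩))))
      exact ((h2.comp b (h1.comp b (contDiffAt_const.prodMk contDiffAt_id))).differentiableAt
        (by simp)).differentiableWithinAt
    · intro b hb
      have hmem := hWB (show (w, b) ∈ W ×ˢ B from ⟨hw, hb⟩)
      set z := Φ.symm (w, b) with hz
      have hzs : z ∈ Φ.source := Φ.map_target hmem
      have h1 : DifferentiableAt ℝ Φ.symm (w, b) :=
        (hsymm.contDiffAt (Φ.open_target.mem_nhds hmem)).differentiableAt (by simp)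
      have h2 : DifferentiableAt ℝ f z :=
        (hf.contDiffAt (hU.mem_nhds (hΦU hzs))).differentiableAt (by simp)
      have h3 : DifferentiableAt ℝ Ψ z :=
        (hΨ.contDiffAt (hU.mem_nhds (hΦU hzs))).differentiableAt (by simp)
      have hin : HasFDerivAt (fun b : A.ker => ((w, b) : EuclideanSpace ℝ (Fin k) × A.ker))
          (ContinuousLinearMap.inr ℝ _ _) b := hasFDerivAt_prodMk_right w b
      have h4 := h2.hasFDerivAt.comp b (h1.hasFDerivAt.comp b hin)
      ext β
      refine (congrArg (fun T => T β) h4.fderiv).trans ?_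
      show fderiv ℝ f z (fderiv ℝ Φ.symm (w, b) (0, β)) = 0
      set v := fderiv ℝ Φ.symm (w, b) (0, β)
      have h5 : fderiv ℝ Ψ z v = (0, β) := by
        have h6 := h3.hasFDerivAt.comp (w, b) h1.hasFDerivAt
        have h7 : (Ψ ∘ Φ.symm) =ᶠ[𝓝 (w, b)] id := by
          filter_upwards [Φ.open_target.mem_nhds hmem] with p hp
          show Ψ (Φ.symm p) = p
          exact (hΦ _).symm.trans (Φ.right_inv hp)
        have h8 := h6.unique ((hasFDerivAt_id (w, b)).congr_of_eventuallyEq h7)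
        exact congrArg (fun T => T (0, β)) h8
      rw [hΨd z (hΦU hzs)] at h5
      have h6 : π (fderiv ℝ f z v) = 0 := (Prod.mk.inj h5).1
      have hsurj : Function.Surjective (π.comp (fderiv ℝ f z)) := by
        intro r
        obtain ⟨u, hu⟩ := (hΦbij z hzs).2 (r, 0)
        rw [hΨd z (hΦU hzs)] at hu
        exact ⟨u, (Prod.mk.inj hu).1⟩
      -- Constant rank enters here: `π ∘ Df` is onto `ℝ^k`, so its kernel also has dimension `d`,
      -- and the inclusion of kernels is an equality. Thus `π (Df v) = 0` implies `Df v = 0`.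
      have hle : LinearMap.ker (fderiv ℝ f z).toLinearMap ≤
          LinearMap.ker (π.comp (fderiv ℝ f z)).toLinearMap := by
        intro u hu
        have hu' : fderiv ℝ f z u = 0 := hu
        show π (fderiv ℝ f z u) = 0
        rw [hu', map_zero]
      have hrk := (π.comp (fderiv ℝ f z)).toLinearMap.finrank_range_add_finrank_ker
      rw [LinearMap.range_eq_top.2 hsurj, finrank_top, finrank_euclideanSpace_fin] at hrk
      have hd' : Module.finrank ℝ (LinearMap.ker (fderiv ℝ f z).toLinearMap) = d :=
        hd z (hΦU hzs)
      have heq := Submodule.eq_of_le_of_finrank_eq hle (by omega)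
      have : v ∈ LinearMap.ker (π.comp (fderiv ℝ f z)).toLinearMap := h6
      rw [← heq] at this
      exact this
  have hmemV : ∀ y, y ∈ Φ.source ∩ Φ ⁻¹' (W ×ˢ B) → (π (f y) ∈ W ∧ L y ∈ B) ∧
      y = Φ.symm (π (f y), L y) := by
    intro y hy
    have h1 := hy.2
    simp only [mem_preimage, hΦ] at h1
    refine ⟨h1, ?_⟩
    conv_lhs => rw [← Φ.left_inv hy.1, hΦ]
  refine ⟨Φ.source ∩ Φ ⁻¹' (W ×ˢ B), W, fun y => π (f y), fun w => Φ.symm (w, (Φ a).2),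
    Φ.isOpen_inter_preimage (Metric.isOpen_ball.prod Metric.isOpen_ball),
    ⟨haΦ, Metric.mem_ball_self hε, Metric.mem_ball_self hε⟩, fun y hy => hΦU hy.1,
    Metric.isOpen_ball, (π.contDiff.comp_contDiffOn hf).mono fun y hy => hΦU hy.1, ?_,
    fun y hy => (hmemV y hy).1.1, ?_, ?_, ?_⟩
  · refine hsymm.comp (contDiffOn_id.prodMk contDiffOn_const) fun w hw =>
      hWB ⟨hw, Metric.mem_ball_self hε⟩
  · intro w hw
    have hmem := hWB (show (w, (Φ a).2) ∈ W ×ˢ B from ⟨hw, Metric.mem_ball_self hε⟩)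
    refine ⟨Φ.map_target hmem, ?_⟩
    rw [mem_preimage, Φ.right_inv hmem]
    exact ⟨hw, Metric.mem_ball_self hε⟩
  · intro w hw
    have hmem := hWB (show (w, (Φ a).2) ∈ W ×ˢ B from ⟨hw, Metric.mem_ball_self hε⟩)
    have := (hΦ _).symm.trans (Φ.right_inv hmem)
    exact (Prod.mk.inj this).1
  · intro y hy y' hy'
    obtain ⟨⟨h1, h2⟩, h3⟩ := hmemV y hy
    obtain ⟨⟨h1', h2'⟩, h3'⟩ := hmemV y' hy'
    refine ⟨fun h => ?_, fun h => congrArg π h⟩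
    rw [h3, h3']
    simp only at h
    rw [← h]
    exact hkey _ h1 _ h2 _ h2'

end InverseFunction


/-! ### Smoothness and closedness of forms that are locally pull-backs. -/

section PullbackForms

variable {E : Type*} [NormedAddCommGroup E] [NormedSpace ℝ E] 
  {M : Type*} [TopologicalSpace M] [ChartedSpace E M] 
  {E' : Type*} [NormedAddCommGroup E'] [NormedSpace ℝ E']
  {Q : Type*} [TopologicalSpace Q] [ChartedSpace E' Q]

/-- A 2-form with values in the alternating forms on the model space. -/
def TwoForm.model (α : TwoForm E M) : M → E [⋀^Fin 2]→L[ℝ] ℝ := α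

lemma chartForm_apply (α : TwoForm E M) (p : M) (y : E) (v : Fin 2 → E) :
    chartForm α p y v = α.model ((extChartAt 𝓘(ℝ, E) p).symm y)
      (fun i => md E E (extChartAt 𝓘(ℝ, E) p).symm y (v i)) := rfl

lemma pullback_apply (f : Q → M) (α : TwoForm E M) (x : Q) (v : Fin 2 → E') :
    (pullback f α : TwoForm E' Q).model x v = α.model (f x) (fun i => md E' E f x (v i)) := rfl

variable [IsManifold 𝓘(ℝ, E) ∞ M] [IsManifold 𝓘(ℝ, E') ∞ Q]

/-- Transfers a pull-back on manifolds to a pull-back in vector spaces by the coordinate expression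
`u` of `f`, where the exterior derivative is defined. -/
lemma chartForm_eventuallyEq_of_local_pullback {α : TwoForm E' Q} {Ω : TwoForm E M} {U : Set Q}
    (hU : IsOpen U) {f : Q → M} (hf : ContMDiffOn 𝓘(ℝ, E') 𝓘(ℝ, E) ∞ f U)
    (hα : ∀ z ∈ U, α z = pullback f Ω z) (p : Q) {y : E'}
    (hy : y ∈ (extChartAt 𝓘(ℝ, E') p).target) (hyU : (extChartAt 𝓘(ℝ, E') p).symm y ∈ U) :
    ∃ (m : M) (u : E' → E), u y ∈ (extChartAt 𝓘(ℝ, E) m).target ∧ ContDiffAt ℝ ∞ u y ∧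
      chartForm α p =ᶠ[𝓝 y]
        fun z => (chartForm Ω m (u z)).compContinuousLinearMap (fderiv ℝ u z) := by
  set φ := extChartAt 𝓘(ℝ, E') p
  set m := f (φ.symm y) with hm
  set ψ := extChartAt 𝓘(ℝ, E) m
  have hsm : ∀ z ∈ φ.target, φ.symm z ∈ U → SmoothAt E' E f (φ.symm z) :=
    fun z _ hz => hf.contMDiffAt (hU.mem_nhds hz)
  have hms : m ∈ ψ.source := mem_extChartAt_source m
  refine ⟨m, fun z => ψ (f (φ.symm z)), ψ.map_source hms,
    contDiffAt_extChartAt_comp hy hms (hsm y hy hyU), ?_⟩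
  have h1 : ∀ᶠ z in 𝓝 y, z ∈ φ.target := (isOpen_extChartAt_target p).mem_nhds hy
  have h2 : ∀ᶠ z in 𝓝 y, φ.symm z ∈ U :=
    (smoothAt_extChartAt_symm hy).continuousAt.preimage_mem_nhds (hU.mem_nhds hyU)
  have h3 : ∀ᶠ z in 𝓝 y, f (φ.symm z) ∈ ψ.source := by
    have : ContinuousAt (fun z => f (φ.symm z)) y :=
      (hsm y hy hyU).continuousAt.comp (smoothAt_extChartAt_symm hy).continuousAt
    exact this.preimage_mem_nhds ((isOpen_extChartAt_source m).mem_nhds hms)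
  filter_upwards [h1, h2, h3] with z hz1 hz2 hz3
  ext v
  rw [ContinuousAlternatingMap.compContinuousLinearMap_apply, chartForm_apply]
  have hαz : α.model (φ.symm z) = (pullback f Ω : TwoForm E' Q).model (φ.symm z) := hα _ hz2
  rw [hαz, pullback_apply, chartForm_apply, ψ.left_inv hz3]
  congr 1
  funext i
  simp only [Function.comp_apply]
  rw [fderiv_extChartAt_comp hz1 hz3 (hsm z hz1 hz2), md_extChartAt_symm_left hz3]

variable [FiniteDimensional ℝ E']

/-- Composition is smooth at the level of multilinear maps. Alternating maps embed linearly among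
these, and in finite dimension the embedding has a continuous linear left inverse `S` that brings
the result back. -/
lemma contDiffAt_compContinuousLinearMap {X : Type*} [NormedAddCommGroup X] [NormedSpace ℝ X]
    {α : X → E [⋀^Fin 2]→L[ℝ] ℝ} {g : X → E' →L[ℝ] E} {x : X} (hα : ContDiffAt ℝ ∞ α x)
    (hg : ContDiffAt ℝ ∞ g x) :
    ContDiffAt ℝ ∞ (fun z => (α z).compContinuousLinearMap (g z)) x := by
  have hfin : FiniteDimensional ℝ (ContinuousMultilinearMap ℝ (fun _ : Fin 2 => E') ℝ) :=
    Module.Finite.of_injective (ContinuousMultilinearMap.toMultilinearMapLinear :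
      _ →ₗ[ℝ] MultilinearMap ℝ (fun _ : Fin 2 => E') ℝ)
      ContinuousMultilinearMap.toMultilinearMap_injective
  let ι : (E' [⋀^Fin 2]→L[ℝ] ℝ) →ₗ[ℝ] ContinuousMultilinearMap ℝ (fun _ : Fin 2 => E') ℝ :=
    ContinuousAlternatingMap.toContinuousMultilinearMapLinear
  obtain ⟨S, hS⟩ := ι.exists_leftInverse_of_injective
    (LinearMap.ker_eq_bot.2 ContinuousAlternatingMap.toContinuousMultilinearMap_injective)
  let T : (E [⋀^Fin 2]→L[ℝ] ℝ) →L[ℝ] ContinuousMultilinearMap ℝ (fun _ : Fin 2 => E) ℝ :=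
    ContinuousAlternatingMap.toContinuousMultilinearMapCLM ℝ
  have h1 : ContDiffAt ℝ ∞ (fun z => T (α z)) x := T.contDiff.contDiffAt.comp x hα
  have h2 : ContDiffAt ℝ ∞ (fun z =>
      ContinuousMultilinearMap.compContinuousLinearMapContinuousMultilinear ℝ
        (fun _ : Fin 2 => E') (fun _ => E) ℝ (fun _ => g z)) x :=
    (ContinuousMultilinearMap.contDiff _).contDiffAt.comp x (contDiffAt_pi.2 fun _ => hg)
  have h3 := (LinearMap.toContinuousLinearMap S).contDiff.contDiffAt.comp x (h2.clm_apply h1)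
  refine h3.congr_of_eventuallyEq (Eventually.of_forall fun z => ?_)
  exact (congrArg (fun T => T ((α z).compContinuousLinearMap (g z))) hS).symm

/-- A form that is locally a pull-back of a smooth closed form is smooth and closed. -/
theorem isSmoothForm_and_isClosedForm_of_local_pullback {α : TwoForm E' Q} {Ω : TwoForm E M}
    (hs : IsSmoothForm Ω) (hc : IsClosedForm Ω)
    (h : ∀ z : Q, ∃ U : Set Q, IsOpen U ∧ z ∈ U ∧ ∃ f : Q → M,
      ContMDiffOn 𝓘(ℝ, E') 𝓘(ℝ, E) ∞ f U ∧ ∀ y ∈ U, α y = pullback f Ω y) :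
    IsSmoothForm α ∧ IsClosedForm α := by
  have key : ∀ (p : Q), ∀ y ∈ (extChartAt 𝓘(ℝ, E') p).target,
      ContDiffAt ℝ ∞ (chartForm α p) y ∧ extDeriv (chartForm α p) y = 0 := by
    intro p y hy
    obtain ⟨U, hU, hyU, f, hf, hα⟩ := h ((extChartAt 𝓘(ℝ, E') p).symm y)
    obtain ⟨m, u, hm, hu, heq⟩ := chartForm_eventuallyEq_of_local_pullback hU hf hα p hy hyU
    have hΩ : ContDiffAt ℝ ∞ (chartForm Ω m) (u y) :=
      (hs m).contDiffAt ((isOpen_extChartAt_target m).mem_nhds hm)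
    constructor
    · refine ContDiffAt.congr_of_eventuallyEq ?_ heq
      have h1 : ContDiffAt ℝ ∞ (fun z => chartForm Ω m (u z)) y := hΩ.comp y hu
      have h2 : ContDiffAt ℝ ∞ (fderiv ℝ u) y := hu.fderiv_right (by simp)
      exact contDiffAt_compContinuousLinearMap h1 h2
    · rw [heq.extDeriv_eq, extDeriv_pullback (hΩ.differentiableAt (by simp)) hu
        (by simp; exact WithTop.coe_le_coe.2 le_top), hc m _ hm]
      ext v
      simp
  exact ⟨fun p y hy => (key p y hy).1.contDiffWithinAt, fun p y hy => (key p y hy).2⟩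

end PullbackForms


/-! ### Smooth embeddings: local retractions and smoothness of maps into the source. -/

section Embedding

variable {E : Type*} [NormedAddCommGroup E] [NormedSpace ℝ E]
  {M : Type*} [TopologicalSpace M] [ChartedSpace E M] [IsManifold 𝓘(ℝ, E) ∞ M]
  {F : Type*} [NormedAddCommGroup F] [NormedSpace ℝ F]
  {N : Type*} [TopologicalSpace N] [ChartedSpace F N] [IsManifold 𝓘(ℝ, F) ∞ N]
  {P : Type*} [NormedAddCommGroup P] [NormedSpace ℝ P]
  {X : Type*} [TopologicalSpace X] [ChartedSpace P X]

/-- A smooth embedding has smooth local left inverses. -/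
theorem exists_local_left_inverse_of_isSmoothEmbedding {j : N → M}
    (hj : IsSmoothEmbedding 𝓘(ℝ, F) 𝓘(ℝ, E) ∞ j) (x : N) :
    ∃ ρ : M → N, SmoothAt E F ρ (j x) ∧ ∀ᶠ y in 𝓝 x, ρ (j y) = y := by
  obtain ⟨C, _, _, hC⟩ := hj.isImmersion
  have h := hC x
  set ψ := h.domChart
  set χ := h.codChart
  have hψ : ContMDiffAt 𝓘(ℝ, F) 𝓘(ℝ, F) ∞ ψ.symm (ψ x) :=
    contMDiffAt_symm_of_mem_maximalAtlas h.domChart_mem_maximalAtlas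
      (ψ.map_source h.mem_domChart_source)
  have hχ : ContMDiffAt 𝓘(ℝ, E) 𝓘(ℝ, E) ∞ χ (j x) :=
    contMDiffAt_of_mem_maximalAtlas h.codChart_mem_maximalAtlas h.mem_codChart_source
  -- In adapted charts the immersion is `u ↦ (u, 0)`, so the first projection undoes it.
  let L : E →L[ℝ] F := (ContinuousLinearMap.fst ℝ F C).comp (h.equiv.symm : E →L[ℝ] F × C)
  have hkey : ∀ y ∈ ψ.source, L (χ (j y)) = ψ y := by
    intro y hy
    have h1 := h.writtenInCharts (show ψ y ∈ (ψ.extend 𝓘(ℝ, F)).target by simpa using ψ.map_source hy)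
    simp only [Function.comp_apply, OpenPartialHomeomorph.extend_coe,
      OpenPartialHomeomorph.extend_coe_symm, modelWithCornersSelf_coe, id,
      modelWithCornersSelf_coe_symm] at h1
    rw [show h.domChart = ψ from rfl, show h.codChart = χ from rfl, ψ.left_inv hy] at h1
    rw [h1]
    show (h.equiv.symm (h.equiv (ψ y, 0))).1 = ψ y
    rw [h.equiv.symm_apply_apply]
  refine ⟨fun m => ψ.symm (L (χ m)), ?_, ?_⟩
  · have hL : ContMDiffAt 𝓘(ℝ, E) 𝓘(ℝ, F) ∞ L (χ (j x)) := L.contMDiff.contMDiffAt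
    have hLψ : ContMDiffAt 𝓘(ℝ, F) 𝓘(ℝ, F) ∞ ψ.symm (L (χ (j x))) := by
      rw [hkey x h.mem_domChart_source]; exact hψ
    exact hLψ.comp (j x) (hL.comp (j x) hχ)
  · filter_upwards [ψ.open_source.mem_nhds h.mem_domChart_source] with y hy
    rw [hkey y hy, ψ.left_inv hy]

/-- A map into an embedded submanifold is smooth if it is smooth as a map into the ambient
manifold. -/
lemma smoothAt_of_comp_isSmoothEmbedding {j : N → M}
    (hj : IsSmoothEmbedding 𝓘(ℝ, F) 𝓘(ℝ, E) ∞ j) {f : X → N} {x : X}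
    (hf : SmoothAt P E (fun y => j (f y)) x) : SmoothAt P F f x := by
  obtain ⟨ρ, hρ, hρj⟩ := exists_local_left_inverse_of_isSmoothEmbedding hj (f x)
  have hcont : ContinuousAt f x :=
    hj.isEmbedding.isInducing.continuousAt_iff.2 hf.continuousAt
  have h1 : SmoothAt P F (fun y => ρ (j (f y))) x := ContMDiffAt.comp x hρ hf
  refine h1.congr_of_eventuallyEq ?_
  filter_upwards [hcont.eventually hρj] with y hy
  exact hy.symm

lemma md_injective_of_isSmoothEmbedding {j : N → M}
    (hj : IsSmoothEmbedding 𝓘(ℝ, F) 𝓘(ℝ, E) ∞ j) (x : N) :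
    Function.Injective (md F E j x) := by
  obtain ⟨ρ, hρ, hρj⟩ := exists_local_left_inverse_of_isSmoothEmbedding hj x
  exact Function.LeftInverse.injective (md_left_inverse hj.contMDiff.contMDiffAt hρ hρj)

end Embedding

/-! ### Quotients of manifolds by equivalence relations with slices. -/

section QuotientManifold

variable {F : Type*} [NormedAddCommGroup F] [NormedSpace ℝ F]
  {N : Type*} [TopologicalSpace N] [ChartedSpace F N]

/-- A slice of an equivalence relation on a manifold: a submersion `q` on an open set `V` whose
fibres are the intersections of `V` with the equivalence classes, and a section `s` of `q`. -/
structure Slice (r : Setoid N) (k : ℕ) where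
  V : Set N
  W : Set (EuclideanSpace ℝ (Fin k))
  q : N → EuclideanSpace ℝ (Fin k)
  s : EuclideanSpace ℝ (Fin k) → N
  isOpen_V : IsOpen V
  isOpen_W : IsOpen W
  smooth_q : ContMDiffOn 𝓘(ℝ, F) 𝓘(ℝ, EuclideanSpace ℝ (Fin k)) ∞ q V
  smooth_s : ContMDiffOn 𝓘(ℝ, EuclideanSpace ℝ (Fin k)) 𝓘(ℝ, F) ∞ s W
  mapsTo_q : MapsTo q V W
  mapsTo_s : MapsTo s W V
  q_s : ∀ w ∈ W, q (s w) = w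
  q_eq_iff : ∀ y ∈ V, ∀ y' ∈ V, q y = q y' ↔ r y y'

namespace Slice

variable {r : Setoid N} {k : ℕ} (S : Slice (F := F) r k)

open Classical in
/-- The map induced on the quotient by the submersion of a slice. -/
def descend (z : Quotient r) : EuclideanSpace ℝ (Fin k) :=
  -- The choice of `y` is immaterial because `q` separates exactly the classes. The value `0` occurs
  -- only outside the chart domain.
  if h : ∃ y ∈ S.V, Quotient.mk r y = z then S.q h.choose else 0

lemma descend_mk {y : N} (hy : y ∈ S.V) : S.descend (Quotient.mk r y) = S.q y := by
  have h : ∃ y' ∈ S.V, Quotient.mk r y' = Quotient.mk r y := ⟨y, hy, rfl⟩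
  rw [descend, dif_pos h]
  exact (S.q_eq_iff _ h.choose_spec.1 _ hy).2 (Quotient.exact h.choose_spec.2)

lemma mk_s_q {y : N} (hy : y ∈ S.V) : Quotient.mk r (S.s (S.q y)) = Quotient.mk r y :=
  Quotient.sound ((S.q_eq_iff _ (S.mapsTo_s (S.mapsTo_q hy)) _ hy).1 (S.q_s _ (S.mapsTo_q hy)))

/-- The chart of the quotient given by a slice. -/
def chart (hopen : IsOpenMap (Quotient.mk r)) :
    OpenPartialHomeomorph (Quotient r) (EuclideanSpace ℝ (Fin k)) where
  toFun := S.descend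
  invFun w := Quotient.mk r (S.s w)
  source := Quotient.mk r '' S.V
  target := S.W
  map_source' := by
    rintro _ ⟨y, hy, rfl⟩
    rw [S.descend_mk hy]
    exact S.mapsTo_q hy
  map_target' w hw := ⟨S.s w, S.mapsTo_s hw, rfl⟩
  left_inv' := by
    rintro _ ⟨y, hy, rfl⟩
    rw [S.descend_mk hy, S.mk_s_q hy]
  right_inv' w hw := by rw [S.descend_mk (S.mapsTo_s hw), S.q_s w hw]
  open_source := hopen _ S.isOpen_V
  open_target := S.isOpen_W
  continuousOn_toFun := by
    rw [continuousOn_open_iff (hopen _ S.isOpen_V)]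
    intro O hO
    have : Quotient.mk r '' S.V ∩ S.descend ⁻¹' O = Quotient.mk r '' (S.V ∩ S.q ⁻¹' O) := by
      ext z
      constructor
      · rintro ⟨⟨y, hy, rfl⟩, h⟩
        rw [mem_preimage, S.descend_mk hy] at h
        exact ⟨y, ⟨hy, h⟩, rfl⟩
      · rintro ⟨y, ⟨hy, h⟩, rfl⟩
        exact ⟨⟨y, hy, rfl⟩, by rwa [mem_preimage, S.descend_mk hy]⟩
    rw [this]
    exact hopen _ (S.smooth_q.continuousOn.isOpen_inter_preimage S.isOpen_V hO)
  continuousOn_invFun := continuous_quotient_mk'.comp_continuousOn S.smooth_s.continuousOn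

end Slice

/-- If an equivalence relation on a manifold has slices at all points, its classes are permuted
transitively by smooth maps and its projection is open, then its quotient is a manifold. -/
theorem exists_quotient_manifold (r : Setoid N) (k : ℕ) (hopen : IsOpenMap (Quotient.mk r))
    (hslice : ∀ x : N, ∃ S : Slice (F := F) r k, x ∈ S.V)
    (htrans : ∀ y y', r y y' → ∃ τ : N → N, ContMDiff 𝓘(ℝ, F) 𝓘(ℝ, F) ∞ τ ∧ τ y = y' ∧
      ∀ z, r z (τ z)) :
    ∃ _ : ChartedSpace (EuclideanSpace ℝ (Fin k)) (Quotient r),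
      IsManifold 𝓘(ℝ, EuclideanSpace ℝ (Fin k)) ∞ (Quotient r) ∧
      ContMDiff 𝓘(ℝ, F) 𝓘(ℝ, EuclideanSpace ℝ (Fin k)) ∞ (Quotient.mk r) ∧
      ∀ x : N, ∃ U : Set (Quotient r), IsOpen U ∧ Quotient.mk r x ∈ U ∧ ∃ f : Quotient r → N,
        ContMDiffOn 𝓘(ℝ, EuclideanSpace ℝ (Fin k)) 𝓘(ℝ, F) ∞ f U ∧
        f (Quotient.mk r x) = x ∧ ∀ y ∈ U, Quotient.mk r (f y) = y := by
  choose S hS using hslice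
  -- the composition of the projection with a chart is smooth
  have hsmooth : ∀ (x y : N), Quotient.mk r y ∈ ((S x).chart hopen).source →
      ContMDiffAt 𝓘(ℝ, F) 𝓘(ℝ, EuclideanSpace ℝ (Fin k)) ∞
        (fun z => (S x).descend (Quotient.mk r z)) y := by
    rintro x y ⟨y', hy', hyy'⟩
    -- The point `y` need not lie in `V`; only its class meets `V`. The map `τ` moves a
    -- neighbourhood of `y` into `V` without changing classes.
    obtain ⟨τ, hτ, hτy, hrτ⟩ := htrans y y' (Quotient.exact hyy'.symm)
    have h1 : ContMDiffAt 𝓘(ℝ, F) 𝓘(ℝ, EuclideanSpace ℝ (Fin k)) ∞ (S x).q (τ y) := by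
      rw [hτy]
      exact (S x).smooth_q.contMDiffAt ((S x).isOpen_V.mem_nhds hy')
    refine (h1.comp y hτ.contMDiffAt).congr_of_eventuallyEq ?_
    have h2 : ∀ᶠ z in 𝓝 y, τ z ∈ (S x).V :=
      hτ.continuous.continuousAt.preimage_mem_nhds
        ((S x).isOpen_V.mem_nhds (by rwa [hτy]))
    filter_upwards [h2] with z hz
    rw [Function.comp_apply, ← (S x).descend_mk hz]
    congr 1
    exact Quotient.sound (hrτ z)
  let cs : ChartedSpace (EuclideanSpace ℝ (Fin k)) (Quotient r) :=
    { atlas := {e | ∃ x, e = (S x).chart hopen}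
      chartAt := fun z => (S z.out).chart hopen
      mem_chart_source := fun z => ⟨z.out, hS _, z.out_eq⟩
      chart_mem_atlas := fun z => ⟨z.out, rfl⟩ }
  have hman : IsManifold 𝓘(ℝ, EuclideanSpace ℝ (Fin k)) ∞ (Quotient r) := by
    refine isManifold_of_contDiffOn _ _ _ ?_
    rintro _ _ ⟨x, rfl⟩ ⟨x', rfl⟩ w hw
    simp only [modelWithCornersSelf_coe_symm, modelWithCornersSelf_coe, range_id, inter_univ,
      preimage_id, OpenPartialHomeomorph.trans_source] at hw
    have hwW : w ∈ (S x).W := hw.1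
    have h1 : ContMDiffAt 𝓘(ℝ, EuclideanSpace ℝ (Fin k)) 𝓘(ℝ, EuclideanSpace ℝ (Fin k)) ∞
        (fun w => (S x').descend (Quotient.mk r ((S x).s w))) w :=
      (hsmooth x' ((S x).s w) hw.2).comp w
        ((S x).smooth_s.contMDiffAt ((S x).isOpen_W.mem_nhds hwW))
    exact (contMDiffAt_iff_contDiffAt.1 h1).contDiffWithinAt
  refine ⟨cs, hman, ?_, ?_⟩
  · intro y
    rw [contMDiffAt_iff_target]
    refine ⟨continuous_quotient_mk'.continuousAt, ?_⟩
    exact hsmooth _ y (mem_chart_source (EuclideanSpace ℝ (Fin k)) (Quotient.mk r y))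
  · intro x
    set z := Quotient.mk r x
    have hrx : r (Quotient.out z) x := Quotient.exact (Quotient.out_eq z)
    set T := S (Quotient.out z)
    have hTV : Quotient.out z ∈ T.V := hS _
    -- The section of the slice meets the class of `x` at some other point in general; composing
    -- with `τ` makes it pass through `x`.
    obtain ⟨τ, hτ, hτy, hrτ⟩ := htrans (T.s (T.q (Quotient.out z))) x
      (Quotient.exact ((T.mk_s_q hTV).trans (Quotient.out_eq z)))
    refine ⟨(T.chart hopen).source, (T.chart hopen).open_source, ⟨_, hTV, z.out_eq⟩,
      fun y => τ (T.s (T.descend y)), ?_, ?_, ?_⟩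
    · have h1 : ContMDiffOn 𝓘(ℝ, EuclideanSpace ℝ (Fin k)) 𝓘(ℝ, EuclideanSpace ℝ (Fin k)) ∞
          T.descend (T.chart hopen).source :=
        contMDiffOn_chart (I := 𝓘(ℝ, EuclideanSpace ℝ (Fin k))) (x := z)
      refine hτ.comp_contMDiffOn (T.smooth_s.comp h1 ?_)
      rintro y ⟨y', hy', rfl⟩
      rw [mem_preimage, T.descend_mk hy']
      exact T.mapsTo_q hy'
    · have : T.descend z = T.q (Quotient.out z) := by
        rw [← T.descend_mk hTV, Quotient.out_eq]
      simp only
      rw [this, hτy]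
    · rintro y ⟨y', hy', rfl⟩
      simp only
      rw [T.descend_mk hy', ← T.mk_s_q hy']
      exact (Quotient.sound (hrτ _)).symm

end QuotientManifold


/-! ### The derivative of the adjoint action for a local group in a vector space. -/

section AdjointInCharts

variable {E : Type*} [NormedAddCommGroup E] [NormedSpace ℝ E]

lemma fderiv_comp_prodMk_right {E₁ E₂ E₃ : Type*} [NormedAddCommGroup E₁] [NormedSpace ℝ E₁]
    [NormedAddCommGroup E₂] [NormedSpace ℝ E₂] [NormedAddCommGroup E₃] [NormedSpace ℝ E₃]
    {f : E₁ × E₂ → E₃} {a : E₁} {b : E₂} (hf : DifferentiableAt ℝ f (a, b)) (v : E₂) :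
    fderiv ℝ (fun y => f (a, y)) b v = fderiv ℝ f (a, b) (0, v) := by
  have h := hf.hasFDerivAt.comp b (hasFDerivAt_prodMk_right a b)
  exact congrArg (fun T => T v) h.fderiv

lemma fderiv_comp_prodMk_left {E₁ E₂ E₃ : Type*} [NormedAddCommGroup E₁] [NormedSpace ℝ E₁]
    [NormedAddCommGroup E₂] [NormedSpace ℝ E₂] [NormedAddCommGroup E₃] [NormedSpace ℝ E₃]
    {f : E₁ × E₂ → E₃} {a : E₁} {b : E₂} (hf : DifferentiableAt ℝ f (a, b)) (v : E₁) :
    fderiv ℝ (fun y => f (y, b)) a v = fderiv ℝ f (a, b) (v, 0) := by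
  have h := HasFDerivAt.comp (f := fun y : E₁ => (y, b)) a hf.hasFDerivAt
    (hasFDerivAt_prodMk_left a b)
  exact congrArg (fun T => T v) h.fderiv

/-- For a local group multiplication `m` with conjugation `C`, the derivative at the neutral
element of the adjoint action is the bracket of the left-invariant vector fields. -/
lemma fderiv_conj_eq_lieBracket {m C : E × E → E} {e : E}
    (hm : ContDiffAt ℝ ∞ m (e, e)) (hC : ContDiffAt ℝ ∞ C (e, e))
    (hml : ∀ᶠ b in 𝓝 e, m (b, e) = b) (hmr : ∀ᶠ b in 𝓝 e, m (e, b) = b)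
    (hCe : ∀ᶠ b in 𝓝 e, C (b, e) = e) (hCid : ∀ᶠ a in 𝓝 e, C (e, a) = a)
    (hmC : ∀ᶠ p in 𝓝 (e, e), m (C p, p.1) = m p) (ξ ζ : E) :
    fderiv ℝ (fun b => fderiv ℝ C (b, e) (0, ζ)) e ξ =
      VectorField.lieBracket ℝ (fun b => fderiv ℝ m (b, e) (0, ξ))
        (fun b => fderiv ℝ m (b, e) (0, ζ)) e := by
  have hmd : DifferentiableAt ℝ m (e, e) := hm.differentiableAt (by simp)
  have hCd : DifferentiableAt ℝ C (e, e) := hC.differentiableAt (by simp)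
  have hm' : DifferentiableAt ℝ (fderiv ℝ m) (e, e) :=
    (hm.fderiv_right (m := 1) (by exact WithTop.coe_le_coe.2 le_top)).differentiableAt (by simp)
  have hC' : DifferentiableAt ℝ (fderiv ℝ C) (e, e) :=
    (hC.fderiv_right (m := 1) (by exact WithTop.coe_le_coe.2 le_top)).differentiableAt (by simp)
  have hCee : C (e, e) = e := hCe.self_of_nhds
  have hsymm : ∀ v w, fderiv ℝ (fderiv ℝ m) (e, e) v w = fderiv ℝ (fderiv ℝ m) (e, e) w v :=
    fun v w => (hm.isSymmSndFDerivAt (by simp; exact WithTop.coe_le_coe.2 le_top)) v w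
  have hid : ∀ v, fderiv ℝ m (e, e) (v, 0) = v := by
    intro v
    rw [← fderiv_comp_prodMk_left hmd]
    have : (fun b => m (b, e)) =ᶠ[𝓝 e] id := hml
    rw [this.fderiv_eq, fderiv_id]; rfl
  have hid' : ∀ v, fderiv ℝ m (e, e) (0, v) = v := by
    intro v
    rw [← fderiv_comp_prodMk_right hmd]
    have : (fun b => m (e, b)) =ᶠ[𝓝 e] id := hmr
    rw [this.fderiv_eq, fderiv_id]; rfl
  have hA : ∀ v, fderiv ℝ C (e, e) (0, v) = v := by
    intro v
    rw [← fderiv_comp_prodMk_right hCd]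
    have : (fun b => C (e, b)) =ᶠ[𝓝 e] id := hCid
    rw [this.fderiv_eq, fderiv_id]; rfl
  have hXd : ∀ v, HasFDerivAt (fun b => fderiv ℝ m (b, e) (0, v))
      ((ContinuousLinearMap.apply ℝ E ((0 : E), v)).comp
        ((fderiv ℝ (fderiv ℝ m) (e, e)).comp (ContinuousLinearMap.inl ℝ E E))) e := fun v =>
    (ContinuousLinearMap.apply ℝ E ((0 : E), v)).hasFDerivAt.comp e
      (HasFDerivAt.comp (f := fun b : E => (b, e)) e hm'.hasFDerivAt
        (hasFDerivAt_prodMk_left e e))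
  have hX : ∀ v w, fderiv ℝ (fun b => fderiv ℝ m (b, e) (0, v)) e w =
      fderiv ℝ (fderiv ℝ m) (e, e) (w, 0) (0, v) := fun v w => by
    rw [(hXd v).fderiv]; rfl
  have hAd : HasFDerivAt (fun b => fderiv ℝ C (b, e) (0, ζ))
      ((ContinuousLinearMap.apply ℝ E ((0 : E), ζ)).comp
        ((fderiv ℝ (fderiv ℝ C) (e, e)).comp (ContinuousLinearMap.inl ℝ E E))) e :=
    (ContinuousLinearMap.apply ℝ E ((0 : E), ζ)).hasFDerivAt.comp e
      (HasFDerivAt.comp (f := fun b : E => (b, e)) e hC'.hasFDerivAt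
        (hasFDerivAt_prodMk_left e e))
  set A : E → E := fun b => fderiv ℝ C (b, e) (0, ζ) with hAdef
  -- the first-order identity
  have hfirst : ∀ᶠ b in 𝓝 e, fderiv ℝ m (e, b) (A b, 0) = fderiv ℝ m (b, e) (0, ζ) := by
    have h1 : ∀ᶠ p in 𝓝 (e, e), DifferentiableAt ℝ m p :=
      (hm.of_le (m := 1) (by exact WithTop.coe_le_coe.2 le_top)).eventually (by simp) |>.mono
        fun p hp => hp.differentiableAt (by simp)
    have h2 : ∀ᶠ p in 𝓝 (e, e), DifferentiableAt ℝ C p :=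
      (hC.of_le (m := 1) (by exact WithTop.coe_le_coe.2 le_top)).eventually (by simp) |>.mono
        fun p hp => hp.differentiableAt (by simp)
    have hc1 : Tendsto (fun b : E => (b, e)) (𝓝 e) (𝓝 (e, e)) :=
      (continuous_id.prodMk continuous_const).tendsto e
    have hc2 : Tendsto (fun b : E => (e, b)) (𝓝 e) (𝓝 (e, e)) :=
      (continuous_const.prodMk continuous_id).tendsto e
    filter_upwards [hc1.eventually h1, hc1.eventually h2, hc2.eventually h1,
      hc1.eventually hmC.eventually_nhds, hCe] with b hb1 hb2 hb3 hb4 hb5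
    have hCb : HasFDerivAt (fun a => C (b, a))
        ((fderiv ℝ C (b, e)).comp (ContinuousLinearMap.inr ℝ E E)) e :=
      hb2.hasFDerivAt.comp e (hasFDerivAt_prodMk_right b e)
    have h3 : HasFDerivAt m (fderiv ℝ m (e, b)) (C (b, e), b) := by
      rw [hb5]; exact hb3.hasFDerivAt
    have h4 : HasFDerivAt (fun a => m (C (b, a), b)) ((fderiv ℝ m (e, b)).comp
        ((ContinuousLinearMap.inl ℝ E E).comp
          ((fderiv ℝ C (b, e)).comp (ContinuousLinearMap.inr ℝ E E)))) e :=
      h3.comp e ((hasFDerivAt_prodMk_left (C (b, e)) b).comp e hCb)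
    have h5 : (fun a => m (C (b, a), b)) =ᶠ[𝓝 e] fun a => m (b, a) := by
      have hc3 : Tendsto (fun a : E => (b, a)) (𝓝 e) (𝓝 (b, e)) :=
        (continuous_const.prodMk continuous_id).tendsto e
      exact hc3.eventually hb4
    rw [← fderiv_comp_prodMk_right hb1, ← h5.fderiv_eq, h4.fderiv]
    rfl
  -- its derivative
  have hL : HasFDerivAt (fun b => fderiv ℝ m (e, b) (A b, 0)) _ e :=
    (hm'.hasFDerivAt.comp e (hasFDerivAt_prodMk_right e e)).clm_apply
      ((hasFDerivAt_prodMk_left (A e) (0 : E)).comp e hAd)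
  have hR := (hXd ζ).congr_of_eventuallyEq hfirst
  -- With `D²` the second derivative of `m` at `(e, e)`, this says `DA(ξ) + D²((0, ξ), (ζ, 0)) =
  -- D²((ξ, 0), (0, ζ))`. Symmetry of `D²` turns the resulting difference into the bracket of the
  -- left-invariant fields.
  have huniq := congrArg (fun T => T ξ) (hL.unique hR)
  simp only [add_apply, ContinuousLinearMap.comp_apply,
    ContinuousLinearMap.flip_apply, ContinuousLinearMap.inr_apply, ContinuousLinearMap.inl_apply,
    ContinuousLinearMap.apply_apply, Function.comp_apply] at huniq
  rw [hid] at huniq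
  have hAe : A e = ζ := hA ζ
  rw [hAe] at huniq
  rw [hAd.fderiv, VectorField.lieBracket_eq]
  simp only [hid', hX]
  rw [hsymm (ζ, 0), ← huniq]
  simp only [ContinuousLinearMap.comp_apply, ContinuousLinearMap.inl_apply,
    ContinuousLinearMap.apply_apply]
  abel

end AdjointInCharts


/-! ### Lie group operations, left-invariant fields and the bracket in the chart at `1`. -/

section LieGroupCharts

variable {E_G : Type*} [NormedAddCommGroup E_G] [NormedSpace ℝ E_G]
  {G : Type*} [TopologicalSpace G] [ChartedSpace E_G G] [Group G] [LieGroup 𝓘(ℝ, E_G) ∞ G]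

variable (E_G G) in
/-- The multiplication of a Lie group in the chart around the neutral element. -/
def chartMul (p : E_G × E_G) : E_G :=
  extChartAt 𝓘(ℝ, E_G) (1 : G) ((extChartAt 𝓘(ℝ, E_G) (1 : G)).symm p.1 *
    (extChartAt 𝓘(ℝ, E_G) (1 : G)).symm p.2)

variable (E_G G) in
/-- The conjugation `(a, b) ↦ a b a⁻¹` in the chart around the neutral element. -/
def chartConj (p : E_G × E_G) : E_G :=
  extChartAt 𝓘(ℝ, E_G) (1 : G) ((extChartAt 𝓘(ℝ, E_G) (1 : G)).symm p.1 *
    (extChartAt 𝓘(ℝ, E_G) (1 : G)).symm p.2 * ((extChartAt 𝓘(ℝ, E_G) (1 : G)).symm p.1)⁻¹)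

variable (E_G G) in
/-- The coordinates of the neutral element. -/
def chartOne : E_G := extChartAt 𝓘(ℝ, E_G) (1 : G) 1

lemma chartOne_mem_target : chartOne E_G G ∈ (extChartAt 𝓘(ℝ, E_G) (1 : G)).target :=
  mem_extChartAt_target 1

lemma one_mem_source : (1 : G) ∈ (extChartAt 𝓘(ℝ, E_G) (1 : G)).source :=
  mem_extChartAt_source 1

@[simp]
lemma symm_chartOne : (extChartAt 𝓘(ℝ, E_G) (1 : G)).symm (chartOne E_G G) = 1 :=
  (extChartAt 𝓘(ℝ, E_G) (1 : G)).left_inv one_mem_source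

lemma smoothAt_left_mul (g h : G) : SmoothAt E_G E_G (fun k : G => g * k) h :=
  (contMDiff_mul_left (I := 𝓘(ℝ, E_G)) (n := ∞) (a := g)).contMDiffAt

lemma smoothAt_right_mul (g h : G) : SmoothAt E_G E_G (fun k : G => k * g) h :=
  (contMDiff_mul_right (I := 𝓘(ℝ, E_G)) (n := ∞) (a := g)).contMDiffAt

lemma smoothAt_conj (g h : G) : SmoothAt E_G E_G (fun k : G => g * k * g⁻¹) h :=
  ((smoothAt_right_mul (E_G := E_G) g⁻¹ (g * h)).comp h (smoothAt_left_mul g h) :)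

lemma smoothAt_symm_fst {p : E_G × E_G}
    (h : p.1 ∈ (extChartAt 𝓘(ℝ, E_G) (1 : G)).target) :
    SmoothAt (E_G × E_G) E_G
      (fun p : E_G × E_G => (extChartAt 𝓘(ℝ, E_G) (1 : G)).symm p.1) p :=
  ContMDiffAt.comp p (smoothAt_extChartAt_symm h) contDiff_fst.contMDiff.contMDiffAt

lemma smoothAt_symm_snd {p : E_G × E_G}
    (h : p.2 ∈ (extChartAt 𝓘(ℝ, E_G) (1 : G)).target) :
    SmoothAt (E_G × E_G) E_G
      (fun p : E_G × E_G => (extChartAt 𝓘(ℝ, E_G) (1 : G)).symm p.2) p :=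
  ContMDiffAt.comp p (smoothAt_extChartAt_symm h) contDiff_snd.contMDiff.contMDiffAt

lemma contDiffAt_chartMul {p : E_G × E_G}
    (h1 : p.1 ∈ (extChartAt 𝓘(ℝ, E_G) (1 : G)).target)
    (h2 : p.2 ∈ (extChartAt 𝓘(ℝ, E_G) (1 : G)).target)
    (h : (extChartAt 𝓘(ℝ, E_G) (1 : G)).symm p.1 * (extChartAt 𝓘(ℝ, E_G) (1 : G)).symm p.2 ∈
      (extChartAt 𝓘(ℝ, E_G) (1 : G)).source) :
    ContDiffAt ℝ ∞ (chartMul E_G G) p := by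
  rw [← contMDiffAt_iff_contDiffAt]
  exact (smoothAt_extChartAt h).comp p ((smoothAt_symm_fst h1).mul (smoothAt_symm_snd h2))

lemma contDiffAt_chartMul_one :
    ContDiffAt ℝ ∞ (chartMul E_G G) (chartOne E_G G, chartOne E_G G) := by
  refine contDiffAt_chartMul chartOne_mem_target chartOne_mem_target ?_
  simp only [symm_chartOne, mul_one]
  exact one_mem_source

lemma contDiffAt_chartConj_one :
    ContDiffAt ℝ ∞ (chartConj E_G G) (chartOne E_G G, chartOne E_G G) := by
  rw [← contMDiffAt_iff_contDiffAt]
  have h1 := smoothAt_symm_fst (E_G := E_G) (G := G) (p := (chartOne E_G G, chartOne E_G G))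
    chartOne_mem_target
  have h2 := smoothAt_symm_snd (E_G := E_G) (G := G) (p := (chartOne E_G G, chartOne E_G G))
    chartOne_mem_target
  refine ContMDiffAt.comp (g := extChartAt 𝓘(ℝ, E_G) (1 : G)) _ (smoothAt_extChartAt ?_)
    ((h1.mul h2).mul h1.inv)
  simp only [symm_chartOne, mul_one, inv_one]
  exact one_mem_source

/-- The left-invariant vector field with value `ξ` at the neutral element. -/
def leftInvariant (ξ : E_G) (g : G) : E_G := md E_G E_G (fun h : G => g * h) 1 ξ

lemma leftInvariant_one (ξ : E_G) : leftInvariant ξ (1 : G) = ξ := by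
  have : (fun h : G => 1 * h) = fun h => h := by funext h; simp
  rw [leftInvariant, this, md_id]
  rfl

lemma leftInvariant_mul (ξ : E_G) (g h : G) :
    leftInvariant ξ (g * h) = md E_G E_G (fun k : G => g * k) h (leftInvariant ξ h) := by
  have h1 : (fun k : G => g * h * k) = fun k => (fun k => g * k) (h * k) := by
    funext k
    simp [mul_assoc]
  rw [leftInvariant, h1, md_comp_apply (smoothAt_left_mul g _) (smoothAt_left_mul h _), mul_one]
  rfl

/-- The left-invariant vector fields in the chart around the neutral element. -/
lemma md_extChartAt_leftInvariant (ξ : E_G) {b : E_G}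
    (hb : b ∈ (extChartAt 𝓘(ℝ, E_G) (1 : G)).target) :
    md E_G E_G (extChartAt 𝓘(ℝ, E_G) (1 : G)) ((extChartAt 𝓘(ℝ, E_G) (1 : G)).symm b)
      (leftInvariant ξ ((extChartAt 𝓘(ℝ, E_G) (1 : G)).symm b)) =
      fderiv ℝ (chartMul E_G G) (b, chartOne E_G G) (0, ξ) := by
  set φ := extChartAt 𝓘(ℝ, E_G) (1 : G)
  have hmem : φ.symm b * φ.symm (chartOne E_G G) ∈ φ.source := by
    rw [symm_chartOne, mul_one]
    exact φ.map_target hb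
  have hd : DifferentiableAt ℝ (chartMul E_G G) (b, chartOne E_G G) :=
    (contDiffAt_chartMul hb chartOne_mem_target hmem).differentiableAt (by simp)
  rw [← fderiv_comp_prodMk_right hd]
  have h := fderiv_extChartAt_comp (f := fun k : G => φ.symm b * k) (p := (1 : G)) (q := (1 : G))
    (chartOne_mem_target (E_G := E_G) (G := G)) hmem (smoothAt_left_mul _ _) ξ
  refine Eq.trans ?_ h.symm
  rw [chartOne, md_extChartAt_symm_self, ← chartOne, symm_chartOne, mul_one]
  rfl

lemma eventually_mem_target :
    ∀ᶠ b in 𝓝 (chartOne E_G G), b ∈ (extChartAt 𝓘(ℝ, E_G) (1 : G)).target :=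
  (isOpen_extChartAt_target (1 : G)).mem_nhds chartOne_mem_target

/-- The adjoint action in the chart around the neutral element. -/
lemma Ad_symm_eq_fderiv (ζ : E_G) :
    ∀ᶠ b in 𝓝 (chartOne E_G G),
      md E_G E_G (fun h : G => (extChartAt 𝓘(ℝ, E_G) (1 : G)).symm b * h *
        ((extChartAt 𝓘(ℝ, E_G) (1 : G)).symm b)⁻¹) 1 ζ =
      fderiv ℝ (chartConj E_G G) (b, chartOne E_G G) (0, ζ) := by
  set φ := extChartAt 𝓘(ℝ, E_G) (1 : G)
  have h1 : ∀ᶠ p in 𝓝 (chartOne E_G G, chartOne E_G G), ContDiffAt ℝ 1 (chartConj E_G G) p :=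
    (contDiffAt_chartConj_one.of_le (m := 1)
      (by exact WithTop.coe_le_coe.2 le_top)).eventually (by simp)
  have hc1 : Tendsto (fun b : E_G => (b, chartOne E_G G)) (𝓝 (chartOne E_G G))
      (𝓝 (chartOne E_G G, chartOne E_G G)) :=
    (continuous_id.prodMk continuous_const).tendsto _
  filter_upwards [hc1.eventually h1] with b hb
  rw [← fderiv_comp_prodMk_right (hb.differentiableAt (by simp))]
  have hone : φ.symm b * φ.symm (chartOne E_G G) * (φ.symm b)⁻¹ = 1 := by
    rw [symm_chartOne]
    simp
  have h := fderiv_extChartAt_comp (f := fun k : G => φ.symm b * k * (φ.symm b)⁻¹)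
    (p := (1 : G)) (q := (1 : G)) (chartOne_mem_target (E_G := E_G) (G := G))
    (by rw [hone]; exact one_mem_source) (smoothAt_conj _ _) ζ
  refine Eq.trans ?_ h.symm
  rw [hone, md_extChartAt_self, chartOne, md_extChartAt_symm_self, ← chartOne, symm_chartOne]

/-- The left-invariant vector fields in the chart around the neutral element. -/
lemma mpullbackWithin_eq_fderiv_chartMul (ξ : E_G) {b : E_G}
    (hb : b ∈ (extChartAt 𝓘(ℝ, E_G) (1 : G)).target) :
    (VectorField.mpullbackWithin 𝓘(ℝ, E_G) 𝓘(ℝ, E_G) (extChartAt 𝓘(ℝ, E_G) (1 : G)).symm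
      (mulInvariantVectorField (I := 𝓘(ℝ, E_G)) (G := G) ξ) (range 𝓘(ℝ, E_G)) b : E_G) =
      fderiv ℝ (chartMul E_G G) (b, chartOne E_G G) (0, ξ) := by
  rw [← md_extChartAt_leftInvariant (G := G) ξ hb]
  set φ := extChartAt 𝓘(ℝ, E_G) (1 : G) with hφ
  -- Pulling a field back along `φ.symm` applies the inverse of its differential, which is the
  -- differential of `φ`.
  have hinv : (md E_G E_G φ.symm b).inverse = md E_G E_G φ (φ.symm b) := by
    apply ContinuousLinearMap.inverse_eq
    · ext v
      have := md_extChartAt_symm_left (φ.map_target hb) v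
      rw [φ.right_inv hb] at this
      exact this
    · ext v
      exact md_extChartAt_symm_right hb v
  have h1 : range 𝓘(ℝ, E_G) = univ := by simp
  rw [VectorField.mpullbackWithin, h1, mfderivWithin_univ]
  exact congrArg (fun T : E_G →L[ℝ] E_G => T (leftInvariant ξ (φ.symm b))) hinv

variable (E_G G) in
/-- The bracket of the Lie algebra of `G`, as an operation on the model space. -/
def modelBracket (ξ ζ : E_G) : E_G :=
  Bracket.bracket (L := GroupLieAlgebra 𝓘(ℝ, E_G) G) (M := GroupLieAlgebra 𝓘(ℝ, E_G) G) ξ ζ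

/-- The bracket of the Lie algebra in the chart around the neutral element. -/
lemma modelBracket_eq_lieBracket (ξ ζ : E_G) :
    modelBracket E_G G ξ ζ = VectorField.lieBracket ℝ
      (fun b => fderiv ℝ (chartMul E_G G) (b, chartOne E_G G) (0, ξ))
      (fun b => fderiv ℝ (chartMul E_G G) (b, chartOne E_G G) (0, ζ)) (chartOne E_G G) := by
  let X : E_G → E_G → E_G := fun ξ b =>
    VectorField.mpullbackWithin 𝓘(ℝ, E_G) 𝓘(ℝ, E_G) (extChartAt 𝓘(ℝ, E_G) (1 : G)).symm
      (mulInvariantVectorField (I := 𝓘(ℝ, E_G)) (G := G) ξ) (range 𝓘(ℝ, E_G)) b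
  have h0 : modelBracket E_G G ξ ζ = (md E_G E_G (extChartAt 𝓘(ℝ, E_G) (1 : G)) 1).inverse
      (VectorField.lieBracketWithin ℝ (X ξ) (X ζ)
        ((extChartAt 𝓘(ℝ, E_G) (1 : G)).symm ⁻¹' univ ∩ range 𝓘(ℝ, E_G)) (chartOne E_G G)) :=
    rfl
  have hmd : md E_G E_G (extChartAt 𝓘(ℝ, E_G) (1 : G)) 1 = ContinuousLinearMap.id ℝ E_G := by
    ext v
    exact md_extChartAt_self 1 v
  have h1 : (extChartAt 𝓘(ℝ, E_G) (1 : G)).symm ⁻¹' univ ∩ range 𝓘(ℝ, E_G) = univ := by simp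
  have hX : ∀ ξ, X ξ =ᶠ[𝓝 (chartOne E_G G)]
      fun b => fderiv ℝ (chartMul E_G G) (b, chartOne E_G G) (0, ξ) := fun ξ => by
    filter_upwards [eventually_mem_target (E_G := E_G) (G := G)] with b hb
    exact mpullbackWithin_eq_fderiv_chartMul ξ hb
  rw [h0, hmd, ContinuousLinearMap.inverse_id, h1, VectorField.lieBracketWithin_univ]
  exact (hX ξ).lieBracket_vectorField_eq (hX ζ)

/-- The adjoint action is smooth at the neutral element and its derivative is the bracket. -/
theorem smoothAt_Ad_and_md_Ad (ζ : E_G) :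
    SmoothAt E_G E_G (fun g : G => md E_G E_G (fun h : G => g * h * g⁻¹) 1 ζ) 1 ∧
    ∀ ξ : E_G, md E_G E_G (fun g : G => md E_G E_G (fun h : G => g * h * g⁻¹) 1 ζ) 1 ξ =
      modelBracket E_G G ξ ζ := by
  set φ := extChartAt 𝓘(ℝ, E_G) (1 : G) with hφ
  set e := chartOne E_G G with he
  have hφe : φ 1 = e := rfl
  have hev : (fun g : G => md E_G E_G (fun h : G => g * h * g⁻¹) 1 ζ) =ᶠ[𝓝 1]
      fun g => fderiv ℝ (chartConj E_G G) (φ g, e) (0, ζ) := by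
    have h1 : Tendsto φ (𝓝 (1 : G)) (𝓝 e) := continuousAt_extChartAt 1
    filter_upwards [h1.eventually (Ad_symm_eq_fderiv (G := G) ζ),
      (isOpen_extChartAt_source (I := 𝓘(ℝ, E_G)) (1 : G)).mem_nhds one_mem_source] with g hg hgs
    rw [← hg, φ.left_inv hgs]
  have hc : ContDiffAt ℝ ∞ (fun b => fderiv ℝ (chartConj E_G G) (b, e) (0, ζ)) e := by
    have h1 : ContDiffAt ℝ ∞ (fun b => fderiv ℝ (chartConj E_G G) (b, e)) e :=
      ContDiffAt.comp (g := fderiv ℝ (chartConj E_G G)) e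
        (contDiffAt_chartConj_one.fderiv_right (by simp))
        (contDiffAt_id.prodMk contDiffAt_const)
    exact h1.clm_apply contDiffAt_const
  have hcm : SmoothAt E_G E_G (fun b => fderiv ℝ (chartConj E_G G) (b, e) (0, ζ)) (φ 1) :=
    contMDiffAt_iff_contDiffAt.2 hc
  have hφs : SmoothAt E_G E_G φ 1 := smoothAt_extChartAt one_mem_source
  refine ⟨(ContMDiffAt.comp (1 : G) hcm hφs).congr_of_eventuallyEq hev, fun ξ => ?_⟩
  rw [md_congr hev, md_comp_apply hcm hφs, md_extChartAt_self, md_eq_fderiv,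
    modelBracket_eq_lieBracket]
  refine fderiv_conj_eq_lieBracket contDiffAt_chartMul_one contDiffAt_chartConj_one
    ?_ ?_ ?_ ?_ ?_ ξ ζ
  · filter_upwards [eventually_mem_target (E_G := E_G) (G := G)] with b hb
    simp only [chartMul, symm_chartOne, mul_one]
    exact φ.right_inv hb
  · filter_upwards [eventually_mem_target (E_G := E_G) (G := G)] with b hb
    simp only [chartMul, symm_chartOne, one_mul]
    exact φ.right_inv hb
  · refine Eventually.of_forall fun b => ?_
    simp only [chartConj, symm_chartOne, mul_one, mul_inv_cancel]
    rfl
  · filter_upwards [eventually_mem_target (E_G := E_G) (G := G)] with b hb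
    simp only [chartConj, symm_chartOne, one_mul, inv_one, mul_one]
    exact φ.right_inv hb
  -- The identity `(b a b⁻¹) b = b a` passes to coordinates only where the conjugate stays in the
  -- chart domain.
  · have h1 : ∀ᶠ p : E_G × E_G in 𝓝 (e, e), φ.symm p.1 * φ.symm p.2 * (φ.symm p.1)⁻¹ ∈
        φ.source := by
      have h1 := smoothAt_symm_fst (E_G := E_G) (G := G) (p := (e, e)) chartOne_mem_target
      have h2 := smoothAt_symm_snd (E_G := E_G) (G := G) (p := (e, e)) chartOne_mem_target
      have hcont := ((h1.mul h2).mul h1.inv).continuousAt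
      refine hcont.preimage_mem_nhds ((isOpen_extChartAt_source (1 : G)).mem_nhds ?_)
      have hval : φ.symm e * φ.symm e * (φ.symm e)⁻¹ = 1 := by
        rw [he, symm_chartOne]
        simp
      show φ.symm e * φ.symm e * (φ.symm e)⁻¹ ∈ φ.source
      rw [hval]
      exact one_mem_source
    filter_upwards [h1] with p hp
    simp only [chartMul, chartConj]
    rw [φ.left_inv hp, inv_mul_cancel_right]

end LieGroupCharts


/-! ### Existence of smooth one-parameter subgroups. -/

section OneParameterSubgroups

variable {E_G : Type*} [NormedAddCommGroup E_G] [NormedSpace ℝ E_G] [FiniteDimensional ℝ E_G]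
  {G : Type*} [TopologicalSpace G] [ChartedSpace E_G G] [Group G] [LieGroup 𝓘(ℝ, E_G) ∞ G]
  [T2Space G]

/-- A curve in a normed space that solves an autonomous equation with smooth right-hand side is
smooth. -/
lemma contDiffOn_of_hasDerivAt {E : Type*} [NormedAddCommGroup E] [NormedSpace ℝ E]
    {X : E → E} {U : Set E} (hX : ContDiffOn ℝ ∞ X U) {I : Set ℝ} (hI : IsOpen I) {c : ℝ → E}
    (hcU : MapsTo c I U) (hc : ∀ t ∈ I, HasDerivAt c (X (c t)) t) : ContDiffOn ℝ ∞ c I := by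
  have hd : DifferentiableOn ℝ c I := fun t ht =>
    (hc t ht).differentiableAt.differentiableWithinAt
  -- Bootstrapping: if `c` is `C^n`, then so is `c' = X ∘ c`, hence `c` is `C^(n+1)`.
  have key : ∀ n : ℕ, ContDiffOn ℝ n c I := by
    intro n
    induction n with
    | zero => exact contDiffOn_zero.2 hd.continuousOn
    | succ n ih =>
      push_cast
      rw [contDiffOn_succ_iff_deriv_of_isOpen hI]
      refine ⟨hd, by simp, ?_⟩
      have h1 : ContDiffOn ℝ n (fun t => X (c t)) I :=
        (hX.of_le (by exact WithTop.coe_le_coe.2 le_top)).comp ih hcU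
      exact h1.congr fun t ht => (hc t ht).deriv
  exact contDiffOn_infty.2 key

/-- Every element of the Lie algebra is the velocity of a smooth one-parameter subgroup. -/
theorem exists_one_parameter_subgroup (ξ : E_G) :
    ∃ γ : ℝ → G, ContMDiff 𝓘(ℝ, ℝ) 𝓘(ℝ, E_G) ∞ γ ∧ (∀ s t, γ (s + t) = γ s * γ t) ∧
      md ℝ E_G γ 0 1 = ξ := by
  have : CompleteSpace E_G := FiniteDimensional.complete ℝ E_G
  have hLG : LieGroup 𝓘(ℝ, E_G) (minSmoothness ℝ 3) G := by
    rw [minSmoothness_of_isRCLikeNormedField]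
    exact LieGroup.of_le (n := ∞) (by exact WithTop.coe_le_coe.2 le_top)
  have hM1 : IsManifold 𝓘(ℝ, E_G) 1 G :=
    IsManifold.of_le (n := ∞) (by exact WithTop.coe_le_coe.2 le_top)
  set X : (g : G) → TangentSpace 𝓘(ℝ, E_G) g :=
    mulInvariantVectorField (I := 𝓘(ℝ, E_G)) (G := G) ξ with hXdef
  have hX : ContMDiff 𝓘(ℝ, E_G) 𝓘(ℝ, E_G).tangent 1
      (fun g : G => (⟨g, X g⟩ : TangentBundle 𝓘(ℝ, E_G) G)) := by
    refine (contMDiff_mulInvariantVectorField (I := 𝓘(ℝ, E_G)) (G := G) ξ).of_le ?_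
    rw [minSmoothness_of_isRCLikeNormedField]
    norm_num
  -- left translates of integral curves are integral curves
  have htrans : ∀ (g : G) (γ : ℝ → G) (s : Set ℝ), IsMIntegralCurveOn γ X s →
      IsMIntegralCurveOn (fun t => g * γ t) X s := by
    intro g γ s hγ t ht
    have h1 : HasMFDerivAt 𝓘(ℝ, E_G) 𝓘(ℝ, E_G) (fun k : G => g * k) (γ t)
        (md E_G E_G (fun k : G => g * k) (γ t)) := (smoothAt_left_mul g (γ t)).mda.hasMFDerivAt
    have h2 := h1.comp_hasMFDerivWithinAt t (hγ t ht)
    have hD : (md E_G E_G (fun k : G => g * k) (γ t)).comp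
        ((1 : ℝ →L[ℝ] ℝ).smulRight (leftInvariant ξ (γ t))) =
        (1 : ℝ →L[ℝ] ℝ).smulRight (leftInvariant ξ (g * γ t)) := by
      ext
      simp [leftInvariant_mul]
    exact (congrArg (fun T : ℝ →L[ℝ] E_G => HasMFDerivWithinAt 𝓘(ℝ, ℝ) 𝓘(ℝ, E_G)
      (fun t => g * γ t) s t T) hD).mp h2
  obtain ⟨γ₀, hγ₀1, hγ₀⟩ := exists_isMIntegralCurveAt_of_contMDiffAt_boundaryless (t₀ := 0)
    (hX.contMDiffAt (x := (1 : G)))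
  obtain ⟨ε, hε, hγ₀ε⟩ := isMIntegralCurveAt_iff'.1 hγ₀
  rw [Real.ball_eq_Ioo, zero_sub, zero_add] at hγ₀ε
  -- Left translates of `γ₀` give integral curves through every point with one common lifetime `ε`,
  -- so the field is complete.
  obtain ⟨γ, hγ1, hγ⟩ := exists_isMIntegralCurve_of_isMIntegralCurveOn hX hε
    (fun g => ⟨fun t => g * γ₀ t, by simp [hγ₀1], htrans g γ₀ _ hγ₀ε⟩) (1 : G)
  have hadd : ∀ s t, γ (s + t) = γ s * γ t := by
    intro s t
    -- Both `t ↦ γ (s + t)` and `t ↦ γ s * γ t` are integral curves starting at `γ s`; uniqueness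
    -- gives the homomorphism property.
    have h1 : IsMIntegralCurve (fun t => γ s * γ t) X :=
      isMIntegralCurve_iff_isMIntegralCurveOn.2 (htrans _ _ _ (hγ.isMIntegralCurveOn univ))
    have h2 := isMIntegralCurve_Ioo_eq_of_contMDiff_boundaryless (t₀ := 0) hX (hγ.comp_add s) h1
      (by simp [hγ1])
    have h3 := congrFun h2 t
    simpa [add_comm] using h3
  have hmd : ∀ t, HasMFDerivAt 𝓘(ℝ, ℝ) 𝓘(ℝ, E_G) γ t
      ((1 : ℝ →L[ℝ] ℝ).smulRight (leftInvariant ξ (γ t) : E_G)) := fun t => hγ t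
  -- smoothness at zero
  have hsm0 : SmoothAt ℝ E_G γ 0 := by
    set φ := extChartAt 𝓘(ℝ, E_G) (1 : G) with hφ
    set e := chartOne E_G G
    obtain ⟨U, hUsub, hU, heU⟩ : ∃ U ⊆ φ.target ∩ {b | ContDiffAt ℝ ∞ (chartMul E_G G) (b, e)},
        IsOpen U ∧ e ∈ U := by
      refine ⟨φ.target, fun b hb => ⟨hb, ?_⟩, isOpen_extChartAt_target 1, chartOne_mem_target⟩
      refine contDiffAt_chartMul hb chartOne_mem_target ?_
      rw [symm_chartOne, mul_one]
      exact φ.map_target hb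
    have hXs : ContDiffOn ℝ ∞ (fun b => fderiv ℝ (chartMul E_G G) (b, e) (0, ξ)) U := by
      intro b hb
      have h0 : ContDiffAt ℝ ∞ (chartMul E_G G) (b, e) := (hUsub hb).2
      have h1 : ContDiffAt ℝ ∞ (fun b => fderiv ℝ (chartMul E_G G) (b, e)) b :=
        ContDiffAt.comp (g := fderiv ℝ (chartMul E_G G)) b
          (h0.fderiv_right (by simp)) (contDiffAt_id.prodMk contDiffAt_const)
      exact (h1.clm_apply contDiffAt_const).contDiffWithinAt
    have hcont : Continuous γ := hγ.continuous
    have hsource : ∀ᶠ t in 𝓝 (0 : ℝ), γ t ∈ φ.source :=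
      hcont.continuousAt.preimage_mem_nhds
        ((isOpen_extChartAt_source (1 : G)).mem_nhds (by rw [hγ1]; exact one_mem_source))
    have hUt : ∀ᶠ t in 𝓝 (0 : ℝ), φ (γ t) ∈ U := by
      have h1 : ContinuousAt φ (γ 0) := by
        rw [hγ1]; exact continuousAt_extChartAt 1
      refine (ContinuousAt.comp h1 hcont.continuousAt).preimage_mem_nhds (hU.mem_nhds ?_)
      show φ (γ 0) ∈ U
      rw [hγ1]
      exact heU
    obtain ⟨δ, hδ, hball⟩ := Metric.mem_nhds_iff.1 (hsource.and hUt)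
    have hder : ∀ t ∈ Metric.ball (0 : ℝ) δ, HasDerivAt (fun t => φ (γ t))
        (fderiv ℝ (chartMul E_G G) (φ (γ t), e) (0, ξ)) t := by
      intro t ht
      have hts : γ t ∈ φ.source := (hball ht).1
      have h1 : HasMFDerivAt 𝓘(ℝ, E_G) 𝓘(ℝ, E_G) φ (γ t) (md E_G E_G φ (γ t)) :=
        (smoothAt_extChartAt hts).mda.hasMFDerivAt
      have hD : (md E_G E_G φ (γ t)).comp
          ((1 : ℝ →L[ℝ] ℝ).smulRight (leftInvariant ξ (γ t))) =
          (1 : ℝ →L[ℝ] ℝ).smulRight (fderiv ℝ (chartMul E_G G) (φ (γ t), e) (0, ξ)) := by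
        have hval : md E_G E_G φ (φ.symm (φ (γ t))) (leftInvariant ξ (φ.symm (φ (γ t)))) =
            fderiv ℝ (chartMul E_G G) (φ (γ t), e) (0, ξ) :=
          md_extChartAt_leftInvariant ξ (φ.map_source hts)
        rw [φ.left_inv hts] at hval
        rw [← hval]
        refine ContinuousLinearMap.ext_ring ?_
        show md E_G E_G φ (γ t) ((1 : ℝ) • leftInvariant ξ (γ t)) = (1 : ℝ) • _
        rw [one_smul, one_smul]
      have h2 : HasFDerivAt (fun t => φ (γ t)) ((md E_G E_G φ (γ t)).comp
          ((1 : ℝ →L[ℝ] ℝ).smulRight (leftInvariant ξ (γ t)))) t :=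
        hasMFDerivAt_iff_hasFDerivAt.1 (h1.comp t (hmd t))
      rw [hD] at h2
      simpa using h2.hasDerivAt
    have hc := contDiffOn_of_hasDerivAt hXs Metric.isOpen_ball (fun t ht => (hball ht).2) hder
    have h0 : (0 : ℝ) ∈ Metric.ball (0 : ℝ) δ := Metric.mem_ball_self hδ
    have hc0 : SmoothAt ℝ E_G (fun t => φ (γ t)) 0 :=
      contMDiffAt_iff_contDiffAt.2 (hc.contDiffAt (Metric.isOpen_ball.mem_nhds h0))
    have h3 : SmoothAt ℝ E_G (fun t => φ.symm (φ (γ t))) 0 :=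
      ContMDiffAt.comp (0 : ℝ) (smoothAt_extChartAt_symm (φ.map_source (hball h0).1)) hc0
    refine h3.congr_of_eventuallyEq ?_
    filter_upwards [hsource] with t ht
    exact (φ.left_inv ht).symm
  refine ⟨γ, fun s => ?_, hadd, ?_⟩
  · have h1 : SmoothAt ℝ ℝ (fun t : ℝ => t - s) s :=
      contMDiffAt_iff_contDiffAt.2 (contDiffAt_id.sub contDiffAt_const)
    have h2 : SmoothAt ℝ E_G γ (s - s) := by rw [sub_self]; exact hsm0
    -- Smoothness at `0` spreads to `s` through `γ t = γ s * γ (t - s)`.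
    have h3 : SmoothAt ℝ E_G (fun t => γ s * γ (t - s)) s :=
      ContMDiffAt.comp s (smoothAt_left_mul (γ s) (γ (s - s)))
        (ContMDiffAt.comp (g := γ) (f := fun t : ℝ => t - s) s h2 h1)
    refine h3.congr_of_eventuallyEq (Eventually.of_forall fun t => ?_)
    show γ t = γ s * γ (t - s)
    rw [← hadd]
    congr 1
    ring
  · have h1 : md ℝ E_G γ 0 = (1 : ℝ →L[ℝ] ℝ).smulRight (leftInvariant ξ (γ 0) : E_G) :=
      (hmd 0).mfderiv
    rw [h1, hγ1, leftInvariant_one]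
    simp

end OneParameterSubgroups


/-! ### Alternating 2-forms as bilinear forms. -/

section Bilinear

variable {E : Type*} [NormedAddCommGroup E] [NormedSpace ℝ E]

lemma update_one_cons {X : Type*} (a b c : X) : Function.update ![a, b] 1 c = ![a, c] := by
  ext i
  fin_cases i <;> rfl

/-- The bilinear form of an alternating 2-form. -/
def bilin (α : E [⋀^Fin 2]→L[ℝ] ℝ) : LinearMap.BilinForm ℝ E :=
  LinearMap.mk₂ ℝ (fun v w => α ![v, w])
    (fun a b w => α.toAlternatingMap.map_vecCons_add ![w] a b)
    (fun c a w => α.toAlternatingMap.map_vecCons_smul ![w] c a)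
    (fun v a b => by
      have h := α.toMultilinearMap.map_update_add ![v, 0] 1 a b
      simp only [update_one_cons] at h
      exact h)
    (fun c v a => by
      have h := α.toMultilinearMap.map_update_smul ![v, 0] 1 c a
      simp only [update_one_cons] at h
      exact h)

lemma bilin_apply (α : E [⋀^Fin 2]→L[ℝ] ℝ) (v w : E) : bilin α v w = α ![v, w] := rfl

lemma bilin_self (α : E [⋀^Fin 2]→L[ℝ] ℝ) (v : E) : bilin α v v = 0 :=
  α.map_eq_zero_of_eq ![v, v] (i := 0) (j := 1) rfl (by simp)

lemma bilin_isAlt (α : E [⋀^Fin 2]→L[ℝ] ℝ) : (bilin α).IsAlt := bilin_self α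

lemma bilin_neg (α : E [⋀^Fin 2]→L[ℝ] ℝ) (v w : E) : -bilin α v w = bilin α w v :=
  (bilin_isAlt α).neg_eq v w

end Bilinear

/-! ### Fundamental vector fields and orbits of one-parameter subgroups. -/

section Action

variable {E : Type*} [NormedAddCommGroup E] [NormedSpace ℝ E]
  {M : Type*} [TopologicalSpace M] [ChartedSpace E M]
  {E_G : Type*} [NormedAddCommGroup E_G] [NormedSpace ℝ E_G]
  {G : Type*} [TopologicalSpace G] [ChartedSpace E_G G] [Group G] [MulAction G M]

variable (E_G G E) in
/-- The value at `x` of the fundamental vector fields, as a linear map of model spaces. -/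
def fund (x : M) : E_G →L[ℝ] E := md E_G E (fun g : G => g • x) 1

/-- The preferred chart has identity differential at its centre, so the two derivatives agree. Sum
and product rules of vector spaces then apply to functions on manifolds. -/
lemma hasFDerivAt_comp_extChartAt_symm [IsManifold 𝓘(ℝ, E) ∞ M] {V : Type*}
    [NormedAddCommGroup V] [NormedSpace ℝ V] {f : M → V} {x : M} (hf : SmoothAt E V f x) :
    HasFDerivAt (fun z => f ((extChartAt 𝓘(ℝ, E) x).symm z)) (md E V f x)
      (extChartAt 𝓘(ℝ, E) x x) := by
  have hx := (extChartAt 𝓘(ℝ, E) x).left_inv (mem_extChartAt_source x)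
  have h1 := smoothAt_extChartAt_symm (mem_extChartAt_target (I := 𝓘(ℝ, E)) x)
  have h2 : SmoothAt E V f ((extChartAt 𝓘(ℝ, E) x).symm (extChartAt 𝓘(ℝ, E) x x)) := by
    rw [hx]; exact hf
  have h3 : SmoothAt E V (fun z => f ((extChartAt 𝓘(ℝ, E) x).symm z))
    (extChartAt 𝓘(ℝ, E) x x) := ContMDiffAt.comp _ h2 h1
  have h4 : md E V f x = fderiv ℝ (fun z => f ((extChartAt 𝓘(ℝ, E) x).symm z))
      (extChartAt 𝓘(ℝ, E) x x) := by
    ext v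
    rw [← md_eq_fderiv, md_comp_apply h2 h1, md_extChartAt_symm_self, hx]
  rw [h4]
  exact ((contMDiffAt_iff_contDiffAt.1 h3).differentiableAt (by simp)).hasFDerivAt

lemma contMDiff_smul_left (E_G : Type*) [NormedAddCommGroup E_G] [NormedSpace ℝ E_G]
    [ChartedSpace E_G G] [ContMDiffSMul 𝓘(ℝ, E_G) 𝓘(ℝ, E) ∞ G M] (g : G) :
    ContMDiff 𝓘(ℝ, E) 𝓘(ℝ, E) ∞ (fun x : M => g • x) :=
  (ContMDiffSMul.contMDiff_smul (I := 𝓘(ℝ, E_G)) (I' := 𝓘(ℝ, E)) (n := ∞)).comp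
    (contMDiff_const.prodMk contMDiff_id)

lemma smoothAt_smul_left (E_G : Type*) [NormedAddCommGroup E_G] [NormedSpace ℝ E_G]
    [ChartedSpace E_G G] [ContMDiffSMul 𝓘(ℝ, E_G) 𝓘(ℝ, E) ∞ G M] (g : G) (x : M) :
    SmoothAt E E (fun x : M => g • x) x :=
  contMDiff_smul_left E_G g x

variable [ContMDiffSMul 𝓘(ℝ, E_G) 𝓘(ℝ, E) ∞ G M]

lemma smoothAt_smul_right (g : G) (x : M) : SmoothAt E_G E (fun g : G => g • x) g :=
  ((ContMDiffSMul.contMDiff_smul (I := 𝓘(ℝ, E_G)) (I' := 𝓘(ℝ, E)) (n := ∞)).comp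
    (contMDiff_id.prodMk contMDiff_const)) g

/-- The velocity of an orbit of a one-parameter subgroup. -/
lemma md_one_parameter_smul {γ : ℝ → G} (hγ : ContMDiff 𝓘(ℝ, ℝ) 𝓘(ℝ, E_G) ∞ γ)
    (hadd : ∀ s t, γ (s + t) = γ s * γ t) (x : M) (t : ℝ) :
    md ℝ E (fun u => γ u • x) t 1 =
      md E E (fun y : M => γ t • y) x (fund E E_G G x (md ℝ E_G γ 0 1)) := by
  have h0 : γ 0 = 1 := by
    have := hadd 0 0
    rw [add_zero] at this
    exact (left_eq_mul.1 this)
  have h1 : (fun u => γ u • x) = fun u => (fun y : M => γ t • y) (γ (u - t) • x) := by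
    funext u
    show γ u • x = γ t • γ (u - t) • x
    rw [smul_smul, ← hadd]
    congr 2
    ring
  have hsub : SmoothAt ℝ ℝ (fun u : ℝ => u - t) t :=
    contMDiffAt_iff_contDiffAt.2 (contDiffAt_id.sub contDiffAt_const)
  have hγs : SmoothAt ℝ E_G (fun u : ℝ => γ (u - t)) t :=
    ContMDiffAt.comp t hγ.contMDiffAt hsub
  have hsm : SmoothAt ℝ E (fun u => γ (u - t) • x) t :=
    ContMDiffAt.comp (g := fun g : G => g • x) t (smoothAt_smul_right _ x) hγs
  have h2 : md ℝ ℝ (fun u : ℝ => u - t) t 1 = 1 := by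
    rw [md_eq_fderiv, fderiv_sub_const, fderiv_fun_id]
    rfl
  rw [h1, md_comp_apply (smoothAt_smul_left E_G _ _) hsm,
    md_comp_apply (g := fun g : G => g • x) (smoothAt_smul_right _ x) hγs,
    md_comp_apply hγ.contMDiffAt hsub, h2, sub_self, h0, one_smul]
  rfl

variable [LieGroup 𝓘(ℝ, E_G) ∞ G] [T2Space G] [FiniteDimensional ℝ E_G]
  [IsManifold 𝓘(ℝ, E) ∞ M]

/-- The fundamental vector fields of a free action vanish nowhere. -/
lemma fund_injective (hfree : ∀ (g : G) (x : M), g • x = x → g = 1) (x : M) :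
    Function.Injective (fund E E_G G x) := by
  rw [injective_iff_map_eq_zero]
  intro ξ hξ
  obtain ⟨γ, hγ, hadd, hγξ⟩ := exists_one_parameter_subgroup (G := G) ξ
  have h0 : γ 0 = 1 := by
    have := hadd 0 0
    rw [add_zero] at this
    exact (left_eq_mul.1 this)
  -- If `ξ̃_x = 0`, the orbit of `x` under the subgroup generated by `ξ` has zero velocity at all
  -- times. It is constant, freeness makes `γ` trivial, and so `ξ = 0`.
  have hlc : IsLocallyConstant (fun u => γ u • x) := by
    refine isLocallyConstant_of_md_eq_zero (E := ℝ) (E' := E)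
      (fun u => ContMDiffAt.comp (g := fun g : G => g • x) u (smoothAt_smul_right _ x)
        hγ.contMDiffAt) fun t => ?_
    refine ContinuousLinearMap.ext_ring ?_
    rw [md_one_parameter_smul hγ hadd, hγξ, hξ, map_zero]
    rfl
  have hone : ∀ t, γ t = 1 := fun t => by
    refine hfree _ x ?_
    have h1 : γ t • x = γ 0 • x := hlc.apply_eq_of_preconnectedSpace t 0
    rw [h1, h0, one_smul]
  have : γ = fun _ => 1 := funext hone
  rw [← hγξ, this, md_const]
  rfl

end Action

/-! ### Equivariance of the momentum map and the isotropy algebra. -/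

section MomentumMap

variable {E : Type*} [NormedAddCommGroup E] [NormedSpace ℝ E]
  {M : Type*} [TopologicalSpace M] [ChartedSpace E M] [IsManifold 𝓘(ℝ, E) ∞ M]
  {E_G : Type*} [NormedAddCommGroup E_G] [NormedSpace ℝ E_G] [FiniteDimensional ℝ E_G]
  {G : Type*} [TopologicalSpace G] [ChartedSpace E_G G] [Group G] [LieGroup 𝓘(ℝ, E_G) ∞ G]
  [MulAction G M] [ContMDiffSMul 𝓘(ℝ, E_G) 𝓘(ℝ, E) ∞ G M]
  {Ω : TwoForm E M} {J : M → Module.Dual ℝ (GroupLieAlgebra 𝓘(ℝ, E_G) G)}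

/-- The values of a momentum map as linear functionals on the model space. -/
def modelMomentum (J : M → Module.Dual ℝ (GroupLieAlgebra 𝓘(ℝ, E_G) G)) (x : M) :
    E_G →ₗ[ℝ] ℝ := J x

lemma IsPoissonianMomentumMap.smoothAt (hJ : IsPoissonianMomentumMap Ω J) (η : E_G) (x : M) :
    SmoothAt E ℝ (fun y => modelMomentum J y η) x := hJ.smooth η x

lemma IsPoissonianMomentumMap.md_eq (hJ : IsPoissonianMomentumMap Ω J) (η : E_G) (x : M)
    (v : E) : md E ℝ (fun y => modelMomentum J y η) x v =
      bilin (Ω.model x) (fund E E_G G x η) v :=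
  (hJ.hamiltonian η x v).symm

lemma IsPoissonianMomentumMap.bracket (hJ : IsPoissonianMomentumMap Ω J) (ξ η : E_G) (x : M) :
    modelMomentum J x (modelBracket E_G G ξ η) =
      bilin (Ω.model x) (fund E E_G G x ξ) (fund E E_G G x η) :=
  hJ.lie_hom ξ η x

variable (E_G) in
/-- The adjoint action on the model space. -/
def modelAd (g : G) : E_G →L[ℝ] E_G := md E_G E_G (fun h : G => g * h * g⁻¹) 1

lemma modelAd_one (ζ : E_G) : modelAd E_G (1 : G) ζ = ζ := Ad_one (E_G := E_G) (G := G) ζ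

lemma modelAd_mul (g h : G) (ζ : E_G) :
    modelAd E_G (g * h) ζ = modelAd E_G g (modelAd E_G h ζ) :=
  Ad_mul (E_G := E_G) g h ζ

/-- Infinitesimal equivariance at the neutral element. By the product rule the derivative along `ξ`
is `Ω(ζ̃, ξ̃) + J([ξ, ζ])`; the bracket condition turns the second term into `Ω(ξ̃, ζ̃)` and
antisymmetry cancels the two. -/
lemma IsPoissonianMomentumMap.smoothAt_and_md_equivariant (hJ : IsPoissonianMomentumMap Ω J)
    (y : M) (ζ : E_G) :
    SmoothAt E_G ℝ (fun h : G => modelMomentum J (h • y) (modelAd E_G h ζ)) 1 ∧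
      md E_G ℝ (fun h : G => modelMomentum J (h • y) (modelAd E_G h ζ)) 1 = 0 := by
  -- Expanding in a basis replaces the pairing of `J` with `Ad` by a finite sum of products of real
  -- functions; smoothness of `J` is known only componentwise.
  let b := Module.finBasis ℝ E_G
  let c := fun i => LinearMap.toContinuousLinearMap (b.coord i)
  have hexp : ∀ (l : E_G →ₗ[ℝ] ℝ) (η : E_G), l η = ∑ i, c i η * l (b i) := by
    intro l η
    conv_lhs => rw [← b.sum_repr η, map_sum]
    refine Finset.sum_congr rfl fun i _ => ?_
    rw [map_smul, smul_eq_mul]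
    rfl
  obtain ⟨hA, hA'⟩ := smoothAt_Ad_and_md_Ad (G := G) ζ
  have hcA : ∀ i, SmoothAt E_G ℝ (fun h : G => c i (modelAd E_G h ζ)) 1 := fun i =>
    ContMDiffAt.comp (1 : G) (c i).contMDiff.contMDiffAt hA
  have hf : ∀ i, SmoothAt E_G ℝ (fun h : G => modelMomentum J (h • y) (b i)) 1 := fun i =>
    ContMDiffAt.comp (g := fun z : M => modelMomentum J z (b i)) (1 : G) (hJ.smoothAt (b i) _)
      (smoothAt_smul_right 1 y)
  have heq : (fun h : G => modelMomentum J (h • y) (modelAd E_G h ζ)) =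
      fun h => ∑ i, c i (modelAd E_G h ζ) * modelMomentum J (h • y) (b i) := by
    funext h
    exact hexp _ _
  have hsm : SmoothAt E_G ℝ (fun h : G => modelMomentum J (h • y) (modelAd E_G h ζ)) 1 := by
    rw [heq]
    exact contMDiffAt_finsetSum fun i _ => (hcA i).mul (hf i)
  refine ⟨hsm, ?_⟩
  have hφ1 : (extChartAt 𝓘(ℝ, E_G) (1 : G)).symm (extChartAt 𝓘(ℝ, E_G) (1 : G) 1) = 1 :=
    (extChartAt 𝓘(ℝ, E_G) (1 : G)).left_inv one_mem_source
  have h1 := hasFDerivAt_comp_extChartAt_symm hsm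
  have h2 : HasFDerivAt (fun z => ∑ i, c i (modelAd E_G ((extChartAt 𝓘(ℝ, E_G) (1 : G)).symm z) ζ) *
      modelMomentum J ((extChartAt 𝓘(ℝ, E_G) (1 : G)).symm z • y) (b i)) _
      (extChartAt 𝓘(ℝ, E_G) (1 : G) 1) :=
    HasFDerivAt.fun_sum fun i _ => (hasFDerivAt_comp_extChartAt_symm (hcA i)).mul
      (hasFDerivAt_comp_extChartAt_symm (hf i))
  have h3 := h2.congr_of_eventuallyEq (f₁ := fun z =>
    modelMomentum J ((extChartAt 𝓘(ℝ, E_G) (1 : G)).symm z • y) (modelAd E_G ((extChartAt 𝓘(ℝ, E_G) (1 : G)).symm z) ζ))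
    (Eventually.of_forall fun z => hexp _ _)
  rw [h1.unique h3]
  ext ξ
  have e1 : ∀ i, md E_G ℝ (fun h : G => c i (modelAd E_G h ζ)) 1 ξ =
      c i (modelBracket E_G G ξ ζ) := by
    intro i
    rw [md_comp_apply (g := c i) (f := fun h : G => modelAd E_G h ζ) (c i).contMDiff.contMDiffAt hA, md_eq_fderiv,
      ContinuousLinearMap.fderiv]
    congr 1
    exact hA' ξ
  have e2 : ∀ i, md E_G ℝ (fun h : G => modelMomentum J (h • y) (b i)) 1 ξ =
      bilin (Ω.model y) (fund E E_G G y (b i)) (fund E E_G G y ξ) := by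
    intro i
    rw [md_comp_apply (g := fun z : M => modelMomentum J z (b i)) (hJ.smoothAt (b i) _)
      (smoothAt_smul_right 1 y), one_smul, hJ.md_eq]
    rfl
  have e3 : modelAd E_G (1 : G) ζ = ζ := modelAd_one ζ
  have e4 : bilin (Ω.model y) (fund E E_G G y ζ) (fund E E_G G y ξ) =
      ∑ i, c i ζ * bilin (Ω.model y) (fund E E_G G y (b i)) (fund E E_G G y ξ) := hexp (((bilin (Ω.model y)).flip (fund E E_G G y ξ)).comp
    (fund E E_G G y).toLinearMap) ζ
  have e5 := hexp (modelMomentum J y) (modelBracket E_G G ξ ζ)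
  have e6 := hJ.bracket ξ ζ y
  have e7 := bilin_neg (Ω.model y) (fund E E_G G y ξ) (fund E E_G G y ζ)
  simp only [sum_apply, add_apply, smul_apply, hφ1, e1, e2, e3, one_smul,
    smul_eq_mul, Finset.sum_add_distrib, zero_apply]
  rw [← e4]
  simp only [mul_comm _ (c _ _)]
  rw [← e5, e6, ← e7]
  ring

/-- A momentum map of a Poissonian action of a connected group is equivariant. -/
theorem IsPoissonianMomentumMap.equivariant [ConnectedSpace G]
    (hJ : IsPoissonianMomentumMap Ω J) (g : G) (x : M) (ζ : E_G) :
    modelMomentum J (g • x) (modelAd E_G g ζ) = modelMomentum J x ζ := by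
  set Φ : G → ℝ := fun h => modelMomentum J (h • x) (modelAd E_G h ζ) with hΦ
  -- Right translation by `g⁻¹` reduces the derivative at `g` to the one at `1`, with base point `g
  -- • x` and vector `Ad_g ζ`.
  have hΦg : ∀ g : G, Φ = fun k => (fun h : G =>
      modelMomentum J (h • (g • x)) (modelAd E_G h (modelAd E_G g ζ))) (k * g⁻¹) := by
    intro g
    funext k
    simp only [hΦ]
    rw [smul_smul, ← modelAd_mul, inv_mul_cancel_right]
  have hloc : ∀ g : G, SmoothAt E_G ℝ Φ g ∧ md E_G ℝ Φ g = 0 := by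
    intro g
    obtain ⟨h1, h2⟩ := hJ.smoothAt_and_md_equivariant (g • x) (modelAd E_G g ζ)
    rw [← mul_inv_cancel g] at h1 h2
    rw [hΦg g]
    refine ⟨ContMDiffAt.comp (f := fun k : G => k * g⁻¹) g h1 (smoothAt_right_mul g⁻¹ g), ?_⟩
    ext v
    rw [md_comp_apply (f := fun k : G => k * g⁻¹) (g := fun h : G =>
      modelMomentum J (h • (g • x)) (modelAd E_G h (modelAd E_G g ζ))) h1
      (smoothAt_right_mul g⁻¹ g), h2]
    rfl
  have hlc : IsLocallyConstant Φ :=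
    isLocallyConstant_of_md_eq_zero (E := E_G) (E' := ℝ) (fun g => (hloc g).1)
      fun g => (hloc g).2
  have h := hlc.apply_eq_of_preconnectedSpace g 1
  simp only [hΦ, one_smul, modelAd_one] at h
  exact h

lemma IsPoissonianMomentumMap.smul_eq [ConnectedSpace G]
    (hJ : IsPoissonianMomentumMap Ω J) (g : G) (x : M) (ζ : E_G) :
    modelMomentum J (g • x) ζ = modelMomentum J x (modelAd E_G g⁻¹ ζ) := by
  rw [← hJ.equivariant g x, ← modelAd_mul, mul_inv_cancel, modelAd_one]

/-- The isotropy group of `μ` consists of the elements that preserve the level set of `μ`. -/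
lemma IsPoissonianMomentumMap.mem_isotropy_iff [ConnectedSpace G]
    (hJ : IsPoissonianMomentumMap Ω J)
    {μ : Module.Dual ℝ (GroupLieAlgebra 𝓘(ℝ, E_G) G)} {x : M} (hx : J x = μ) (g : G) :
    g ∈ isotropy μ ↔ J (g • x) = μ := by
  subst hx
  constructor
  · intro h
    ext ζ
    exact (hJ.smul_eq g x ζ).trans (h ζ)
  · intro h ζ
    have h1 := hJ.smul_eq g x ζ
    exact h1.symm.trans (congrArg (fun l => l ζ) h)

/-- The Lie algebra of the isotropy group, in terms of the differential of the momentum map. -/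
lemma IsPoissonianMomentumMap.mem_subgroupLieAlgebra_iff [ConnectedSpace G] [T2Space G]
    (hJ : IsPoissonianMomentumMap Ω J)
    {μ : Module.Dual ℝ (GroupLieAlgebra 𝓘(ℝ, E_G) G)} {x : M} (hx : J x = μ) (ξ : E_G) :
    ξ ∈ (subgroupLieAlgebra (isotropy μ) : Set E_G) ↔
      ∀ η, md E ℝ (fun y => modelMomentum J y η) x (fund E E_G G x ξ) = 0 := by
  have hsm : ∀ (γ : ℝ → G), ContMDiff 𝓘(ℝ, ℝ) 𝓘(ℝ, E_G) ∞ γ → ∀ t,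
      SmoothAt ℝ E (fun u => γ u • x) t := fun γ hγ t =>
    ContMDiffAt.comp (g := fun g : G => g • x) t (smoothAt_smul_right _ x) hγ.contMDiffAt
  -- Equivariance rewrites the derivative of `J` along the orbit at every time `t` as a derivative
  -- at the fixed point `x`. The condition at `x` alone then keeps the whole orbit in the level set.
  have hder : ∀ (γ : ℝ → G), ContMDiff 𝓘(ℝ, ℝ) 𝓘(ℝ, E_G) ∞ γ →
      (∀ s t, γ (s + t) = γ s * γ t) → md ℝ E_G γ 0 1 = ξ → ∀ η t,
      md ℝ ℝ (fun u => modelMomentum J (γ u • x) η) t 1 =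
        md E ℝ (fun y => modelMomentum J y (modelAd E_G (γ t)⁻¹ η)) x (fund E E_G G x ξ) := by
    intro γ hγ hadd hγξ η t
    rw [md_comp_apply (g := fun y => modelMomentum J y η) (hJ.smoothAt η _) (hsm γ hγ t),
      md_one_parameter_smul hγ hadd, hγξ,
      ← md_comp_apply (hJ.smoothAt η _) (smoothAt_smul_left E_G _ _)]
    congr 2
    funext y
    exact hJ.smul_eq _ _ _
  constructor
  · rintro ⟨γ, hγ, hadd, hmem, hγξ⟩ η
    have h0 : γ 0 = 1 := by
      have := hadd 0 0
      rw [add_zero] at this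
      exact (left_eq_mul.1 this)
    have h1 := hder γ hγ hadd hγξ η 0
    rw [h0, inv_one, modelAd_one] at h1
    rw [← h1]
    have h2 : (fun u => modelMomentum J (γ u • x) η) = fun _ => modelMomentum J x η := by
      funext u
      have h3 : J (γ u • x) = J x := ((hJ.mem_isotropy_iff hx _).1 (hmem u)).trans hx.symm
      exact congrArg (fun l => l η) h3
    rw [h2, md_const]
    rfl
  · intro h
    obtain ⟨γ, hγ, hadd, hγξ⟩ := exists_one_parameter_subgroup (G := G) ξ
    have h0 : γ 0 = 1 := by
      have := hadd 0 0
      rw [add_zero] at this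
      exact (left_eq_mul.1 this)
    refine ⟨γ, hγ, hadd, fun t => (hJ.mem_isotropy_iff hx _).2 ?_, hγξ⟩
    rw [← hx]
    refine LinearMap.ext fun (η : E_G) => ?_
    have hlc : IsLocallyConstant (fun u => modelMomentum J (γ u • x) η) := by
      refine isLocallyConstant_of_md_eq_zero (E := ℝ) (E' := ℝ)
        (fun t => ContMDiffAt.comp (g := fun y => modelMomentum J y η) t (hJ.smoothAt η _)
          (hsm γ hγ t)) fun t => ?_
      refine ContinuousLinearMap.ext_ring ?_
      rw [hder γ hγ hadd hγξ, h]
      rfl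
    have h4 : modelMomentum J (γ t • x) η = modelMomentum J (γ 0 • x) η :=
      hlc.apply_eq_of_preconnectedSpace t 0
    rw [h0, one_smul] at h4
    exact h4

end MomentumMap


/-! ### Slices for free proper actions. -/

section ActionSlice

/-- A proper free action moves small sets off themselves, except by elements close to `1`. -/
lemma exists_isOpen_forall_smul_mem {G M : Type*} [TopologicalSpace G] [Group G]
    [TopologicalSpace M] [MulAction G M] [ProperSMul G M]
    (hfree : ∀ (g : G) (x : M), g • x = x → g = 1) (x : M) {O : Set G} (hO : IsOpen O)
    (h1 : (1 : G) ∈ O) :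
    ∃ V : Set M, IsOpen V ∧ x ∈ V ∧ ∀ y ∈ V, ∀ g : G, g • y ∈ V → g ∈ O := by
  -- Properness makes the image of the elements far from `1` closed, and freeness keeps `(x, x)` out
  -- of it, so a product neighbourhood of `(x, x)` misses it.
  have hC : IsClosed ((fun p : G × M => (p.1 • p.2, p.2)) '' (Oᶜ ×ˢ univ)) :=
    ProperSMul.isProperMap_smul_pair.isClosedMap _ (hO.isClosed_compl.prod isClosed_univ)
  have hx : (x, x) ∈ ((fun p : G × M => (p.1 • p.2, p.2)) '' (Oᶜ ×ˢ univ))ᶜ := by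
    rintro ⟨⟨g, y⟩, ⟨hg, -⟩, hgy⟩
    obtain ⟨h2, h3⟩ := Prod.mk.inj hgy
    simp only at h2 h3
    subst h3
    exact hg (by rw [hfree g y h2]; exact h1)
  obtain ⟨V₁, V₂, hV₁, hV₂, hx₁, hx₂, hV⟩ := isOpen_prod_iff.1 hC.isOpen_compl x x hx
  refine ⟨V₁ ∩ V₂, hV₁.inter hV₂, ⟨hx₁, hx₂⟩, fun y hy g hgy => ?_⟩
  by_contra hg
  exact hV (show (g • y, y) ∈ V₁ ×ˢ V₂ from ⟨hgy.1, hy.2⟩) ⟨(g, y), ⟨hg, trivial⟩, rfl⟩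

variable {E : Type*} [NormedAddCommGroup E] [NormedSpace ℝ E] [FiniteDimensional ℝ E]
  {M : Type*} [TopologicalSpace M] [ChartedSpace E M] [IsManifold 𝓘(ℝ, E) ∞ M]
  {E_G : Type*} [NormedAddCommGroup E_G] [NormedSpace ℝ E_G] [FiniteDimensional ℝ E_G]
  {G : Type*} [TopologicalSpace G] [ChartedSpace E_G G] [Group G] [LieGroup 𝓘(ℝ, E_G) ∞ G]
  [T2Space G] [MulAction G M] [ContMDiffSMul 𝓘(ℝ, E_G) 𝓘(ℝ, E) ∞ G M] [ProperSMul G M]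

/-- Around each point, the orbits of a free proper action are the fibres of a submersion. -/
theorem exists_submersion_of_free_proper (hfree : ∀ (g : G) (x : M), g • x = x → g = 1) (x : M) :
    ∃ (S : Submodule ℝ E) (V : Set M) (p : M → S), IsOpen V ∧ x ∈ V ∧
      (∀ y ∈ V, SmoothAt E S p y) ∧
      (∀ y ∈ V, ∀ y' ∈ V, p y = p y' ↔ ∃ g : G, g • y = y') ∧
      ∀ y ∈ V, ∀ v, md E S p y v = 0 ↔ ∃ ξ, fund E E_G G y ξ = v := by
  obtain ⟨S, hS⟩ := Submodule.exists_isCompl (LinearMap.range (fund E E_G G x).toLinearMap)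
  set φ := extChartAt 𝓘(ℝ, E) x with hφ
  set χ := extChartAt 𝓘(ℝ, E_G) (1 : G) with hχ
  have hφx : φ.symm (φ x) = x := φ.left_inv (mem_extChartAt_source x)
  have hχ1 : χ.symm (chartOne E_G G) = 1 := symm_chartOne
  -- Translates by group elements near `1` of a transversal to the orbit. The derivative at the base
  -- point is `(ξ, s) ↦ ξ̃_x + s`, bijective because `S` is a complement of the orbit directions.
  let θ : E_G × S → M := fun z => χ.symm z.1 • φ.symm (φ x + z.2)
  let f : E_G × S → E := fun z => φ (θ z)
  let U₀ : Set (E_G × S) := χ.target ×ˢ ((fun s : S => φ x + (s : E)) ⁻¹' φ.target)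
  have hU₀ : IsOpen U₀ := (isOpen_extChartAt_target _).prod
    ((isOpen_extChartAt_target x).preimage (by fun_prop))
  have hadd : ∀ s : S, SmoothAt S E (fun s : S => φ x + (s : E)) s := fun s =>
    contMDiffAt_iff_contDiffAt.2 (contDiffAt_const.add S.subtypeL.contDiff.contDiffAt)
  have hθ : ∀ z ∈ U₀, SmoothAt (E_G × S) E θ z := by
    intro z hz
    have h1 : SmoothAt (E_G × S) E_G (fun z : E_G × S => χ.symm z.1) z :=
      ContMDiffAt.comp z (smoothAt_extChartAt_symm hz.1) contDiff_fst.contMDiff.contMDiffAt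
    have h2 : SmoothAt (E_G × S) E (fun z : E_G × S => φ.symm (φ x + z.2)) z :=
      ContMDiffAt.comp (g := φ.symm) z (smoothAt_extChartAt_symm hz.2)
        (ContMDiffAt.comp (g := fun s : S => φ x + (s : E)) z (hadd z.2)
          contDiff_snd.contMDiff.contMDiffAt)
    exact h1.smul h2
  let U : Set (E_G × S) := U₀ ∩ θ ⁻¹' φ.source
  have hU : IsOpen U := by
    have hc : ContinuousOn θ U₀ := fun z hz => (hθ z hz).continuousAt.continuousWithinAt
    exact hc.isOpen_inter_preimage hU₀ (isOpen_extChartAt_source x)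
  have hfU : ContDiffOn ℝ ∞ f U := fun z hz =>
    (contMDiffAt_iff_contDiffAt.1
      (ContMDiffAt.comp z (smoothAt_extChartAt hz.2) (hθ z hz.1))).contDiffWithinAt
  have hθ1 : ∀ s : S, θ (chartOne E_G G, s) = φ.symm (φ x + s) := fun s => by
    simp only [θ, hχ1, one_smul]
  have hθa : θ (chartOne E_G G, 0) = x := by
    rw [hθ1, ZeroMemClass.coe_zero, add_zero, hφx]
  have hxt : φ x ∈ φ.target := mem_extChartAt_target x
  have ha : (chartOne E_G G, (0 : S)) ∈ U := by
    refine ⟨⟨chartOne_mem_target, ?_⟩, ?_⟩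
    · rw [mem_preimage, ZeroMemClass.coe_zero, add_zero]
      exact hxt
    · rw [mem_preimage, hθa]
      exact mem_extChartAt_source x
  have hd : ∀ (ξ : E_G) (s : S), fderiv ℝ f (chartOne E_G G, 0) (ξ, s) =
      fund E E_G G x ξ + s := by
    intro ξ s
    have hfa : DifferentiableAt ℝ f (chartOne E_G G, 0) :=
      (hfU.contDiffAt (hU.mem_nhds ha)).differentiableAt (by simp)
    have e : ((ξ, s) : E_G × S) = (ξ, 0) + (0, s) := by simp
    rw [e, map_add]
    congr 1
    · rw [← fderiv_comp_prodMk_left hfa]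
      have h0 : (fun a => f (a, 0)) = fun a => φ (χ.symm a • x) := by
        funext a
        simp only [f, θ, ZeroMemClass.coe_zero, add_zero, hφx]
      have hφ1 : SmoothAt E E φ ((1 : G) • x) := by
        rw [one_smul]
        exact smoothAt_extChartAt (mem_extChartAt_source x)
      have h1 : SmoothAt E_G E (fun g : G => φ (g • x)) 1 :=
        ContMDiffAt.comp (g := φ) (f := fun g : G => g • x) 1 hφ1 (smoothAt_smul_right 1 x)
      have h2 := (hasFDerivAt_comp_extChartAt_symm h1).fderiv
      rw [h0]
      refine (congrArg (fun A : E_G →L[ℝ] E => A ξ) h2).trans ?_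
      refine (md_comp_apply (g := φ) (f := fun g : G => g • x) hφ1
        (smoothAt_smul_right 1 x) ξ).trans ?_
      rw [one_smul]
      exact md_extChartAt_self x _
    · rw [← fderiv_comp_prodMk_right hfa]
      have h0 : (fun b => f (chartOne E_G G, b)) =ᶠ[𝓝 0] fun b : S => φ x + (b : E) := by
        have h1 : ∀ᶠ b : S in 𝓝 0, φ x + (b : E) ∈ φ.target :=
          (hadd 0).continuousAt.preimage_mem_nhds
            ((isOpen_extChartAt_target x).mem_nhds (by
            rw [ZeroMemClass.coe_zero, add_zero]; exact hxt))
        filter_upwards [h1] with b hb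
        simp only [f, hθ1, φ.right_inv hb]
      rw [h0.fderiv_eq]
      have h2 : HasFDerivAt (fun b : S => φ x + (b : E)) S.subtypeL 0 :=
        S.subtypeL.hasFDerivAt.const_add _
      rw [h2.fderiv]
      rfl
  have hinj := fund_injective (E := E) (E_G := E_G) hfree
  have hbij : Function.Bijective (fderiv ℝ f (chartOne E_G G, 0)) := by
    constructor
    · rw [injective_iff_map_eq_zero]
      rintro ⟨ξ, s⟩ h
      rw [hd] at h
      have h1 : fund E E_G G x ξ = -(s : E) := eq_neg_of_add_eq_zero_left h
      have h2 : fund E E_G G x ξ = 0 := Submodule.disjoint_def.1 hS.disjoint _ ⟨ξ, rfl⟩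
        (h1 ▸ S.neg_mem s.2)
      have h3 : ξ = 0 := hinj x (h2.trans (map_zero _).symm)
      rw [h2, zero_add] at h
      simp [h3, Subtype.ext_iff, h]
    · intro v
      obtain ⟨_, ⟨ξ, rfl⟩, s, hs, hv⟩ := Submodule.mem_sup.1
        (hS.sup_eq_top ▸ Submodule.mem_top : v ∈ _)
      exact ⟨(ξ, ⟨s, hs⟩), by rw [hd]; exact hv⟩
  obtain ⟨Φ, haΦ, hΦU, hΦf, hΦs, -⟩ :=
    exists_openPartialHomeomorph_of_bijective_fderiv hU hfU ha hbij
  obtain ⟨A, B, hA, hB, haA, h0B, hAB⟩ := isOpen_prod_iff.1 Φ.open_source _ _ haΦ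
  -- The neighbourhood of `1` is the chart image of `A`, so any element relating two points of the
  -- transversal in `V₀` has coordinates in `A`.
  obtain ⟨V₀, hV₀, hxV₀, hV₀'⟩ := exists_isOpen_forall_smul_mem hfree x
    ((continuousOn_extChartAt (I := 𝓘(ℝ, E_G)) (1 : G)).isOpen_inter_preimage
      (isOpen_extChartAt_source 1) hA) ⟨one_mem_source, haA⟩
  have hBt : ∀ s ∈ B, φ x + (s : E) ∈ φ.target := fun s hs =>
    (hΦU (hAB (mk_mem_prod haA hs))).1.2
  let B' : Set S := B ∩ (fun s : S => φ.symm (φ x + s)) ⁻¹' V₀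
  have hB' : IsOpen B' := by
    refine ContinuousOn.isOpen_inter_preimage ?_ hB hV₀
    intro s hs
    exact (ContMDiffAt.comp (g := φ.symm) s (smoothAt_extChartAt_symm (hBt s hs))
      (hadd s)).continuousAt.continuousWithinAt
  have hAB' : A ×ˢ B' ⊆ Φ.source := (prod_mono_right inter_subset_left).trans hAB
  let T : Set E := Φ.target ∩ Φ.symm ⁻¹' (A ×ˢ B')
  have hT : IsOpen T := Φ.symm.isOpen_inter_preimage (hA.prod hB')
  let V : Set M := φ.source ∩ φ ⁻¹' T
  have hV : IsOpen V := (continuousOn_extChartAt x).isOpen_inter_preimage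
    (isOpen_extChartAt_source x) hT
  let p : M → S := fun y => (Φ.symm (φ y)).2
  -- points of `V` in the coordinates given by `θ`
  have hVθ : ∀ y ∈ V, ∃ a ∈ A, p y ∈ B' ∧ θ (a, p y) = y ∧ (a, p y) ∈ U := by
    rintro y ⟨hy, hyT⟩
    have h1 := hAB' hyT.2
    refine ⟨(Φ.symm (φ y)).1, hyT.2.1, hyT.2.2, ?_, hΦU h1⟩
    refine φ.injOn (hΦU h1).2 hy ?_
    exact (hΦf _).symm.trans (Φ.right_inv hyT.1)
  have hθV : ∀ a ∈ A, ∀ s ∈ B', θ (a, s) ∈ V ∧ p (θ (a, s)) = s := by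
    intro a ha s hs
    have h1 := hAB' (mk_mem_prod ha hs)
    have h2 : φ (θ (a, s)) = Φ (a, s) := (hΦf (a, s)).symm
    refine ⟨⟨(hΦU h1).2, ?_⟩, ?_⟩
    · rw [mem_preimage, h2]
      refine ⟨Φ.map_source h1, ?_⟩
      rw [mem_preimage, Φ.left_inv h1]
      exact mk_mem_prod ha hs
    · simp only [p, h2, Φ.left_inv h1]
  have hxV : x ∈ V := by
    have h := (hθV _ haA 0 ⟨h0B, by
      rw [mem_preimage, ZeroMemClass.coe_zero, add_zero, hφx]; exact hxV₀⟩).1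
    rwa [hθa] at h
  have hp : ∀ y ∈ V, SmoothAt E S p y := by
    intro y hy
    have h1 : SmoothAt E (E_G × S) Φ.symm (φ y) := contMDiffAt_iff_contDiffAt.2
      (hΦs.contDiffAt (Φ.open_target.mem_nhds hy.2.1))
    exact ContMDiffAt.comp (g := (Prod.snd : E_G × S → S)) (f := fun y => Φ.symm (φ y)) y
      contDiff_snd.contMDiff.contMDiffAt
      (ContMDiffAt.comp (g := Φ.symm) y h1 (smoothAt_extChartAt hy.1))
  have hpiff : ∀ y ∈ V, ∀ y' ∈ V, p y = p y' ↔ ∃ g : G, g • y = y' := by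
    intro y hy y' hy'
    obtain ⟨a, haA', hpy, hay, hU1⟩ := hVθ y hy
    obtain ⟨a', haA'', hpy', hay', hU1'⟩ := hVθ y' hy'
    constructor
    · intro h
      refine ⟨χ.symm a' * (χ.symm a)⁻¹, ?_⟩
      rw [← hay, ← hay', h]
      simp only [θ]
      rw [mul_smul, inv_smul_smul]
    · rintro ⟨g, hg⟩
      -- Removing the group coordinates of `y` and `y'` leaves `h`, which relates two points of the
      -- transversal. It is therefore near `1`, so `(χ h, p y)` and `(1, p y')` (in coordinates)
      -- have the same image under `θ`, and `p` reads off equal second coordinates.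
      set h : G := (χ.symm a')⁻¹ * g * χ.symm a with hh
      have hz : h • φ.symm (φ x + p y) = φ.symm (φ x + p y') := by
        rw [hh, mul_smul, mul_smul]
        have e1 : χ.symm a • φ.symm (φ x + p y) = y := hay
        have e2 : χ.symm a' • φ.symm (φ x + p y') = y' := hay'
        rw [e1, hg, inv_smul_eq_iff, e2]
      obtain ⟨hO1, hO2⟩ := hV₀' _ hpy.2 h (by rw [hz]; exact hpy'.2)
      have e3 : θ (χ h, p y) = θ (chartOne E_G G, p y') := by
        rw [hθ1]
        simp only [θ]
        rw [χ.left_inv hO1, hz]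
      rw [← (hθV _ hO2 _ hpy).2, e3, (hθV _ haA _ hpy').2]
  refine ⟨S, V, p, hV, hxV, hp, hpiff, fun y hy => ?_⟩
  -- the kernel of the differential
  have hle : LinearMap.range (fund E E_G G y).toLinearMap ≤
      LinearMap.ker (md E S p y).toLinearMap := by
    rintro _ ⟨ξ, rfl⟩
    have h1 : SmoothAt E S p ((1 : G) • y) := by
      rw [one_smul]
      exact hp y hy
    have h2 : (fun g : G => p (g • y)) =ᶠ[𝓝 1] fun _ => p y := by
      have h3 : ∀ᶠ g : G in 𝓝 1, g • y ∈ V :=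
        (smoothAt_smul_right (E := E) (E_G := E_G) (1 : G) y).continuousAt.preimage_mem_nhds
          (hV.mem_nhds (by rwa [one_smul]))
      filter_upwards [h3] with g hg
      exact ((hpiff y hy _ hg).2 ⟨g, rfl⟩).symm
    have h4 := md_comp_apply (g := p) (f := fun g : G => g • y) h1
      (smoothAt_smul_right (E_G := E_G) 1 y) ξ
    rw [md_congr h2, md_const, one_smul] at h4
    exact h4.symm
  have hsurj : Function.Surjective (md E S p y) := by
    obtain ⟨a, haA', hpy, hay, hU1⟩ := hVθ y hy
    have h1 : SmoothAt S E (fun s : S => θ (a, s)) (p y) :=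
      ContMDiffAt.comp (g := θ) (p y) (hθ _ hU1.1)
        (contMDiffAt_const.prodMk_space contMDiffAt_id)
    have h2 : SmoothAt E S p (θ (a, p y)) := by
      rw [hay]
      exact hp y hy
    have h3 : ∀ᶠ s in 𝓝 (p y), p (θ (a, s)) = s := by
      filter_upwards [hB'.mem_nhds hpy] with s hs
      exact (hθV a haA' s hs).2
    intro v
    have h4 := md_left_inverse h1 h2 h3 v
    rw [hay] at h4
    exact ⟨_, h4⟩
  -- By freeness the orbit directions have dimension `dim G` at `y` as at `x`, and `S` has
  -- codimension `dim G`. The inclusion is thus an equality.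
  have hdim : LinearMap.range (fund E E_G G y).toLinearMap =
      LinearMap.ker (md E S p y).toLinearMap := by
    refine Submodule.eq_of_le_of_finrank_eq hle ?_
    have h1 := (md E S p y).toLinearMap.finrank_range_add_finrank_ker
    rw [LinearMap.range_eq_top.2 hsurj, finrank_top] at h1
    have h2 := Submodule.finrank_add_eq_of_isCompl hS
    rw [LinearMap.finrank_range_of_inj (hinj x)] at h2
    rw [LinearMap.finrank_range_of_inj (hinj y)]
    omega
  intro v
  exact (SetLike.ext_iff.1 hdim v).symm

end ActionSlice


/-! ### Geometry of the level set: tangent spaces, isotropy action and slices. -/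

section LevelSetGeometry

lemma finrank_map_of_injective {V V' : Type*} [AddCommGroup V] [Module ℝ V] [AddCommGroup V']
    [Module ℝ V'] {f : V →ₗ[ℝ] V'} (hf : Function.Injective f) (p : Submodule ℝ V) :
    Module.finrank ℝ (p.map f) = Module.finrank ℝ p :=
  (Submodule.equivMapOfInjective f hf p).finrank_eq.symm

variable {E : Type*} [NormedAddCommGroup E] [NormedSpace ℝ E]
  {M : Type*} [TopologicalSpace M] [ChartedSpace E M] [IsManifold 𝓘(ℝ, E) ∞ M]
  {E_G : Type*} [NormedAddCommGroup E_G] [NormedSpace ℝ E_G] [FiniteDimensional ℝ E_G]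
  {G : Type*} [TopologicalSpace G] [ChartedSpace E_G G] [Group G] [LieGroup 𝓘(ℝ, E_G) ∞ G]
  [T2Space G] [ConnectedSpace G] [MulAction G M] [ContMDiffSMul 𝓘(ℝ, E_G) 𝓘(ℝ, E) ∞ G M]
  {Ω : TwoForm E M} {J : M → Module.Dual ℝ (GroupLieAlgebra 𝓘(ℝ, E_G) G)}
  {μ : Module.Dual ℝ (GroupLieAlgebra 𝓘(ℝ, E_G) G)}
  {F : Type*} [NormedAddCommGroup F] [NormedSpace ℝ F] [FiniteDimensional ℝ F]
  [ChartedSpace F (LevelSet J μ)]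

/-- The differential of the inclusion of the level set. -/
def mdInclusion (E F : Type*) [NormedAddCommGroup E] [NormedSpace ℝ E] [ChartedSpace E M]
    [NormedAddCommGroup F] [NormedSpace ℝ F] [ChartedSpace F (LevelSet J μ)] (x : LevelSet J μ) :
    F →L[ℝ] E := md F E (inclusion J μ) x

lemma IsWeaklyRegularValue.smoothAt_inclusion (hμ : IsWeaklyRegularValue E J μ F)
    (x : LevelSet J μ) : SmoothAt F E (inclusion J μ) x :=
  hμ.embedding.contMDiff.contMDiffAt

lemma IsWeaklyRegularValue.mdInclusion_injective (hμ : IsWeaklyRegularValue E J μ F)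
    (x : LevelSet J μ) : Function.Injective (mdInclusion E F x) := by
  have := hμ.isManifold
  exact md_injective_of_isSmoothEmbedding hμ.embedding x

lemma mem_momentumKer_iff (x : M) (v : TangentSpace 𝓘(ℝ, E) x) :
    v ∈ momentumKer J x ↔ ∀ ξ, dComponent J ξ x v = 0 := by
  simp [momentumKer]

/-- The tangent space of the level set is the orthogonal of the tangent space of the orbit. -/
lemma IsWeaklyRegularValue.mem_range_mdInclusion_iff (hμ : IsWeaklyRegularValue E J μ F)
    (hJ : IsPoissonianMomentumMap Ω J) (x : LevelSet J μ) (v : E) :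
    (∃ u, mdInclusion E F x u = v) ↔
      ∀ η, bilin (Ω.model x.1) (fund E E_G G x.1 η) v = 0 := by
  have h1 : (∃ u, mdInclusion E F x u = v) ↔
      (v : TangentSpace 𝓘(ℝ, E) x.1) ∈ momentumKer J (inclusion J μ x) := by
    rw [← hμ.tangent x]
    exact Iff.rfl
  refine h1.trans ((mem_momentumKer_iff _ _).trans ?_)
  refine forall_congr' fun (η : E_G) => ?_
  rw [← hJ.md_eq η x.1 v]
  exact Iff.rfl

/-- The vectors of the Lie algebra of the isotropy group. -/
lemma mem_subgroupLieAlgebra_isotropy_iff (hJ : IsPoissonianMomentumMap Ω J)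
    (x : LevelSet J μ) (ξ : E_G) :
    ξ ∈ (subgroupLieAlgebra (isotropy μ) : Set E_G) ↔
      ∀ η, bilin (Ω.model x.1) (fund E E_G G x.1 η) (fund E E_G G x.1 ξ) = 0 := by
  rw [hJ.mem_subgroupLieAlgebra_iff x.2]
  refine forall_congr' fun η => ?_
  rw [hJ.md_eq]

/-- The Lie algebra of the isotropy group as a subspace of the model space. -/
def isotropyAlgebra (x : LevelSet J μ) (Ω : TwoForm E M) : Submodule ℝ E_G :=
  ⨅ η, LinearMap.ker ((bilin (Ω.model x.1) (fund E E_G G x.1 η)).comp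
    (fund E E_G G x.1).toLinearMap)

lemma mem_isotropyAlgebra_iff (hJ : IsPoissonianMomentumMap Ω J)
    (x : LevelSet J μ) (ξ : E_G) :
    ξ ∈ isotropyAlgebra x Ω ↔ ξ ∈ (subgroupLieAlgebra (isotropy μ) : Set E_G) := by
  rw [mem_subgroupLieAlgebra_isotropy_iff hJ x, isotropyAlgebra, Submodule.mem_iInf]
  exact Iff.rfl

/-- The directions in the level set that are tangent to the orbit. -/
lemma IsWeaklyRegularValue.exists_fund_eq_iff (hμ : IsWeaklyRegularValue E J μ F)
    (hJ : IsPoissonianMomentumMap Ω J) (x : LevelSet J μ) (v : E) :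
    (∃ u, mdInclusion E F x u = v ∧ ∃ ξ, fund E E_G G x.1 ξ = v) ↔
      ∃ ξ ∈ isotropyAlgebra x Ω, fund E E_G G x.1 ξ = v := by
  constructor
  · rintro ⟨u, hu, ξ, hξ⟩
    refine ⟨ξ, ?_, hξ⟩
    rw [mem_isotropyAlgebra_iff hJ, mem_subgroupLieAlgebra_isotropy_iff hJ x, hξ]
    exact (hμ.mem_range_mdInclusion_iff hJ x v).1 ⟨u, hu⟩
  · rintro ⟨ξ, hξ, hv⟩
    rw [mem_isotropyAlgebra_iff hJ, mem_subgroupLieAlgebra_isotropy_iff hJ x, hv] at hξ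
    obtain ⟨u, hu⟩ := (hμ.mem_range_mdInclusion_iff hJ x v).2 hξ
    exact ⟨u, hu, ξ, hv⟩

/-- The vectors tangent to the level set and to the orbit. -/
def verticalSpace (E F : Type*) [NormedAddCommGroup E] [NormedSpace ℝ E] [ChartedSpace E M]
    [NormedAddCommGroup F] [NormedSpace ℝ F] [ChartedSpace F (LevelSet J μ)]
    (x : LevelSet J μ) : Submodule ℝ F :=
  (LinearMap.range (fund E E_G G x.1).toLinearMap).comap (mdInclusion E F x).toLinearMap

lemma mem_verticalSpace_iff (x : LevelSet J μ) (u : F) :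
    u ∈ verticalSpace E F x ↔ ∃ ξ, fund E E_G G x.1 ξ = mdInclusion E F x u := Iff.rfl

lemma IsWeaklyRegularValue.map_verticalSpace (hμ : IsWeaklyRegularValue E J μ F)
    (hJ : IsPoissonianMomentumMap Ω J) (x : LevelSet J μ) :
    (verticalSpace E F x).map (mdInclusion E F x).toLinearMap =
      (isotropyAlgebra x Ω).map (fund E E_G G x.1).toLinearMap := by
  ext v
  refine Iff.trans ?_ (hμ.exists_fund_eq_iff hJ x v)
  constructor
  · rintro ⟨u, ⟨ξ, hξ⟩, hu⟩
    exact ⟨u, hu, ξ, hξ.trans hu⟩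
  · rintro ⟨u, hu, ξ, hξ⟩
    exact ⟨u, ⟨ξ, hξ.trans hu.symm⟩, hu⟩

lemma IsWeaklyRegularValue.finrank_verticalSpace (hμ : IsWeaklyRegularValue E J μ F)
    (hJ : IsPoissonianMomentumMap Ω J) (hfree : ∀ (g : G) (x : M), g • x = x → g = 1)
    (x : LevelSet J μ) :
    Module.finrank ℝ (verticalSpace E F x) =
      Module.finrank ℝ (isotropyAlgebra x Ω : Submodule ℝ E_G) := by
  rw [← finrank_map_of_injective (hμ.mdInclusion_injective x), hμ.map_verticalSpace hJ]
  exact finrank_map_of_injective (fund_injective hfree x.1) _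

/-- Freeness identifies each vertical space with `𝔤_μ`, which is described pointwise but depends
only on `μ`. This is the constant rank needed for the quotient. -/
lemma IsWeaklyRegularValue.exists_finrank_verticalSpace_eq (hμ : IsWeaklyRegularValue E J μ F)
    (hJ : IsPoissonianMomentumMap Ω J) (hfree : ∀ (g : G) (x : M), g • x = x → g = 1) :
    ∃ k d : ℕ, k + d = Module.finrank ℝ F ∧
      ∀ x : LevelSet J μ, Module.finrank ℝ (verticalSpace E F x) = d := by
  rcases isEmpty_or_nonempty (LevelSet J μ) with h | ⟨⟨x⟩⟩
  -- For an empty level set any dimension serves; here `d = 0` and `k = dim F`.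
  · exact ⟨_, 0, rfl, fun x => h.elim x⟩
  · refine ⟨_, Module.finrank ℝ (verticalSpace E F x),
      Nat.sub_add_cancel (Submodule.finrank_le _), fun y => ?_⟩
    rw [hμ.finrank_verticalSpace hJ hfree, hμ.finrank_verticalSpace hJ hfree]
    have h : isotropyAlgebra y Ω = isotropyAlgebra x Ω := by
      ext ξ
      rw [mem_isotropyAlgebra_iff hJ, mem_isotropyAlgebra_iff hJ]
    rw [h]

/-- By equivariance, an element of `G` carrying one point of the level set to another lies in `G_μ`.
Slices for `G` can thus be used for the quotient by `G_μ`. -/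
lemma orbitSetoid_iff (hJ : IsPoissonianMomentumMap Ω J) (y y' : LevelSet J μ) :
    orbitSetoid J μ y y' ↔ ∃ g : G, g • y.1 = y'.1 := by
  constructor
  · intro h
    obtain ⟨g, hg⟩ := (orbitSetoid J μ).symm h
    exact ⟨g.1, hg⟩
  · rintro ⟨g, hg⟩
    refine (orbitSetoid J μ).symm ⟨⟨g, ?_⟩, hg⟩
    rw [hJ.mem_isotropy_iff y.2, hg]
    exact y'.2

/-- The action of an element of the isotropy group on the level set. -/
def levelSetSmul (hJ : IsPoissonianMomentumMap Ω J) (g : isotropy μ) (x : LevelSet J μ) :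
    LevelSet J μ := ⟨g.1 • x.1, (hJ.mem_isotropy_iff x.2 g.1).1 g.2⟩

/-- The action is smooth into `M`, and the embedding reflects smoothness. -/
lemma contMDiff_levelSetSmul (hμ : IsWeaklyRegularValue E J μ F)
    (hJ : IsPoissonianMomentumMap Ω J) (g : isotropy μ) :
    ContMDiff 𝓘(ℝ, F) 𝓘(ℝ, F) ∞ (levelSetSmul hJ g) := by
  have := hμ.isManifold
  intro x
  refine smoothAt_of_comp_isSmoothEmbedding hμ.embedding ?_
  exact ContMDiffAt.comp (g := fun y : M => g.1 • y) x (smoothAt_smul_left E_G g.1 x.1)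
    (hμ.smoothAt_inclusion x)

lemma proj_levelSetSmul (hJ : IsPoissonianMomentumMap Ω J) (g : isotropy μ) (x : LevelSet J μ) :
    proj J μ (levelSetSmul hJ g x) = proj J μ x :=
  Quotient.sound ((orbitSetoid J μ).symm ((orbitSetoid_iff hJ _ _).2 ⟨g.1, rfl⟩))

/-- The saturation of an open set is the union of its preimages under the continuous translations by
elements of `G_μ`. -/
lemma isOpenMap_proj (hJ : IsPoissonianMomentumMap Ω J) : IsOpenMap (proj J μ) := by
  intro O hO
  rw [← isQuotientMap_quotient_mk'.isOpen_preimage]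
  have h : Quotient.mk (orbitSetoid J μ) ⁻¹' (proj J μ '' O) =
      ⋃ g : isotropy μ, levelSetSmul hJ g ⁻¹' O := by
    ext x
    simp only [mem_preimage, mem_iUnion, mem_image]
    constructor
    · rintro ⟨y, hy, hyx⟩
      obtain ⟨g, hg⟩ := Quotient.exact hyx
      refine ⟨g, ?_⟩
      have : levelSetSmul hJ g x = y := Subtype.ext hg
      rwa [this]
    · rintro ⟨g, hg⟩
      exact ⟨_, hg, proj_levelSetSmul hJ g x⟩
  change IsOpen (Quotient.mk (orbitSetoid J μ) ⁻¹' (proj J μ '' O))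
  rw [h]
  refine isOpen_iUnion fun g => hO.preimage ?_
  exact ((contMDiff_smul_left (E := E) E_G g.1).continuous.comp continuous_subtype_val).subtype_mk _

variable [ProperSMul G M]

/-- The reduced space maps continuously and injectively into `M/G`, which is Hausdorff because the
action is proper. -/
lemma t2Space_reducedSpace (hJ : IsPoissonianMomentumMap Ω J) : T2Space (ReducedSpace J μ) := by
  let f : ReducedSpace J μ → MulAction.orbitRel.Quotient G M :=
    Quotient.lift (fun x => Quotient.mk (MulAction.orbitRel G M) x.1) fun a b h => by
      obtain ⟨g, hg⟩ := (orbitSetoid_iff hJ _ _).1 ((orbitSetoid J μ).symm h)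
      exact Quotient.sound ⟨g, hg⟩
  refine T2Space.of_injective_continuous (f := f) ?_
    (continuous_quotient_mk'.comp continuous_subtype_val |>.quotient_lift _)
  rintro ⟨a⟩ ⟨b⟩ h
  obtain ⟨g, hg⟩ := Quotient.exact h
  exact Quotient.sound ((orbitSetoid J μ).symm ((orbitSetoid_iff hJ _ _).2 ⟨g, hg⟩))

lemma secondCountableTopology_reducedSpace [SecondCountableTopology M]
    (hJ : IsPoissonianMomentumMap Ω J) : SecondCountableTopology (ReducedSpace J μ) :=
  have : SecondCountableTopology (LevelSet J μ) :=
    TopologicalSpace.Subtype.secondCountableTopology {x | J x = μ}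
  TopologicalSpace.Quotient.secondCountableTopology (isOpenMap_proj hJ)

variable [FiniteDimensional ℝ E]

/-- The orbit submersion `p` of `M`, restricted to the level set, need not be a submersion. Its
differential has the vertical space as kernel, so it has constant rank, and the constant rank
theorem in a chart gives the submersion and its section. -/
lemma exists_slice (hμ : IsWeaklyRegularValue E J μ F)
    (hJ : IsPoissonianMomentumMap Ω J) (hfree : ∀ (g : G) (x : M), g • x = x → g = 1)
    {k d : ℕ} (hk : k + d = Module.finrank ℝ F)
    (hd : ∀ x : LevelSet J μ, Module.finrank ℝ (verticalSpace E F x) = d) (x : LevelSet J μ) :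
    ∃ S : Slice (F := F) (orbitSetoid J μ) k, x ∈ S.V := by
  have := hμ.isManifold
  obtain ⟨S, V, p, hV, hxV, hp, hpiff, hker⟩ :=
    exists_submersion_of_free_proper (E := E) (E_G := E_G) hfree x.1
  set φ := extChartAt 𝓘(ℝ, F) x with hφ
  let U : Set F := φ.target ∩ φ.symm ⁻¹' (inclusion J μ ⁻¹' V)
  have hU : IsOpen U := (continuousOn_extChartAt_symm x).isOpen_inter_preimage
    (isOpen_extChartAt_target x) (hV.preimage continuous_subtype_val)
  let f : F → S := fun z => p (inclusion J μ (φ.symm z))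
  have hsm : ∀ z ∈ U, SmoothAt F E (fun z => inclusion J μ (φ.symm z)) z := fun z hz =>
    ContMDiffAt.comp (g := inclusion J μ) z (hμ.smoothAt_inclusion _)
      (smoothAt_extChartAt_symm hz.1)
  have hf : ContDiffOn ℝ ∞ f U := fun z hz => (contMDiffAt_iff_contDiffAt.1
    (ContMDiffAt.comp (g := p) z (hp _ hz.2) (hsm z hz))).contDiffWithinAt
  have hx : φ x ∈ U := ⟨mem_extChartAt_target x, by
    rw [mem_preimage, φ.left_inv (mem_extChartAt_source x)]; exact hxV⟩
  have hdU : ∀ z ∈ U, Module.finrank ℝ (fderiv ℝ f z).ker = d := by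
    intro z hz
    rw [← hd (φ.symm z)]
    have hinj : Function.Injective (md F F φ.symm z) :=
      Function.LeftInverse.injective (g := md F F φ (φ.symm z)) (md_extChartAt_symm_right hz.1)
    have hsurj : Function.Surjective (md F F φ.symm z) :=
      LinearMap.surjective_of_injective (f := (md F F φ.symm z).toLinearMap) hinj
    have h1 : (fderiv ℝ f z).ker.map (md F F φ.symm z).toLinearMap =
        verticalSpace E F (φ.symm z) := by
      have h2 : ∀ v, fderiv ℝ f z v = 0 ↔ md F F φ.symm z v ∈ verticalSpace E F (φ.symm z) := by
        intro v
        rw [mem_verticalSpace_iff]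
        refine Iff.trans ?_ (hker _ hz.2 _)
        rw [← md_eq_fderiv, md_comp_apply (g := p) (f := fun z => inclusion J μ (φ.symm z)) (hp _ hz.2)
          (hsm z hz),
          md_comp_apply (g := inclusion J μ) (hμ.smoothAt_inclusion _)
          (smoothAt_extChartAt_symm hz.1)]
        rfl
      ext u
      constructor
      · rintro ⟨v, hv, rfl⟩
        exact (h2 v).1 hv
      · intro hu
        obtain ⟨v, rfl⟩ := hsurj u
        exact ⟨v, (h2 v).2 hu, rfl⟩
    rw [← h1]
    exact (finrank_map_of_injective hinj _).symm
  obtain ⟨V', W, q, s, hV', hxV', hV'U, hW, hq, hs, hqm, hsm', hqs, hqiff⟩ :=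
    exists_local_section_of_finrank_ker_eq hU hf hx hk hdU
  have hVt : ∀ z ∈ V', z ∈ φ.target := fun z hz => (hV'U hz).1
  refine ⟨⟨φ.source ∩ φ ⁻¹' V', W, fun y => q (φ y), fun w => φ.symm (s w),
    (continuousOn_extChartAt x).isOpen_inter_preimage (isOpen_extChartAt_source x) hV', hW,
    ?_, ?_, ?_, ?_, ?_, ?_⟩, ⟨mem_extChartAt_source x, hxV'⟩⟩
  · intro y hy
    exact (ContMDiffAt.comp (g := q) y (contMDiffAt_iff_contDiffAt.2
      (hq.contDiffAt (hV'.mem_nhds hy.2))) (smoothAt_extChartAt hy.1)).contMDiffWithinAt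
  · intro w hw
    exact (ContMDiffAt.comp (g := φ.symm) w (smoothAt_extChartAt_symm (hVt _ (hsm' hw)))
      (contMDiffAt_iff_contDiffAt.2 (hs.contDiffAt (hW.mem_nhds hw)))).contMDiffWithinAt
  · intro y hy
    exact hqm hy.2
  · intro w hw
    refine ⟨φ.map_target (hVt _ (hsm' hw)), ?_⟩
    rw [mem_preimage, φ.right_inv (hVt _ (hsm' hw))]
    exact hsm' hw
  · intro w hw
    rw [φ.right_inv (hVt _ (hsm' hw)), hqs w hw]
  · intro y hy y' hy'
    rw [hqiff _ hy.2 _ hy'.2, orbitSetoid_iff hJ]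
    have h1 := (hV'U hy.2).2
    have h2 := (hV'U hy'.2).2
    change inclusion J μ (φ.symm (φ y)) ∈ V at h1
    change inclusion J μ (φ.symm (φ y')) ∈ V at h2
    change p (inclusion J μ (φ.symm (φ y))) = p (inclusion J μ (φ.symm (φ y'))) ↔ _
    rw [φ.left_inv hy.1] at h1 ⊢
    rw [φ.left_inv hy'.1] at h2 ⊢
    exact hpiff _ h1 _ h2

end LevelSetGeometry


/-! ### Linear presymplectic reduction. -/

section LinearReduction

variable {V F Q g : Type*} [AddCommGroup V] [Module ℝ V] [FiniteDimensional ℝ V]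
  [AddCommGroup F] [Module ℝ F] [FiniteDimensional ℝ F]
  [AddCommGroup Q] [Module ℝ Q] [FiniteDimensional ℝ Q]
  [AddCommGroup g] [Module ℝ g] [FiniteDimensional ℝ g]
  {B : LinearMap.BilinForm ℝ V} {A : g →ₗ[ℝ] V} {ι : F →ₗ[ℝ] V}

lemma range_eq_orthogonal (hι : ∀ v, (∃ u, ι u = v) ↔ ∀ η, B (A η) v = 0) :
    LinearMap.range ι = B.orthogonal (LinearMap.range A) := by
  ext v
  refine (hι v).trans ?_
  rw [LinearMap.BilinForm.mem_orthogonal_iff]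
  constructor
  · rintro h _ ⟨η, rfl⟩
    exact h η
  · exact fun h η => h _ ⟨η, rfl⟩

/-- The dimension of the orthogonal of a subspace. -/
lemma finrank_inf_ker_add_finrank (hB : B.IsAlt) (hA : Function.Injective A)
    (hinj : Function.Injective ι) (hι : ∀ v, (∃ u, ι u = v) ↔ ∀ η, B (A η) v = 0) :
    Module.finrank ℝ (LinearMap.range A ⊓ LinearMap.ker B : Submodule ℝ V) + Module.finrank ℝ V =
      Module.finrank ℝ g + Module.finrank ℝ F := by
  have h := LinearMap.BilinForm.finrank_add_finrank_orthogonal hB.isRefl (LinearMap.range A)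
  rw [LinearMap.BilinForm.orthogonal_top_eq_ker hB.isRefl, ← range_eq_orthogonal hι, LinearMap.finrank_range_of_inj hA,
    LinearMap.finrank_range_of_inj hinj] at h
  omega

/-- The double orthogonal of a subspace is its sum with the kernel of the form. -/
lemma exists_sub_mem_ker (hB : B.IsAlt) (hA : Function.Injective A)
    (hinj : Function.Injective ι) (hι : ∀ v, (∃ u, ι u = v) ↔ ∀ η, B (A η) v = 0)
    {v : V} (hv : ∀ u, B v (ι u) = 0) : ∃ η, v - A η ∈ LinearMap.ker B := by
  have hle : LinearMap.range A ⊔ LinearMap.ker B ≤ B.orthogonal (LinearMap.range ι) := by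
    refine sup_le ?_ ?_
    · rintro _ ⟨η, rfl⟩
      rw [LinearMap.BilinForm.mem_orthogonal_iff]
      rintro _ ⟨u, rfl⟩
      exact hB.isRefl _ _ ((hι _).1 ⟨u, rfl⟩ η)
    · rw [← LinearMap.BilinForm.orthogonal_top_eq_ker hB.isRefl]
      exact LinearMap.BilinForm.orthogonal_le le_top
  have hker : LinearMap.ker B ≤ LinearMap.range ι := by
    rw [← LinearMap.BilinForm.orthogonal_top_eq_ker hB.isRefl, range_eq_orthogonal hι]
    exact LinearMap.BilinForm.orthogonal_le le_top
  -- `dim (range ι)^⊥ = dim V + dim ker B - dim F = dim g + dim ker B - dim (range A ∩ ker B)`,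
  -- which is the dimension of `range A + ker B`.
  have h1 := LinearMap.BilinForm.finrank_add_finrank_orthogonal hB.isRefl (LinearMap.range ι)
  rw [LinearMap.BilinForm.orthogonal_top_eq_ker hB.isRefl, inf_eq_right.2 hker, LinearMap.finrank_range_of_inj hinj] at h1
  have h2 := finrank_inf_ker_add_finrank hB hA hinj hι
  have h3 := Submodule.finrank_sup_add_finrank_inf_eq (LinearMap.range A) (LinearMap.ker B)
  rw [LinearMap.finrank_range_of_inj hA] at h3
  have heq := Submodule.eq_of_le_of_finrank_eq hle (by omega)
  have hv' : v ∈ LinearMap.range A ⊔ LinearMap.ker B := by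
    rw [heq, LinearMap.BilinForm.mem_orthogonal_iff]
    rintro _ ⟨u, rfl⟩
    exact hB.isRefl _ _ (hv u)
  obtain ⟨_, ⟨η, rfl⟩, w, hw, rfl⟩ := Submodule.mem_sup.1 hv'
  exact ⟨η, by rwa [add_sub_cancel_left]⟩

variable {C : LinearMap.BilinForm ℝ Q} {π : F →ₗ[ℝ] Q}

/-- The kernel of the restriction of an alternating form to the orthogonal of a subspace. -/
lemma exists_add_of_mem_ker_restrict (hB : B.IsAlt) (hA : Function.Injective A)
    (hinj : Function.Injective ι) (hι : ∀ v, (∃ u, ι u = v) ↔ ∀ η, B (A η) v = 0)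
    (hπ : ∀ u, π u = 0 ↔ ∃ ξ, A ξ = ι u) {u : F} (hu : ∀ v, B (ι u) (ι v) = 0) :
    ∃ u₁ u₂, u = u₁ + u₂ ∧ π u₁ = 0 ∧ ι u₂ ∈ LinearMap.ker B := by
  obtain ⟨η, hη⟩ := exists_sub_mem_ker hB hA hinj hι hu
  -- The component of `ι u` in `ker B` is orthogonal to everything, hence tangent to the level set;
  -- so the component along the orbit is tangent to it too.
  obtain ⟨w, hw⟩ := (hι (ι u - A η)).2 fun ζ => by
    refine hB.isRefl _ _ ?_
    rw [LinearMap.mem_ker.1 hη]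
    rfl
  refine ⟨u - w, w, (sub_add_cancel _ _).symm, (hπ _).2 ⟨η, ?_⟩, by rwa [hw]⟩
  rw [map_sub, hw, sub_sub_cancel]

lemma ker_le_ker_restrict (hι : ∀ v, (∃ u, ι u = v) ↔ ∀ η, B (A η) v = 0)
    (hπ : ∀ u, π u = 0 ↔ ∃ ξ, A ξ = ι u) {u : F} (hu : π u = 0) (v : F) :
    B (ι u) (ι v) = 0 := by
  obtain ⟨ξ, hξ⟩ := (hπ u).1 hu
  rw [← hξ]
  exact (hι _).1 ⟨v, rfl⟩ ξ

/-- The radical of the restricted form is the sum of the vertical vectors and `ker B`; the vertical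
part never obstructs, so only `ker B` has to be tested. -/
lemma ker_restrict_iff (hB : B.IsAlt) (hA : Function.Injective A)
    (hinj : Function.Injective ι) (hι : ∀ v, (∃ u, ι u = v) ↔ ∀ η, B (A η) v = 0)
    (hπ : ∀ u, π u = 0 ↔ ∃ ξ, A ξ = ι u) :
    (∀ u, (∀ v, B (ι u) (ι v) = 0) → π u = 0) ↔ ∀ u, ι u ∈ LinearMap.ker B → π u = 0 := by
  constructor
  · intro h u hu
    refine h u fun v => ?_
    rw [LinearMap.mem_ker.1 hu]
    rfl
  · intro h u hu
    obtain ⟨u₁, u₂, rfl, h1, h2⟩ := exists_add_of_mem_ker_restrict hB hA hinj hι hπ hu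
    rw [map_add, h1, h _ h2, add_zero]

/-- Since `π` is onto, testing against all vectors of the quotient is testing against all lifts. -/
lemma mem_ker_reduced_iff (hC : ∀ u v, C (π u) (π v) = B (ι u) (ι v))
    (hsurj : Function.Surjective π) (u : F) :
    π u ∈ LinearMap.ker C ↔ ∀ v, B (ι u) (ι v) = 0 := by
  rw [LinearMap.mem_ker]
  constructor
  · intro h v
    rw [← hC, h]
    rfl
  · intro h
    ext w
    obtain ⟨v, rfl⟩ := hsurj w
    rw [hC, h]
    rfl

lemma ker_reduced_eq_bot_iff (hC : ∀ u v, C (π u) (π v) = B (ι u) (ι v))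
    (hsurj : Function.Surjective π) :
    LinearMap.ker C = ⊥ ↔ ∀ u, (∀ v, B (ι u) (ι v) = 0) → π u = 0 := by
  rw [Submodule.eq_bot_iff]
  constructor
  · intro h u hu
    exact h _ ((mem_ker_reduced_iff hC hsurj u).2 hu)
  · intro h w hw
    obtain ⟨u, rfl⟩ := hsurj w
    exact h u ((mem_ker_reduced_iff hC hsurj u).1 hw)

/-- The dimension of the kernel of the reduced form. -/
lemma finrank_ker_reduced_add (hB : B.IsAlt) (hA : Function.Injective A)
    (hinj : Function.Injective ι) (hι : ∀ v, (∃ u, ι u = v) ↔ ∀ η, B (A η) v = 0)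
    (hπ : ∀ u, π u = 0 ↔ ∃ ξ, A ξ = ι u) (hC : ∀ u v, C (π u) (π v) = B (ι u) (ι v))
    (hsurj : Function.Surjective π) :
    Module.finrank ℝ (LinearMap.ker C) +
        Module.finrank ℝ (LinearMap.range A ⊓ LinearMap.ker B : Submodule ℝ V) =
      Module.finrank ℝ (LinearMap.ker B) := by
  have hker : LinearMap.ker B ≤ LinearMap.range ι := by
    rw [← LinearMap.BilinForm.orthogonal_top_eq_ker hB.isRefl, range_eq_orthogonal hι]
    exact LinearMap.BilinForm.orthogonal_le le_top
  -- The radical of the restricted form written in two ways. Counting dimensions on both sides, `dim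
  -- ker π` cancels.
  have h1 : (LinearMap.ker π ⊔ (LinearMap.ker B).comap ι) = (LinearMap.ker C).comap π := by
    refine le_antisymm (sup_le ?_ ?_) ?_
    · intro u hu
      exact (mem_ker_reduced_iff hC hsurj u).2 (ker_le_ker_restrict hι hπ hu)
    · intro u hu
      refine (mem_ker_reduced_iff hC hsurj u).2 fun v => ?_
      rw [LinearMap.mem_ker.1 hu]
      rfl
    · intro u hu
      obtain ⟨u₁, u₂, rfl, h1, h2⟩ := exists_add_of_mem_ker_restrict hB hA hinj hι hπ
        ((mem_ker_reduced_iff hC hsurj u).1 hu)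
      exact Submodule.add_mem_sup h1 h2
  have h2 : ∀ p : Submodule ℝ V, p ≤ LinearMap.range ι →
      Module.finrank ℝ (p.comap ι) = Module.finrank ℝ p := by
    intro p hp
    rw [← finrank_map_of_injective hinj, Submodule.map_comap_eq, inf_eq_right.2 hp]
  have h3 : (LinearMap.ker π ⊓ (LinearMap.ker B).comap ι) =
      (LinearMap.range A ⊓ LinearMap.ker B).comap ι := by
    ext u
    exact and_congr_left fun _ => hπ u
  have h4 : Module.finrank ℝ ((LinearMap.ker C).comap π) =
      Module.finrank ℝ (LinearMap.ker C) + Module.finrank ℝ (LinearMap.ker π) := by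
    have h5 := (π.domRestrict ((LinearMap.ker C).comap π)).finrank_range_add_finrank_ker
    have h6 : LinearMap.range (π.domRestrict ((LinearMap.ker C).comap π)) = LinearMap.ker C := by
      rw [LinearMap.range_domRestrict, Submodule.map_comap_eq, LinearMap.range_eq_top.2 hsurj,
        top_inf_eq]
    have h7 : (LinearMap.ker (π.domRestrict ((LinearMap.ker C).comap π))).map
        (Submodule.subtype _) = LinearMap.ker π := by
      rw [LinearMap.ker_domRestrict]
      ext u
      simp only [Submodule.mem_map, LinearMap.mem_ker, Subtype.exists]
      constructor
      · rintro ⟨v, hv, h, rfl⟩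
        exact h
      · intro h
        refine ⟨u, ?_, h, rfl⟩
        rw [Submodule.mem_comap, h]
        exact zero_mem _
    rw [h6] at h5
    rw [← h5, ← h7, finrank_map_of_injective (Submodule.subtype_injective _)]
  have h8 := Submodule.finrank_sup_add_finrank_inf_eq (LinearMap.ker π)
    ((LinearMap.ker B).comap ι)
  rw [h1, h3, h4, h2 _ hker, h2 _ (inf_le_right.trans hker)] at h8
  omega

end LinearReduction


/-! ### Descent of the form to the reduced space. -/

section Descent

variable {E : Type*} [NormedAddCommGroup E] [NormedSpace ℝ E]
  {M : Type*} [TopologicalSpace M] [ChartedSpace E M] [IsManifold 𝓘(ℝ, E) ∞ M]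
  {E_G : Type*} [NormedAddCommGroup E_G] [NormedSpace ℝ E_G] [FiniteDimensional ℝ E_G]
  {G : Type*} [TopologicalSpace G] [ChartedSpace E_G G] [Group G] [LieGroup 𝓘(ℝ, E_G) ∞ G]
  [T2Space G] [ConnectedSpace G] [MulAction G M] [ContMDiffSMul 𝓘(ℝ, E_G) 𝓘(ℝ, E) ∞ G M]
  {Ω : TwoForm E M} {J : M → Module.Dual ℝ (GroupLieAlgebra 𝓘(ℝ, E_G) G)}
  {μ : Module.Dual ℝ (GroupLieAlgebra 𝓘(ℝ, E_G) G)}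
  {F : Type*} [NormedAddCommGroup F] [NormedSpace ℝ F] [FiniteDimensional ℝ F]
  [ChartedSpace F (LevelSet J μ)]
  {P : Type*} [NormedAddCommGroup P] [NormedSpace ℝ P] [FiniteDimensional ℝ P]
  [ChartedSpace P (ReducedSpace J μ)]

/-- The differential of the projection onto the reduced space. -/
def mdProj (F P : Type*) [NormedAddCommGroup F] [NormedSpace ℝ F] [ChartedSpace F (LevelSet J μ)]
    [NormedAddCommGroup P] [NormedSpace ℝ P] [ChartedSpace P (ReducedSpace J μ)]
    (x : LevelSet J μ) : F →L[ℝ] P := md F P (proj J μ) x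

variable (P) in
/-- Smooth local sections of the projection onto the reduced space. -/
def HasLocalSections (F : Type*) [NormedAddCommGroup F] [NormedSpace ℝ F]
    [ChartedSpace F (LevelSet J μ)] : Prop :=
  ∀ x : LevelSet J μ, ∃ U : Set (ReducedSpace J μ), IsOpen U ∧ proj J μ x ∈ U ∧
    ∃ f : ReducedSpace J μ → LevelSet J μ, ContMDiffOn 𝓘(ℝ, P) 𝓘(ℝ, F) ∞ f U ∧
      f (proj J μ x) = x ∧ ∀ y ∈ U, proj J μ (f y) = y

lemma md_proj_section (hσ : ContMDiff 𝓘(ℝ, F) 𝓘(ℝ, P) ∞ (proj J μ))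
    {U : Set (ReducedSpace J μ)} (hU : IsOpen U) {f : ReducedSpace J μ → LevelSet J μ}
    (hf : ContMDiffOn 𝓘(ℝ, P) 𝓘(ℝ, F) ∞ f U) (hfU : ∀ y ∈ U, proj J μ (f y) = y)
    {y : ReducedSpace J μ} (hy : y ∈ U) (v : P) :
    mdProj F P (f y) (md P F f y v) = v :=
  md_left_inverse (hf.contMDiffAt (hU.mem_nhds hy)) hσ.contMDiffAt
    (by filter_upwards [hU.mem_nhds hy] with z hz using hfU z hz) v

lemma mdProj_surjective (hσ : ContMDiff 𝓘(ℝ, F) 𝓘(ℝ, P) ∞ (proj J μ))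
    (hsec : HasLocalSections (J := J) (μ := μ) P F) (x : LevelSet J μ) :
    Function.Surjective (mdProj F P x) := by
  obtain ⟨U, hU, hxU, f, hf, hfx, hfU⟩ := hsec x
  intro v
  have h := md_proj_section hσ hU hf hfU hxU v
  rw [hfx] at h
  exact ⟨_, h⟩

/-- The kernel of the differential of the projection. -/
lemma mdProj_eq_zero_iff (hμ : IsWeaklyRegularValue E J μ F)
    (hJ : IsPoissonianMomentumMap Ω J)
    (hσ : ContMDiff 𝓘(ℝ, F) 𝓘(ℝ, P) ∞ (proj J μ))
    (hsec : HasLocalSections (J := J) (μ := μ) P F)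
    (hd : ∀ x : LevelSet J μ, Module.finrank ℝ P + Module.finrank ℝ (verticalSpace E F x) =
      Module.finrank ℝ F) (x : LevelSet J μ) (u : F) :
    mdProj F P x u = 0 ↔ ∃ ξ, fund E E_G G x.1 ξ = mdInclusion E F x u := by
  have := hμ.isManifold
  -- A vertical vector is the velocity of a curve `γ t • x` with `γ` in `G_μ`, and `σ` is constant
  -- along it. Equality then follows by dimension.
  have hle : verticalSpace E F x ≤ LinearMap.ker (mdProj F P x).toLinearMap := by
    rintro u hu
    obtain ⟨ξ', hξ'⟩ := (mem_verticalSpace_iff x u).1 hu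
    obtain ⟨ξ, hξ, hξu⟩ := (hμ.exists_fund_eq_iff hJ x (mdInclusion E F x u)).1
      ⟨u, rfl, ξ', hξ'⟩
    rw [mem_isotropyAlgebra_iff hJ] at hξ
    obtain ⟨γ, hγ, hadd, hmem, hγξ⟩ := hξ
    have h0 : γ 0 = 1 := by
      have := hadd 0 0
      rw [add_zero] at this
      exact (left_eq_mul.1 this)
    let c : ℝ → LevelSet J μ := fun t => levelSetSmul hJ ⟨γ t, hmem t⟩ x
    have hc0 : c 0 = x := Subtype.ext (by
      show γ 0 • x.1 = x.1
      rw [h0, one_smul])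
    have hc : SmoothAt ℝ F c 0 := smoothAt_of_comp_isSmoothEmbedding hμ.embedding
      (ContMDiffAt.comp (g := fun g : G => g • x.1) 0 (smoothAt_smul_right _ x.1)
        hγ.contMDiffAt)
    have h1 : md ℝ F c 0 1 = u := by
      apply hμ.mdInclusion_injective x
      have h2 := md_comp_apply (g := inclusion J μ) (f := c) (hμ.smoothAt_inclusion _) hc 1
      rw [hc0] at h2
      refine h2.symm.trans ?_
      rw [← hξu]
      refine (md_one_parameter_smul hγ hadd x.1 0).trans ?_
      have h3 : (fun y : M => γ 0 • y) = fun y => y := by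
        funext y
        rw [h0, one_smul]
      rw [h3, md_id]
      exact congrArg (fund E E_G G x.1) hγξ
    have h4 := md_comp_apply (g := proj J μ) (f := c) hσ.contMDiffAt hc 1
    have h5 : (fun t => proj J μ (c t)) = fun _ => proj J μ x := by
      funext t
      exact proj_levelSetSmul hJ _ x
    rw [h5, md_const, h1, hc0] at h4
    exact h4.symm
  have h1 := (mdProj F P x).toLinearMap.finrank_range_add_finrank_ker
  rw [LinearMap.range_eq_top.2 (mdProj_surjective hσ hsec x), finrank_top] at h1
  have h2 := hd x
  have heq := Submodule.eq_of_le_of_finrank_eq hle (by omega)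
  exact (SetLike.ext_iff.1 heq u).symm

/-- The form on the level set depends only on the images of its arguments in the reduced space. -/
lemma form_eq_of_mdProj_eq (hμ : IsWeaklyRegularValue E J μ F)
    (hJ : IsPoissonianMomentumMap Ω J) (hact : IsPresymplecticAction G Ω)
    (hσ : ContMDiff 𝓘(ℝ, F) 𝓘(ℝ, P) ∞ (proj J μ))
    (hker : ∀ (x : LevelSet J μ) (u : F),
      mdProj F P x u = 0 ↔ ∃ ξ, fund E E_G G x.1 ξ = mdInclusion E F x u)
    {x x' : LevelSet J μ} (hx : proj J μ x = proj J μ x') {u v u' v' : F}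
    (hu : mdProj F P x u = mdProj F P x' u') (hv : mdProj F P x v = mdProj F P x' v') :
    bilin (Ω.model x.1) (mdInclusion E F x u) (mdInclusion E F x v) =
      bilin (Ω.model x'.1) (mdInclusion E F x' u') (mdInclusion E F x' v') := by
  obtain ⟨g, hg⟩ := Quotient.exact hx.symm
  have hgx : levelSetSmul hJ g x = x' := Subtype.ext hg
  set T : F →L[ℝ] F := md F F (levelSetSmul hJ g) x with hT
  have hτ : SmoothAt F F (levelSetSmul hJ g) x := contMDiff_levelSetSmul hμ hJ g x
  have h1 : ∀ w, mdProj F P x' (T w) = mdProj F P x w := by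
    intro w
    have h := md_comp_apply (g := proj J μ) (f := levelSetSmul hJ g) (E'' := P)
      hσ.contMDiffAt hτ w
    rw [hgx] at h
    have h2 : (fun y => proj J μ (levelSetSmul hJ g y)) = proj J μ :=
      funext fun y => proj_levelSetSmul hJ g y
    rw [h2] at h
    exact h.symm
  have h2 : ∀ w, mdInclusion E F x' (T w) =
      md E E (fun y : M => g.1 • y) x.1 (mdInclusion E F x w) := by
    intro w
    have h := md_comp_apply (g := inclusion J μ) (f := levelSetSmul hJ g) (E'' := E)
      (hμ.smoothAt_inclusion _) hτ w
    rw [hgx] at h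
    refine h.symm.trans ?_
    exact md_comp_apply (g := fun y : M => g.1 • y) (f := inclusion J μ)
      (smoothAt_smul_left E_G g.1 x.1) (hμ.smoothAt_inclusion x) w
  have h3 : ∀ a b, bilin (Ω.model x'.1) (mdInclusion E F x' (T a)) (mdInclusion E F x' (T b)) =
      bilin (Ω.model x.1) (mdInclusion E F x a) (mdInclusion E F x b) := by
    intro a b
    rw [h2, h2]
    have h4 := congrArg (fun α : TwoForm E M =>
      α.model x.1 ![mdInclusion E F x a, mdInclusion E F x b]) (hact g.1)
    rw [bilin_apply, bilin_apply, ← h4]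
    have h5 : x'.1 = g.1 • x.1 := by rw [← hgx]; rfl
    rw [h5]
    refine congrArg (Ω.model (g.1 • x.1)) ?_
    ext i
    fin_cases i <;> rfl
  -- Vectors with the same projection differ by an orbit direction, which is `Ω`-orthogonal to the
  -- tangent space of the level set.
  have h4 : ∀ a b w, mdProj F P x' a = mdProj F P x' b →
      bilin (Ω.model x'.1) (mdInclusion E F x' a) (mdInclusion E F x' w) =
        bilin (Ω.model x'.1) (mdInclusion E F x' b) (mdInclusion E F x' w) := by
    intro a b w hab
    obtain ⟨ξ, hξ⟩ := (hker x' (a - b)).1 (by rw [map_sub, hab, sub_self])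
    have h5 := (hμ.mem_range_mdInclusion_iff hJ x' _).1 ⟨w, rfl⟩ ξ
    rw [hξ, map_sub, map_sub, LinearMap.sub_apply, sub_eq_zero] at h5
    exact h5
  rw [← h3, h4 (T u) u' _ ((h1 u).trans hu), ← bilin_neg, h4 (T v) v' _ ((h1 v).trans hv),
    bilin_neg]

/-- The form of the level set descends to the reduced space. -/
theorem exists_reduced_form [FiniteDimensional ℝ E] [IsManifold 𝓘(ℝ, P) ∞ (ReducedSpace J μ)]
    (hμ : IsWeaklyRegularValue E J μ F)
    (hJ : IsPoissonianMomentumMap Ω J) (hact : IsPresymplecticAction G Ω)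
    (hs : IsSmoothForm Ω) (hc : IsClosedForm Ω)
    (hσ : ContMDiff 𝓘(ℝ, F) 𝓘(ℝ, P) ∞ (proj J μ))
    (hsec : HasLocalSections (J := J) (μ := μ) P F)
    (hker : ∀ (x : LevelSet J μ) (u : F),
      mdProj F P x u = 0 ↔ ∃ ξ, fund E E_G G x.1 ξ = mdInclusion E F x u) :
    ∃ Ωhat : TwoForm P (ReducedSpace J μ), IsSmoothForm Ωhat ∧ IsClosedForm Ωhat ∧
      ∀ (x : LevelSet J μ) (u v : F),
        bilin (Ωhat.model (proj J μ x)) (mdProj F P x u) (mdProj F P x v) =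
          bilin (Ω.model x.1) (mdInclusion E F x u) (mdInclusion E F x v) := by
  have hr : ∀ x : LevelSet J μ, ∃ r : P →L[ℝ] F, ∀ w, mdProj F P x (r w) = w := by
    intro x
    obtain ⟨r, hr⟩ := (mdProj F P x).toLinearMap.exists_rightInverse_of_surjective
      (LinearMap.range_eq_top.2 (mdProj_surjective hσ hsec x))
    exact ⟨LinearMap.toContinuousLinearMap r, fun w => congrArg (fun l => l w) hr⟩
  choose r hr using hr
  -- Defined pointwise from an arbitrary representative and arbitrary lifts of vectors. Independence
  -- of these choices is `form_eq_of_mdProj_eq`; regularity comes afterwards, from the smooth local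
  -- sections `f`, since there the form is the pull-back of `Ω` by `j_μ ∘ f`.
  let Ωhat : TwoForm P (ReducedSpace J μ) := fun z =>
    (Ω.model z.out.1).compContinuousLinearMap ((mdInclusion E F z.out).comp (r z.out))
  have hΩhat : ∀ (x : LevelSet J μ) (u v : F),
      bilin (Ωhat.model (proj J μ x)) (mdProj F P x u) (mdProj F P x v) =
        bilin (Ω.model x.1) (mdInclusion E F x u) (mdInclusion E F x v) := by
    intro x u v
    set x' : LevelSet J μ := (proj J μ x).out with hx'
    have h1 : bilin (Ωhat.model (proj J μ x)) (mdProj F P x u) (mdProj F P x v) =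
        bilin (Ω.model x'.1) (mdInclusion E F x' (r x' (mdProj F P x u)))
          (mdInclusion E F x' (r x' (mdProj F P x v))) := by
      rw [bilin_apply, bilin_apply]
      refine congrArg (Ω.model x'.1) ?_
      ext i
      fin_cases i <;> rfl
    rw [h1]
    exact form_eq_of_mdProj_eq hμ hJ hact hσ hker (Quotient.out_eq _) (hr _ _) (hr _ _)
  obtain ⟨h1, h2⟩ := isSmoothForm_and_isClosedForm_of_local_pullback (α := Ωhat) hs hc (by
    intro z
    obtain ⟨U, hU, hzU, f, hf, -, hfU⟩ := hsec z.out
    have hz : proj J μ z.out = z := z.out_eq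
    rw [hz] at hzU
    refine ⟨U, hU, hzU, fun y => inclusion J μ (f y),
      hμ.embedding.contMDiff.comp_contMDiffOn hf, fun y hy => ?_⟩
    have h3 : ∀ a b : P, bilin (Ωhat.model y) a b =
        bilin (TwoForm.model (pullback (fun y => inclusion J μ (f y)) Ω :
          TwoForm P (ReducedSpace J μ)) y) a b := by
      intro a b
      have h4 := hΩhat (f y) (md P F f y a) (md P F f y b)
      rw [md_proj_section hσ hU hf hfU hy, md_proj_section hσ hU hf hfU hy, hfU y hy] at h4
      rw [h4, bilin_apply, bilin_apply, pullback_apply]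
      refine congrArg (Ω.model (f y).1) ?_
      have h5 : ∀ w, md P E (fun y => inclusion J μ (f y)) y w =
          mdInclusion E F (f y) (md P F f y w) := fun w =>
        md_comp_apply (g := inclusion J μ) (hμ.smoothAt_inclusion _)
          (hf.contMDiffAt (hU.mem_nhds hy)) w
      ext i
      fin_cases i
      · exact (h5 a).symm
      · exact (h5 b).symm
    refine ContinuousAlternatingMap.ext fun w => ?_
    have h6 : w = ![w 0, w 1] := by
      ext i
      fin_cases i <;> rfl
    rw [h6]
    exact h3 (w 0) (w 1))
  exact ⟨Ωhat, h1, h2, hΩhat⟩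

end Descent


/-! ### Kernels of 2-forms as kernels of bilinear forms. -/

section FormKernel

lemma vec_two_eq {X Y : Type*} (f : X → Y) (w : Fin 2 → X) :
    ![f (w 0), f (w 1)] = fun i => f (w i) := by
  ext i
  fin_cases i <;> rfl

variable {E : Type*} [NormedAddCommGroup E] [NormedSpace ℝ E]
  {M : Type*} [TopologicalSpace M] [ChartedSpace E M]

lemma mem_formKer_iff (α : TwoForm E M) (x : M) (v : E) :
    (v : TangentSpace 𝓘(ℝ, E) x) ∈ formKer α x ↔ v ∈ LinearMap.ker (bilin (α.model x)) := by
  rw [LinearMap.mem_ker, LinearMap.ext_iff]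
  exact Iff.rfl

lemma formKer_eq (α : TwoForm E M) (x : M) :
    (formKer α x : Submodule ℝ E) = LinearMap.ker (bilin (α.model x)) :=
  Submodule.ext (mem_formKer_iff α x)

lemma finrank_formKer (α : TwoForm E M) (x : M) :
    Module.finrank ℝ (formKer α x) = Module.finrank ℝ (LinearMap.ker (bilin (α.model x))) :=
  congrArg (fun p : Submodule ℝ E => Module.finrank ℝ p) (formKer_eq α x)

end FormKernel

/-! ### The kernel conditions of the theorem in terms of the model spaces. -/

section Kernels

variable {E : Type*} [NormedAddCommGroup E] [NormedSpace ℝ E]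
  {M : Type*} [TopologicalSpace M] [ChartedSpace E M] [IsManifold 𝓘(ℝ, E) ∞ M]
  {E_G : Type*} [NormedAddCommGroup E_G] [NormedSpace ℝ E_G] [FiniteDimensional ℝ E_G]
  {G : Type*} [TopologicalSpace G] [ChartedSpace E_G G] [Group G] [LieGroup 𝓘(ℝ, E_G) ∞ G]
  [T2Space G] [ConnectedSpace G] [MulAction G M] [ContMDiffSMul 𝓘(ℝ, E_G) 𝓘(ℝ, E) ∞ G M]
  {Ω : TwoForm E M} {J : M → Module.Dual ℝ (GroupLieAlgebra 𝓘(ℝ, E_G) G)}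
  {μ : Module.Dual ℝ (GroupLieAlgebra 𝓘(ℝ, E_G) G)}
  {F : Type*} [NormedAddCommGroup F] [NormedSpace ℝ F] [FiniteDimensional ℝ F]
  [ChartedSpace F (LevelSet J μ)]

/-- An orbit direction comes from `𝔤_μ` exactly when it is tangent to the level set, by equivariance
and weak regularity. -/
lemma mem_isotropyFundamentalSpace_iff (hμ : IsWeaklyRegularValue E J μ F)
    (hJ : IsPoissonianMomentumMap Ω J) (x : LevelSet J μ) (v : E) :
    v ∈ (isotropyFundamentalSpace E μ x.1 : Set E) ↔
      ∃ u, mdInclusion E F x u = v ∧ ∃ ξ, fund E E_G G x.1 ξ = mdInclusion E F x u := by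
  have h : v ∈ (isotropyFundamentalSpace E μ x.1 : Set E) ↔
      ∃ ξ ∈ isotropyAlgebra x Ω, fund E E_G G x.1 ξ = v :=
    exists_congr fun ξ => and_congr_left fun _ => (mem_isotropyAlgebra_iff hJ x ξ).symm
  rw [h, ← hμ.exists_fund_eq_iff hJ]
  refine exists_congr fun u => and_congr_right fun hu => ?_
  rw [hu]

lemma mem_image_formKer_pullback_iff (x : LevelSet J μ) (v : E) :
    v ∈ (mfderiv 𝓘(ℝ, F) 𝓘(ℝ, E) (inclusion J μ) x ''
        (formKer (pullback (inclusion J μ) Ω : TwoForm F (LevelSet J μ)) x :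
          Set (TangentSpace 𝓘(ℝ, F) x)) : Set E) ↔
      ∃ u, (∀ w, bilin (Ω.model x.1) (mdInclusion E F x u) (mdInclusion E F x w) = 0) ∧
        mdInclusion E F x u = v := by
  refine exists_congr fun (u : F) => and_congr_left fun _ => forall_congr' fun (w : F) => ?_
  have h : (pullback (inclusion J μ) Ω : TwoForm F (LevelSet J μ)).model x ![u, w] =
      bilin (Ω.model x.1) (mdInclusion E F x u) (mdInclusion E F x w) := by
    rw [bilin_apply, pullback_apply]
    refine congrArg (Ω.model x.1) ?_
    ext i
    fin_cases i <;> rfl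
  rw [← h]
  exact Iff.rfl

/-- The tangent space of the orbit of the isotropy group is the kernel of the form of the level
set if and only if it contains that kernel. -/
lemma isotropyFundamentalSpace_eq_iff (hμ : IsWeaklyRegularValue E J μ F)
    (hJ : IsPoissonianMomentumMap Ω J) (x : LevelSet J μ) :
    isotropyFundamentalSpace E μ (inclusion J μ x) =
        mfderiv 𝓘(ℝ, F) 𝓘(ℝ, E) (inclusion J μ) x ''
          (formKer (pullback (inclusion J μ) Ω : TwoForm F (LevelSet J μ)) x :
            Set (TangentSpace 𝓘(ℝ, F) x)) ↔
      ∀ u, (∀ w, bilin (Ω.model x.1) (mdInclusion E F x u) (mdInclusion E F x w) = 0) →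
        ∃ ξ, fund E E_G G x.1 ξ = mdInclusion E F x u := by
  constructor
  · intro h u hu
    have h1 := (mem_image_formKer_pullback_iff (Ω := Ω) x (mdInclusion E F x u)).2 ⟨u, hu, rfl⟩
    have h2 := (Set.ext_iff.1 h (mdInclusion E F x u)).2 h1
    obtain ⟨u', hu', hξ⟩ := (mem_isotropyFundamentalSpace_iff hμ hJ x _).1 h2
    rwa [hu'] at hξ
  · intro h
    refine Set.ext fun (v : E) => ?_
    refine (mem_isotropyFundamentalSpace_iff hμ hJ x v).trans
      (Iff.trans ?_ (mem_image_formKer_pullback_iff x v).symm)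
    constructor
    · rintro ⟨u, hu, ξ, hξ⟩
      refine ⟨u, fun w => ?_, hu⟩
      rw [← hξ]
      exact (hμ.mem_range_mdInclusion_iff hJ x _).1 ⟨w, rfl⟩ ξ
    · rintro ⟨u, hu, huv⟩
      exact ⟨u, huv, h u hu⟩

/-- Vectors of the intersection are written as images of vectors `u` of the level set, the form in
which `ker_restrict_iff` applies. -/
lemma formKer_inf_levelTangent_subset_iff (hμ : IsWeaklyRegularValue E J μ F)
    (hJ : IsPoissonianMomentumMap Ω J) (x : LevelSet J μ) :
    ((formKer Ω (inclusion J μ x) ⊓ levelTangent E J μ F x :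
        Submodule ℝ (TangentSpace 𝓘(ℝ, E) (inclusion J μ x))) :
          Set (TangentSpace 𝓘(ℝ, E) (inclusion J μ x))) ⊆
        isotropyFundamentalSpace E μ (inclusion J μ x) ↔
      ∀ u, mdInclusion E F x u ∈ LinearMap.ker (bilin (Ω.model x.1)) →
        ∃ ξ, fund E E_G G x.1 ξ = mdInclusion E F x u := by
  constructor
  · intro h u hu
    have h1 := h (a := mdInclusion E F x u) ⟨(mem_formKer_iff Ω x.1 _).2 hu, u, rfl⟩
    obtain ⟨u', hu', hξ⟩ := (mem_isotropyFundamentalSpace_iff hμ hJ x _).1 h1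
    rwa [hu'] at hξ
  · rintro h v ⟨hv, u, hu⟩
    have hu' : mdInclusion E F x u = v := hu
    refine (mem_isotropyFundamentalSpace_iff hμ hJ x v).2 ⟨u, hu', h u ?_⟩
    rw [hu']
    exact (mem_formKer_iff Ω x.1 v).1 hv

end Kernels

end PresymplecticReduction
end

/-! ### The reduction theorem. -/

open PresymplecticReduction in
theorem mainTheorem1
    -- the manifold
    {E : Type*} [NormedAddCommGroup E] [NormedSpace ℝ E] [FiniteDimensional ℝ E]
    {M : Type*} [TopologicalSpace M] [ChartedSpace E M] [IsManifold 𝓘(ℝ, E) ∞ M]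
    [T2Space M] [SecondCountableTopology M] [ConnectedSpace M]
    -- the Lie group
    {E_G : Type*} [NormedAddCommGroup E_G] [NormedSpace ℝ E_G] [FiniteDimensional ℝ E_G]
    {G : Type*} [TopologicalSpace G] [ChartedSpace E_G G] [Group G] [LieGroup 𝓘(ℝ, E_G) ∞ G]
    [T2Space G] [SecondCountableTopology G] [ConnectedSpace G]
    -- the smooth, proper and free action
    [MulAction G M] [ContMDiffSMul 𝓘(ℝ, E_G) 𝓘(ℝ, E) ∞ G M] [ProperSMul G M]
    (hfree : ∀ (g : G) (x : M), g • x = x → g = 1)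
    -- the presymplectic form, the momentum map and the weakly regular value
    (Ω : TwoForm E M) (hΩ : IsPresymplecticForm Ω) (hact : IsPresymplecticAction G Ω)
    (J : M → Module.Dual ℝ (GroupLieAlgebra 𝓘(ℝ, E_G) G)) (hJ : IsPoissonianMomentumMap Ω J)
    (μ : Module.Dual ℝ (GroupLieAlgebra 𝓘(ℝ, E_G) G))
    {F : Type*} [NormedAddCommGroup F] [NormedSpace ℝ F] [FiniteDimensional ℝ F]
    [ChartedSpace F (LevelSet J μ)] (hμ : IsWeaklyRegularValue E J μ F) :
    -- the isotropy group leaves the level set invariant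
    (∀ g ∈ isotropy μ, ∀ x : M, J x = μ → J (g • x) = μ) ∧
    -- the orbit space is a manifold, and the projection is a submersion
    ∃ (k : ℕ) (_ : ChartedSpace (EuclideanSpace ℝ (Fin k)) (ReducedSpace J μ)),
      IsManifold 𝓘(ℝ, EuclideanSpace ℝ (Fin k)) ∞ (ReducedSpace J μ) ∧
      T2Space (ReducedSpace J μ) ∧ SecondCountableTopology (ReducedSpace J μ) ∧
      ContMDiff 𝓘(ℝ, F) 𝓘(ℝ, EuclideanSpace ℝ (Fin k)) ∞ (proj J μ) ∧
      (∀ x : LevelSet J μ, Function.Surjective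
        (mfderiv 𝓘(ℝ, F) 𝓘(ℝ, EuclideanSpace ℝ (Fin k)) (proj J μ) x)) ∧
      -- the restriction of the form descends to a closed 2-form
      ∃ Ωhat : TwoForm (EuclideanSpace ℝ (Fin k)) (ReducedSpace J μ),
        IsSmoothForm Ωhat ∧ IsClosedForm Ωhat ∧
        (pullback (proj J μ) Ωhat : TwoForm F (LevelSet J μ)) = pullback (inclusion J μ) Ω ∧
        -- when it is symplectic
        (IsSymplecticForm Ωhat ↔ ∀ x : LevelSet J μ,
          isotropyFundamentalSpace E μ (inclusion J μ x) =
            mfderiv 𝓘(ℝ, F) 𝓘(ℝ, E) (inclusion J μ) x ''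
              (formKer (pullback (inclusion J μ) Ω : TwoForm F (LevelSet J μ)) x :
                Set (TangentSpace 𝓘(ℝ, F) x))) ∧
        (∀ x : LevelSet J μ,
          isotropyFundamentalSpace E μ (inclusion J μ x) =
            mfderiv 𝓘(ℝ, F) 𝓘(ℝ, E) (inclusion J μ) x ''
              (formKer (pullback (inclusion J μ) Ω : TwoForm F (LevelSet J μ)) x :
                Set (TangentSpace 𝓘(ℝ, F) x)) ↔
          ((formKer Ω (inclusion J μ x) ⊓ levelTangent E J μ F x :
              Submodule ℝ (TangentSpace 𝓘(ℝ, E) (inclusion J μ x))) :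
                Set (TangentSpace 𝓘(ℝ, E) (inclusion J μ x))) ⊆
            isotropyFundamentalSpace E μ (inclusion J μ x)) ∧
        -- otherwise it is presymplectic
        (¬ IsSymplecticForm Ωhat → IsPresymplecticForm Ωhat) ∧
        -- when the dimension of the kernel is preserved
        (∀ x : LevelSet J μ,
          formKer Ω (inclusion J μ x) ≤ levelTangent E J μ F x →
          fundamentalSpace E_G G E (inclusion J μ x) ∩
            (formKer Ω (inclusion J μ x) : Set (TangentSpace 𝓘(ℝ, E) (inclusion J μ x))) = {0} →
          Module.finrank ℝ (formKer Ωhat (proj J μ x)) =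
            Module.finrank ℝ (formKer Ω (inclusion J μ x))) := by
  have hisM := hμ.isManifold
  obtain ⟨k, d, hk, hd⟩ := hμ.exists_finrank_verticalSpace_eq hJ hfree
  obtain ⟨cs, hman, hσ, hsec⟩ := exists_quotient_manifold (F := F) (orbitSetoid J μ) k
    (isOpenMap_proj (E := E) hJ) (exists_slice hμ hJ hfree hk hd) (fun y y' h => by
      obtain ⟨g, hg⟩ := (orbitSetoid J μ).symm h
      refine ⟨levelSetSmul hJ g, contMDiff_levelSetSmul hμ hJ g, Subtype.ext hg, fun z => ?_⟩
      exact (orbitSetoid_iff hJ _ _).2 ⟨g.1, rfl⟩)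
  have hker := mdProj_eq_zero_iff hμ hJ hσ hsec (fun x => by
    rw [hd x, finrank_euclideanSpace_fin, hk])
  have hsurj := mdProj_surjective hσ hsec
  obtain ⟨Ωhat, hsm, hcl, hpull⟩ :=
    exists_reduced_form hμ hJ hact hΩ.smooth hΩ.closed hσ hsec hker
  have hA : ∀ x : LevelSet J μ, Function.Injective (fund E E_G G x.1) := fun x =>
    fund_injective hfree x.1
  have hrange := hμ.mem_range_mdInclusion_iff hJ
  have hbot : ∀ x : LevelSet J μ, formKer Ωhat (proj J μ x) = ⊥ ↔
      ∀ u, (∀ w, bilin (Ω.model x.1) (mdInclusion E F x u) (mdInclusion E F x w) = 0) →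
        ∃ ξ, fund E E_G G x.1 ξ = mdInclusion E F x u := by
    intro x
    have h1 := ker_reduced_eq_bot_iff (ι := (mdInclusion E F x).toLinearMap)
      (π := (mdProj F (EuclideanSpace ℝ (Fin k)) x).toLinearMap) (hpull x) (hsurj x)
    rw [← formKer_eq] at h1
    refine h1.trans (forall_congr' fun u => imp_congr_right fun _ => hker x u)
  have hdim : ∀ x : LevelSet J μ, Module.finrank ℝ (formKer Ωhat (proj J μ x)) +
      Module.finrank ℝ (LinearMap.range (fund E E_G G x.1).toLinearMap ⊓
        LinearMap.ker (bilin (Ω.model x.1)) : Submodule ℝ E) =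
      Module.finrank ℝ (formKer Ω x.1) := by
    intro x
    rw [finrank_formKer, finrank_formKer]
    exact finrank_ker_reduced_add (bilin_isAlt _) (hA x) (hμ.mdInclusion_injective x) (hrange x)
      (hker x) (hpull x) (hsurj x)
  -- Smoothness and closedness are already known, and `σ` is onto, so only non-degeneracy over
  -- points of the level set remains.
  have hsymp : IsSymplecticForm Ωhat ↔ ∀ x : LevelSet J μ, formKer Ωhat (proj J μ x) = ⊥ :=
    ⟨fun h x => h.nondegenerate _, fun h => ⟨hsm, hcl, fun z => by
      obtain ⟨x, rfl⟩ := Quotient.exists_rep z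
      exact h x⟩⟩
  refine ⟨fun g hg x hx => (hJ.mem_isotropy_iff hx g).1 hg, k, cs, hman,
    t2Space_reducedSpace (E := E) hJ, secondCountableTopology_reducedSpace (E := E) hJ, hσ,
    hsurj, Ωhat, hsm, hcl, ?_, ?_, ?_, ?_, ?_⟩
  · refine funext fun x => ContinuousAlternatingMap.ext fun (w : Fin 2 → F) => ?_
    have h1 := hpull x (w 0) (w 1)
    rw [bilin_apply, bilin_apply] at h1
    rw [vec_two_eq, vec_two_eq] at h1
    exact h1
  · rw [hsymp]
    exact forall_congr' fun x =>
      (hbot x).trans (isotropyFundamentalSpace_eq_iff hμ hJ x).symm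
  · intro x
    rw [isotropyFundamentalSpace_eq_iff hμ hJ, formKer_inf_levelTangent_subset_iff hμ hJ]
    have h1 := ker_restrict_iff (ι := (mdInclusion E F x).toLinearMap)
      (π := (mdProj F (EuclideanSpace ℝ (Fin k)) x).toLinearMap) (bilin_isAlt (Ω.model x.1))
      (hA x) (hμ.mdInclusion_injective x) (hrange x) (hker x)
    refine Iff.trans ?_ (h1.trans ?_)
    · exact forall_congr' fun u => imp_congr_right fun _ => (hker x u).symm
    · exact forall_congr' fun u => imp_congr_right fun _ => hker x u
  · intro hn
    rw [hsymp, not_forall] at hn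
    obtain ⟨x, hx⟩ := hn
    refine ⟨hsm, hcl, Module.finrank ℝ (formKer Ωhat (proj J μ x)), ?_, fun z => ?_⟩
    · exact Nat.pos_of_ne_zero fun h => hx (by
        rw [finrank_formKer, Submodule.finrank_eq_zero, ← formKer_eq] at h
        exact h)
    · obtain ⟨y, rfl⟩ := Quotient.exists_rep z
      obtain ⟨r, -, hr⟩ := hΩ.degenerate
      have h1 := hdim x
      have h2 := hdim y
      -- The dimension of `𝔤̃ ∩ ker Ω` is determined by those of `M`, `G` and the level set, so it
      -- agrees at `x` and `y`; with the constant rank `r` of `ker Ω`, so does that of the reduced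
      -- kernel.
      have h3 := finrank_inf_ker_add_finrank (bilin_isAlt (Ω.model x.1)) (hA x)
        (hμ.mdInclusion_injective x) (hrange x)
      have h4 := finrank_inf_ker_add_finrank (bilin_isAlt (Ω.model y.1)) (hA y)
        (hμ.mdInclusion_injective y) (hrange y)
      rw [hr] at h1 h2
      change Module.finrank ℝ (formKer Ωhat (proj J μ y)) = _
      omega
  · intro x _ hx
    have h1 : (LinearMap.range (fund E E_G G x.1).toLinearMap ⊓
        LinearMap.ker (bilin (Ω.model x.1)) : Submodule ℝ E) = ⊥ := by
      rw [Submodule.eq_bot_iff]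
      rintro v ⟨hv, hv'⟩
      exact (Set.ext_iff.1 hx v).1 ⟨hv, (mem_formKer_iff Ω x.1 v).2 hv'⟩
    have h2 := hdim x
    rw [h1, finrank_bot, add_zero] at h2
    exact h2
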